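/- Let $R$ be a reduced irreducible (crystallographic) root system in a real vector space $\mathfrak h_{\mathbb R}$ with inner product $\langle\cdot,\cdot\rangle$, with simple roots $\alpha_1,\dots,\alpha_n$, positive roots $R^+$, coroots $\alpha^\vee=2\alpha/\langle\alpha,\alpha\rangle$, highest root $\theta$, $\rho=\frac12\sum_{\alpha\in R^+}\alpha$, Weyl group $W_0$ with longest element $w_0$, coweight lattice $P=\{\mu:\langle\mu,\alpha_i\rangle\in\mathbb Z \text{ for all } i\}$ and dominant coweights $P^+=\{\mu:\langle\mu,\alpha_i\rangle\in\mathbb Z_{\ge0}\text{ for all } i\}$. Let $Q^+=\sum_i\mathbb Z_{\ge0}\alpha_i^\vee$ and, for $\lambda\in P^+$, let $\Pi_\lambda=\bigcap_{w\in W_0}w(\lambda-Q^+)$. For $\alpha\in R$, $k\in\mathbb Z$ let $H_{\alpha+k\delta}=\{x:\langle x,\alpha\rangle=-k\}$; for $\alpha\in R^+$ its positive (negative) side is $\langle x,\alpha\rangle\ge-k$ (resp. $\le -k$). Let $c_0=\{x:\langle x,\alpha_i\rangle>0\ (1\le i\le n),\ \langle x,\theta\rangle<1\}$, let $s_1,\dots,s_n$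 be the reflections in $H_{\alpha_1},\dots,H_{\alpha_n}$ and $s_0$ the reflection in $H_{-\theta+\delta}$, let $t_\mu$ be the translation by $\mu$, and let $\tilde W=P\rtimes W_0$. The length $\ell(w)$ of $w\in\tilde W$ is the number of hyperplanes $H_{\alpha+k\delta}$ separating $c_0$ from $wc_0$, and $\Omega=\{w\in\tilde W:\ell(w)=0\}$. A reduced expression $\vec w$ of $w\in\tilde W$ is $w=s_{i_1}\cdots s_{i_\ell}\gamma$ with $\gamma\in\Omega$, $\ell=\ell(w)$. A positively folded alcove walk of type $s_{i_1}\cdots s_{i_\ell}\gamma$ is a sequence of $\ell$ steps starting at $1$, where the $k$th step from the current element $x$, with $s=s_{i_k}$ and $H$ the hyperplane between $xc_0$ and $xsc_0$, is either a crossing $x\to xs$ of $H$ (positive if $xsc_0$ is on the positive side of $H$, negative otherwise), or a fold $x\to x$ on $H$, allowed only if $xc_0$ is on the positive side of $H$; if the steps lead to $v$, then the walk ends at $v\gamma\in\tilde W$. Its dimension $\dim(p)$ is the number of positive crossings plus the number of folds. Let $\lambda\in P^+$ and $\mu\in P$. Fix a reduced expression $\vec m_\lambda$ of the minimal length element $m_\lambda$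 of $W_0t_\lambda W_0$, and a reduced expression $\vec u$ of each $u\in W_0^\lambda$, where $W_0^\lambda$ is the set of minimal length representatives of the cosets in $W_0/W_{0\lambda}$, $W_{0\lambda}$ being the stabilizer of $\lambda$ in $W_0$. For $\nu\in P$ let $\mathcal P(\vec\lambda)_\nu$ be the set of positively folded alcove walks of the types $\vec u\cdot\vec m_\lambda$ (concatenation), $u\in W_0^\lambda$, that end in $t_\nu W_0$. For $1\le i\le n$ the root operator $\tilde e_i$ is defined on positively folded alcove walks $p$ as follows. If $p$ has no negative crossing on a hyperplane $H_{\alpha_i+k\delta}$, $k\in\mathbb Z$, then $\tilde e_i(p)=0$. Otherwise let $k$ be maximal such that $p$ has a negative crossing on $H_\gamma$, $\gamma=\alpha_i+k\delta$. Then $\tilde e_i(p)$ is the walk of the same type in which the first negative crossing on $H_\gamma$ is replaced by a fold, and in which moreover the first later step that is in $p$ a fold on $H_{\gamma+\delta}$ or a positive crossing on $H_\gamma$, if there is one, is changed from a fold to a crossing or from a crossing to a fold, respectively. Put $\tilde e_i(0)=0$. Then the following hold. (1) If $\mu\notin\Pi_\lambda$, then $\mathcal P(\vec\lambda)_\mu=\emptyset$.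 (2) If $\mu\in\Pi_\lambda$, then there is a walk $p\in\mathcal P(\vec\lambda)_\mu$ with $\dim(p)=\langle\lambda+\mu,\rho\rangle$. (3) The set $\mathcal P(\vec\lambda)_{w_0\lambda}$ has exactly one element $p_{w_0\lambda}$. If $\mu\in\Pi_\lambda$ and $w_0=s_{i_1}\cdots s_{i_N}$ is any reduced decomposition, put $\mu_0=\mu$ and, for $1\le k\le N$, $m_k=\max\{m\in\mathbb Z_{\ge0}:\mu_{k-1}-m\alpha_{i_k}^\vee\in\Pi_\lambda\}$ and $\mu_k=\mu_{k-1}-m_k\alpha_{i_k}^\vee$. Then $p=\tilde e_{i_1}^{m_1}\cdots\tilde e_{i_N}^{m_N}(p_{w_0\lambda})$ is nonzero, lies in $\mathcal P(\vec\lambda)_\mu$, and has $\dim(p)=\langle\lambda+\mu,\rho\rangle$. (4) Consequently $\mathcal P(\vec\lambda)_\mu\neq\emptyset$ if and only if $\mu\in\Pi_\lambda$. -/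

import Mathlib

/-!
Positively folded alcove walks for a reduced irreducible crystallographic root system.

The root system is a root system `Φ : RootPairing ι ℝ M N`: the space in which coweights, coroots
and alcoves live is `N`, the roots are linear forms on `N`, and `⟨x, α⟩` is the evaluation of the
root `α` at `x : N`. An affine root `α + kδ` is given by an index `a : ι` and an integer `k`.
-/

noncomputable section

namespace AlcoveWalks

variable {ι M N : Type*} [AddCommGroup M] [Module ℝ M] [AddCommGroup N] [Module ℝ N]
  {Φ : RootPairing ι ℝ M N}

/-- The value `⟨x, α + kδ⟩ = ⟨x, α⟩ + k` of the affine root `α + kδ` at the point `x`. -/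
def affRoot (Φ : RootPairing ι ℝ M N) (a : ι) (k : ℤ) (x : N) : ℝ :=
  Φ.toLinearMap (Φ.root a) x + k

/-- The translation `t_μ`. -/
def trans (μ : N) : N ≃ᵃ[ℝ] N := AffineEquiv.constVAdd ℝ N μ

/-- The reflection `s_{α + kδ}`, namely `t_{-kα^∨} s_α`; see `affRefl_apply`. -/
def affRefl (Φ : RootPairing ι ℝ M N) (a : ι) (k : ℤ) : N ≃ᵃ[ℝ] N :=
  trans (-(k : ℝ) • Φ.coroot a) * (Φ.coreflection a).toAffineEquiv

theorem affRefl_apply (Φ : RootPairing ι ℝ M N) (a : ι) (k : ℤ) (x : N) :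
    affRefl Φ a k x = x - affRoot Φ a k x • Φ.coroot a := by
  simp [affRefl, affRoot, trans, RootPairing.coreflection_apply, add_smul, sub_eq_add_neg,
    add_comm, add_left_comm]

/-- The Weyl group `W₀`, as a group of affine transformations fixing the origin. -/
def weyl (Φ : RootPairing ι ℝ M N) : Subgroup (N ≃ᵃ[ℝ] N) :=
  Subgroup.closure (Set.range fun a => affRefl Φ a 0)

/-- The coweight lattice: the points at which all simple roots are integral. -/
def IsCoweight (b : Φ.Base) (μ : N) : Prop :=
  ∀ i ∈ b.support, ∃ z : ℤ, Φ.toLinearMap (Φ.root i) μ = z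

/-- The dominant coweights. -/
def IsDominant (b : Φ.Base) (μ : N) : Prop :=
  ∀ i ∈ b.support, ∃ z : ℕ, Φ.toLinearMap (Φ.root i) μ = z

/-- `ω` is the fundamental coweight dual to the simple root with index `i`. -/
def IsFundamental (b : Φ.Base) (i : ι) (ω : N) : Prop :=
  Φ.toLinearMap (Φ.root i) ω = 1 ∧
    ∀ j ∈ b.support, j ≠ i → Φ.toLinearMap (Φ.root j) ω = 0

/-- `θ` is the (index of the) highest root. -/
def IsHighestRoot (b : Φ.Base) (θ : ι) : Prop :=
  ∀ i ∈ b.support, ∀ ω, IsFundamental b i ω →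
    ∀ a, Φ.toLinearMap (Φ.root a) ω ≤ Φ.toLinearMap (Φ.root θ) ω

/-- `ρ`, half the sum of the positive roots. -/
def rho [Fintype ι] (b : Φ.Base) : M :=
  open Classical in (1 / 2 : ℝ) • ∑ a with b.IsPos a, Φ.root a

/-- `Q⁺`, the nonnegative integer combinations of the simple coroots. -/
def corootCone (b : Φ.Base) : AddSubmonoid N :=
  AddSubmonoid.closure (Φ.coroot '' b.support)

/-- The saturated set `Π_λ`, the intersection over `w ∈ W₀` of the sets `w(λ - Q⁺)`. -/
def saturatedSet (b : Φ.Base) (lam : N) : Set N :=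
  ⋂ w ∈ weyl Φ, (fun q => w (lam - q)) '' (corootCone b : Set N)

/-! ### Alcoves, hyperplanes and lengths -/

/-- The fundamental alcove `c₀`; the last condition is positivity of `α₀ = -θ + δ`. -/
def fundAlcove (b : Φ.Base) (θ : ι) : Set N :=
  {x | (∀ i ∈ b.support, 0 < affRoot Φ i 0 x) ∧ 0 < -Φ.toLinearMap (Φ.root θ) x + 1}

/-- The alcove `x c₀` lies in the half space `⟨·, α + kδ⟩ ≥ 0`
(the positive side of the hyperplane if `α` is a positive root). -/
def OnPos (b : Φ.Base) (θ : ι) (x : N ≃ᵃ[ℝ] N) (a : ι) (k : ℤ) : Prop :=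
  ∀ v ∈ x '' fundAlcove b θ, 0 ≤ affRoot Φ a k v

/-- The alcove `x c₀` lies in the half space `⟨·, α + kδ⟩ ≤ 0`
(the negative side of the hyperplane if `α` is a positive root). -/
def OnNeg (b : Φ.Base) (θ : ι) (x : N ≃ᵃ[ℝ] N) (a : ι) (k : ℤ) : Prop :=
  ∀ v ∈ x '' fundAlcove b θ, affRoot Φ a k v ≤ 0

/-- The extended affine Weyl group `P ⋊ W₀`, as the set of all `t_μ w`. -/
def extAffWeyl (b : Φ.Base) : Set (N ≃ᵃ[ℝ] N) :=
  {x | ∃ μ, IsCoweight b μ ∧ ∃ w ∈ weyl Φ, x = trans μ * w}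

/-- The length of `w`: the number of hyperplanes separating `c₀` from `w c₀`. Each hyperplane
`H_{α + kδ}` is counted once, as the pair `(α, k)` with `α` positive. -/
def len (b : Φ.Base) (θ : ι) (w : N ≃ᵃ[ℝ] N) : ℕ :=
  {h : ι × ℤ | b.IsPos h.1 ∧
    ((OnPos b θ 1 h.1 h.2 ∧ OnNeg b θ w h.1 h.2) ∨
      (OnNeg b θ 1 h.1 h.2 ∧ OnPos b θ w h.1 h.2))}.ncard

/-- `Ω`, the elements of length zero of the extended affine Weyl group. -/
def lengthZero (b : Φ.Base) (θ : ι) : Set (N ≃ᵃ[ℝ] N) :=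
  {γ | γ ∈ extAffWeyl b ∧ len b θ γ = 0}

/-- The Coxeter generators of the affine Weyl group: `some i` is `s_i` for the simple root with
index `i`, and `none` is `s₀ = s_{-θ + δ} = s_{θ - δ}`. -/
def gen (b : Φ.Base) (θ : ι) : Option b.support → N ≃ᵃ[ℝ] N
  | some i => affRefl Φ i 0
  | none => affRefl Φ θ (-1)

/-- `s_{i₁} ⋯ s_{i_ℓ} γ` is a reduced expression for `w`, with `γ ∈ Ω`. -/
def IsReducedExpr (b : Φ.Base) (θ : ι) (word : List (Option b.support)) (γ w : N ≃ᵃ[ℝ] N) : Prop :=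
  γ ∈ lengthZero b θ ∧ (word.map (gen b θ)).prod * γ = w ∧ word.length = len b θ w

/-- `w₀` is the longest element of `W₀`. -/
def IsLongest (b : Φ.Base) (θ : ι) (w₀ : N ≃ᵃ[ℝ] N) : Prop :=
  w₀ ∈ weyl Φ ∧ ∀ w ∈ weyl Φ, len b θ w ≤ len b θ w₀

/-- `w = s_{i₁} ⋯ s_{i_N}` is a reduced decomposition in the simple reflections of `W₀`. -/
def IsReducedWord (b : Φ.Base) (θ : ι) (word : List b.support) (w : N ≃ᵃ[ℝ] N) : Prop :=
  (word.map fun i => affRefl Φ i 0).prod = w ∧ word.length = len b θ w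

/-- The double coset `W₀ t_λ W₀`. -/
def doubleCoset (Φ : RootPairing ι ℝ M N) (lam : N) : Set (N ≃ᵃ[ℝ] N) :=
  {x | ∃ v ∈ weyl Φ, ∃ w ∈ weyl Φ, x = v * trans lam * w}

/-- `m` is an element of minimal length of `W₀ t_λ W₀`. -/
def IsMinimalIn (b : Φ.Base) (θ : ι) (lam : N) (m : N ≃ᵃ[ℝ] N) : Prop :=
  m ∈ doubleCoset Φ lam ∧ ∀ x ∈ doubleCoset Φ lam, len b θ m ≤ len b θ x

/-- `W₀^λ`: the minimal length representatives of the cosets `u W_{0λ}` in `W₀`, where `W_{0λ}` is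
the stabilizer of `λ` in `W₀`. -/
def minReps (b : Φ.Base) (θ : ι) (lam : N) : Set (N ≃ᵃ[ℝ] N) :=
  {u | u ∈ weyl Φ ∧ ∀ v ∈ weyl Φ, v lam = lam → len b θ u ≤ len b θ (u * v)}

/-! ### Alcove walks -/

/-- At each step a walk crosses the wall of the given type or is folded back at it. -/
inductive Move
  | cross
  | fold

/-- The exchange of crossings and folds. -/
def Move.toggle : Move → Move
  | .cross => .fold
  | .fold => .cross

/-- A (folded) alcove walk starting at `1`: the list of its steps, each given by the type of the
wall it meets there and by what it does, and the sheet `γ` to which it jumps at the end. -/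
structure Walk (b : Φ.Base) where
  steps : List (Option b.support × Move)
  sheet : N ≃ᵃ[ℝ] N

namespace Walk

variable {b : Φ.Base} (θ : ι) (p : Walk b)

/-- The alcove reached after the first `k` steps: a crossing of type `s` leads from `x` to `xs`,
a fold stays at `x`. -/
def pos (k : ℕ) : N ≃ᵃ[ℝ] N :=
  ((p.steps.take k).map fun st => match st.2 with
    | .cross => gen b θ st.1
    | .fold => 1).prod

/-- The end alcove in the extended affine Weyl group. -/
def endAlcove : N ≃ᵃ[ℝ] N := p.pos θ p.steps.length * p.sheet

/-- The step with number `k` (counted from `0`) crosses `H_{α + jδ}` from the negative to the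
positive side (where `α` is positive). -/
def PosCrossingOn (k : ℕ) (a : ι) (j : ℤ) : Prop :=
  ∃ s, p.steps[k]? = some (s, Move.cross) ∧
    OnNeg b θ (p.pos θ k) a j ∧ OnPos b θ (p.pos θ k * gen b θ s) a j

/-- The step with number `k` crosses `H_{α + jδ}` from the positive to the negative side. -/
def NegCrossingOn (k : ℕ) (a : ι) (j : ℤ) : Prop :=
  ∃ s, p.steps[k]? = some (s, Move.cross) ∧
    OnPos b θ (p.pos θ k) a j ∧ OnNeg b θ (p.pos θ k * gen b θ s) a j

/-- The step with number `k` is a positive fold on `H_{α + jδ}`: the walk is at an alcove `x` on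
the positive side, `xs` is on the negative side, and the walk stays at `x`. -/
def PosFoldOn (k : ℕ) (a : ι) (j : ℤ) : Prop :=
  ∃ s, p.steps[k]? = some (s, Move.fold) ∧
    OnPos b θ (p.pos θ k) a j ∧ OnNeg b θ (p.pos θ k * gen b θ s) a j

/-- All folds are positive. -/
def PositivelyFolded : Prop :=
  ∀ k s, p.steps[k]? = some (s, Move.fold) → ∃ a j, b.IsPos a ∧ p.PosFoldOn θ k a j

/-- The dimension: the number of positive crossings plus the number of folds. -/
def dim : ℕ :=
  {k : ℕ | ∃ a j, b.IsPos a ∧ p.PosCrossingOn θ k a j}.ncard +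
    {k : ℕ | ∃ s, p.steps[k]? = some (s, Move.fold)}.ncard

/-! ### Root operators -/

/-- `H_{α_i + jδ}` is the `i`-critical hyperplane of `p`, and step `k` is its `i`-critical
crossing: `j` is maximal such that `p` has a negative crossing on `H_{α_i + jδ}`, and the step
with number `k` is the first such crossing. -/
def IsCritical (i : ι) (k : ℕ) (j : ℤ) : Prop :=
  IsGreatest {j' : ℤ | ∃ k', p.NegCrossingOn θ k' i j'} j ∧
    IsLeast {k' : ℕ | p.NegCrossingOn θ k' i j} k

/-- After the critical crossing at step `k`, step `k'` is the first one that is a fold on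
`H_{α_i + (j+1)δ}` or a positive crossing on `H_{α_i + jδ}`. -/
def IsReturn (i : ι) (k : ℕ) (j : ℤ) (k' : ℕ) : Prop :=
  IsLeast {l : ℕ | k < l ∧ (p.PosFoldOn θ l i (j + 1) ∨ p.PosCrossingOn θ l i j)} k'

/-- Exchange crossing and fold at step `k`, keeping the type of the walk. The part of the walk
after that step is thereby reflected in the hyperplane met at that step. -/
def toggleAt (k : ℕ) : Walk b where
  steps := p.steps.modify k fun st => (st.1, st.2.toggle)
  sheet := p.sheet

open Classical in
/-- The raising operator `ẽ_i`, with `none` for the value `0`. The critical crossing on `H_γ`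
becomes a fold, so that the following part of the walk is reflected in `H_γ`. At the first later
fold on `H_{γ+δ}` or positive crossing on `H_γ`, if there is one, a fold becomes a positive
crossing (the rest of the walk is then translated by `α_i^∨`), and a positive crossing becomes a
fold (the rest of the walk is then unchanged). -/
def rootOp (i : ι) : Option (Walk b) :=
  if hc : ∃ c : ℕ × ℤ, p.IsCritical θ i c.1 c.2 then
    if hr : ∃ k', p.IsReturn θ i hc.choose.1 hc.choose.2 k' then
      some ((p.toggleAt hc.choose.1).toggleAt hr.choose)
    else some (p.toggleAt hc.choose.1)
  else none

end Walk

/-- The power `ẽ_i^m`, extended by `ẽ_i(0) = 0`. -/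
def rootOpPow {b : Φ.Base} (θ : ι) (i : ι) (m : ℕ) (p : Option (Walk b)) : Option (Walk b) :=
  (fun q : Option (Walk b) => q.bind fun r => r.rootOp θ i)^[m] p

/-- The largest `m ≥ 0` with `ν - m α_i^∨ ∈ Π_λ`. -/
def maxStep (b : Φ.Base) (lam ν : N) (i : ι) : ℕ :=
  sSup {m : ℕ | ν - m • Φ.coroot i ∈ saturatedSet b lam}

/-- For a word `i₁, …, i_N` the walk `ẽ_{i₁}^{m₁} ⋯ ẽ_{i_N}^{m_N}(p)`, where `μ₀ = μ`,
`m_k = maxStep` of `μ_{k-1}` in the direction `i_k`, and `μ_k = μ_{k-1} - m_k α_{i_k}^∨`. -/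
def stringWalk {b : Φ.Base} (θ : ι) (lam : N) (p : Walk b) : N → List b.support → Option (Walk b)
  | _, [] => some p
  | μ, i :: word => rootOpPow θ i (maxStep b lam μ i)
      (stringWalk θ lam p (μ - maxStep b lam μ i • Φ.coroot i) word)

/-- The set `𝒫(λ⃗)_μ` of positively folded alcove walks of the types `u⃗ · m⃗_λ`, `u ∈ W₀^λ`, with
end alcove in `t_μ W₀`. Here `m⃗_λ` is the word `mword` followed by `γ ∈ Ω`, and `u⃗` is `uword u`. -/
def walkSet (b : Φ.Base) (θ : ι) (lam : N) (mword : List (Option b.support)) (γ : N ≃ᵃ[ℝ] N)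
    (uword : (N ≃ᵃ[ℝ] N) → List (Option b.support)) (μ : N) : Set (Walk b) :=
  {p | p.PositivelyFolded θ ∧
    (∃ u ∈ minReps b θ lam, p.steps.map Prod.fst = uword u ++ mword ∧ p.sheet = γ) ∧
    ∃ w ∈ weyl Φ, p.endAlcove θ = trans μ * w}

end AlcoveWalks

end

/-!
The length of `x` is measured by its levels: a root takes values between two consecutive integers
on the alcove `x c₀`, and each hyperplane that separates this alcove from `c₀` is counted by the
distance between the levels of `x` and of `1`.

Folding a walk moves its end down in the Bruhat order. The ends of walks of type `u⃗ · m⃗_λ` are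
therefore below `u m_λ`, which places their translation parts in `Π_λ`. Each fold of a positively
folded walk enlarges the set of positive roots that the linear part of the end makes negative, and
counting these gives `dim p ≤ ⟨λ + ν, ρ⟩` for every walk `p` ending in `t_ν W₀`.

The root operator `ẽ_i` raises the dimension by one and moves the end by `0` or `α_i^∨`. On a walk
attaining the bound the shift `0` would violate it, so the result attains the bound at `ν + α_i^∨`.
Descending from `μ` along maximal `α_i^∨`-strings in `Π_λ` for the letters of a reduced word of
`w₀` produces points that are extremal for larger and larger sets of positive roots, and the last
of them is `w₀ λ`. There the bound is `0`, so the walk has no folds and no positive crossings and is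
unique. On the way back up the strings, the level at the end of each walk is low enough for the
required power of `ẽ_i` to be nonzero.
-/

noncomputable section

namespace AlcoveWalks

variable {ι M N : Type*} [AddCommGroup M] [Module ℝ M] [AddCommGroup N] [Module ℝ N]
  {Φ : RootPairing ι ℝ M N}

/-! ### Roots, positivity and the highest root -/

/-- The index of the root `-a`. -/
def opp (Φ : RootPairing ι ℝ M N) (a : ι) : ι := Φ.reflectionPerm a a

theorem root_opp (a : ι) : Φ.root (opp Φ a) = -Φ.root a := by simp [opp]

theorem coroot_opp (a : ι) : Φ.coroot (opp Φ a) = -Φ.coroot a := by simp [opp]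

theorem root'_opp (a : ι) (v : N) : Φ.root' (opp Φ a) v = -Φ.root' a v := by
  rw [RootPairing.root', root_opp, map_neg, LinearMap.neg_apply]

theorem opp_involutive : Function.Involutive (opp Φ) := fun a =>
  Φ.root.injective (by rw [root_opp, root_opp, neg_neg])

theorem reflectionPerm_opp (c a : ι) :
    Φ.reflectionPerm c (opp Φ a) = opp Φ (Φ.reflectionPerm c a) :=
  Φ.root.injective (by
    rw [root_opp, Φ.root_reflectionPerm, Φ.root_reflectionPerm, root_opp, map_neg])

theorem isPos_opp (b : Φ.Base) (a : ι) : b.IsPos (opp Φ a) ↔ ¬ b.IsPos a :=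
  RootPairing.Base.IsPos.neg_iff_not b a

theorem root'_ext {a c : ι} (h : ∀ v, Φ.root' a v = Φ.root' c v) : a = c :=
  Φ.root.injective ((LinearMap.IsPerfPair.bijective_left Φ.toLinearMap).1 (LinearMap.ext h))

theorem root_mem_closure_of_isPos {b : Φ.Base} {a : ι} (ha : b.IsPos a) :
    Φ.root a ∈ AddSubmonoid.closure (Φ.root '' b.support) := by
  obtain ⟨f, -, hf | hf⟩ := b.exists_root_eq_sum_nat_or_neg a
  · exact hf ▸ sum_mem fun j hj =>
      nsmul_mem (AddSubmonoid.subset_closure (Set.mem_image_of_mem _ hj)) _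
  · have hheight : b.height a = ∑ j ∈ b.support, -(f j : ℤ) :=
      RootPairing.Base.height_eq_sum (by simp [hf])
    have hnonpos : b.height a ≤ 0 := hheight ▸ Finset.sum_nonpos fun j _ => by simp
    exact absurd ha hnonpos.not_gt

theorem root'_nonneg_of_isPos {b : Φ.Base} {a : ι} (ha : b.IsPos a) {v : N}
    (hv : ∀ i ∈ b.support, 0 ≤ Φ.root' i v) : 0 ≤ Φ.root' a v := by
  refine AddSubmonoid.closure_induction (motive := fun x _ => 0 ≤ Φ.toLinearMap x v) ?_ (by simp)
    (fun x y _ _ hx hy => ?_) (root_mem_closure_of_isPos ha)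
  · rintro - ⟨i, hi, rfl⟩
    exact hv i hi
  · rw [map_add, LinearMap.add_apply]
    exact add_nonneg hx hy

section IsCrystallographic

variable [Φ.IsCrystallographic]

theorem root'_coroot (a c : ι) : Φ.root' a (Φ.coroot c) = Φ.pairingIn ℤ a c :=
  (Φ.algebraMap_pairingIn ℤ a c).symm

theorem root'_reflectionPerm (c a : ι) (v : N) :
    Φ.root' (Φ.reflectionPerm c a) v = Φ.root' a v - Φ.pairingIn ℤ a c * Φ.root' c v := by
  rw [← root'_coroot, RootPairing.root', Φ.root_reflectionPerm, Φ.reflection_apply, map_sub,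
    map_smul, LinearMap.sub_apply, LinearMap.smul_apply, smul_eq_mul]
  rfl

theorem exists_root'_le_of_isPos [Finite ι] {b : Φ.Base} {a : ι} (ha : b.IsPos a) {v : N}
    (hv : ∀ i ∈ b.support, 0 ≤ Φ.root' i v) : ∃ i ∈ b.support, Φ.root' i v ≤ Φ.root' a v := by
  refine ha.induction_on_add (p := fun c => ∃ i ∈ b.support, Φ.root' i v ≤ Φ.root' c v)
    (fun i hi => ⟨i, hi, le_rfl⟩) ?_
  rintro c j d hd ⟨i, hi, hic⟩ hj
  refine ⟨i, hi, hic.trans ?_⟩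
  rw [RootPairing.root', RootPairing.root', hd, map_add, LinearMap.add_apply]
  exact le_add_of_nonneg_right (hv j hj)

variable [Finite ι] [Φ.IsReduced] {b : Φ.Base}

theorem isPos_reflectionPerm_simple {i a : ι} (hi : i ∈ b.support) (h : a ≠ i)
    (h' : a ≠ opp Φ i) : b.IsPos (Φ.reflectionPerm i a) ↔ b.IsPos a := by
  by_cases ha : b.IsPos a
  · exact iff_of_true (ha.reflectionPerm hi h) ha
  · refine iff_of_false ?_ ha
    rw [← isPos_opp] at ha
    rw [← isPos_opp, ← reflectionPerm_opp]
    exact ha.reflectionPerm hi fun e => h' (opp_involutive.eq_iff.1 e)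

theorem isPos_flip_iff (a : ι) : b.flip.IsPos a ↔ b.IsPos a := by
  have := Module.IsReflexive.of_isPerfPair Φ.toLinearMap
  have := Module.IsReflexive.of_isPerfPair Φ.toLinearMap.flip
  have hopp : ∀ c, (b.flip.IsPos c ↔ b.IsPos c) → (b.flip.IsPos (opp Φ c) ↔ b.IsPos (opp Φ c)) :=
    fun c hc => (isPos_opp b.flip c).trans ((not_congr hc).trans (isPos_opp b c).symm)
  have hsimple : ∀ i ∈ b.support, b.flip.IsPos i ↔ b.IsPos i := fun i hi =>
    iff_of_true (RootPairing.Base.isPos_of_mem_support (b := b.flip) hi)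
      (RootPairing.Base.isPos_of_mem_support hi)
  refine b.induction_reflect (p := fun c => b.flip.IsPos c ↔ b.IsPos c) a hopp hsimple ?_
  intro c j hc hj
  by_cases hcj : c = j
  · subst hcj
    exact hopp c hc
  by_cases hcj' : c = opp Φ j
  · rw [hcj', reflectionPerm_opp]
    change b.flip.IsPos (opp Φ (opp Φ j)) ↔ b.IsPos (opp Φ (opp Φ j))
    rw [opp_involutive]
    exact hsimple j hj
  · rw [isPos_reflectionPerm_simple hj hcj hcj', ← hc]
    exact isPos_reflectionPerm_simple (Φ := Φ.flip) (b := b.flip) hj hcj hcj'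

theorem coroot_mem_corootCone {a : ι} (ha : b.IsPos a) : Φ.coroot a ∈ corootCone b :=
  root_mem_closure_of_isPos (Φ := Φ.flip) (b := b.flip) ((isPos_flip_iff a).2 ha)

end IsCrystallographic

section FundamentalCoweights

variable [Φ.IsRootSystem] (b : Φ.Base)

/-- The fundamental coweights, the basis of `N` dual to the simple roots. -/
def fundCoweight (i : b.support) : N :=
  Φ.toLinearMap.flip.toPerfPair.symm (b.toWeightBasis.coord i)

theorem root'_fundCoweight (a : ι) (i : b.support) :
    Φ.root' a (fundCoweight b i) = b.toWeightBasis.repr (Φ.root a) i :=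
  LinearMap.apply_toPerfPair_flip Φ.toLinearMap _ _

theorem root'_simple_fundCoweight [DecidableEq b.support] (i j : b.support) :
    Φ.root' i (fundCoweight b j) = if i = j then 1 else 0 := by
  rw [root'_fundCoweight, RootPairing.Base.toWeightBasis_repr_root, Finsupp.single_apply]

theorem isFundamental_fundCoweight (i : b.support) : IsFundamental b i (fundCoweight b i) := by
  classical
  refine ⟨(root'_simple_fundCoweight b i i).trans (if_pos rfl), fun j hj hji => ?_⟩
  exact (root'_simple_fundCoweight b ⟨j, hj⟩ i).trans (if_neg fun e => hji (congrArg Subtype.val e))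

theorem root'_simple_fundCoweight_nonneg (i : b.support) :
    ∀ j ∈ b.support, 0 ≤ Φ.root' j (fundCoweight b i) := by
  classical
  intro j hj
  rw [root'_simple_fundCoweight b ⟨j, hj⟩ i]
  split_ifs <;> norm_num

theorem root'_eq_sum_fundCoweight (a : ι) (v : N) :
    Φ.root' a v = ∑ i : b.support, Φ.root' a (fundCoweight b i) * Φ.root' i v := by
  conv_lhs => rw [RootPairing.root', ← b.toWeightBasis.sum_repr (Φ.root a)]
  simp only [map_sum, map_smul, LinearMap.sum_apply, LinearMap.smul_apply, smul_eq_mul,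
    RootPairing.Base.toWeightBasis_apply, root'_fundCoweight]

/-- The sum `ρ^∨` of the fundamental coweights; its value at a root is the height of that root. -/
def rhoVee : N := ∑ i : b.support, fundCoweight b i

theorem root'_simple_rhoVee {i : ι} (hi : i ∈ b.support) : Φ.root' i (rhoVee b) = 1 := by
  classical
  rw [rhoVee, map_sum]
  simp only [root'_simple_fundCoweight b ⟨i, hi⟩, Finset.sum_ite_eq, Finset.mem_univ, if_true]

theorem root'_rhoVee (a : ι) : Φ.root' a (rhoVee b) = b.height a := by
  obtain ⟨f, -, -, hf⟩ := b.exists_root_eq_sum_int a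
  rw [RootPairing.Base.height_eq_sum hf, RootPairing.root', hf]
  simp only [map_sum, map_zsmul, LinearMap.sum_apply, LinearMap.smul_apply, zsmul_eq_mul,
    Int.cast_sum]
  exact Finset.sum_congr rfl fun j hj => by
    rw [show Φ.toLinearMap (Φ.root j) (rhoVee b) = 1 from root'_simple_rhoVee b hj, mul_one]

variable {b}

theorem root'_simple_rhoVee_nonneg : ∀ i ∈ b.support, 0 ≤ Φ.root' i (rhoVee b) :=
  fun _ hi => zero_le_one.trans_eq (root'_simple_rhoVee b hi).symm

theorem isPos_iff_root'_rhoVee_pos {a : ι} : b.IsPos a ↔ 0 < Φ.root' a (rhoVee b) := by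
  rw [root'_rhoVee, RootPairing.Base.isPos_iff]
  exact Int.cast_pos.symm

end FundamentalCoweights

section HighestRoot

variable [Φ.IsRootSystem] {b : Φ.Base} {θ : ι}

theorem IsHighestRoot.root'_le (hθ : IsHighestRoot b θ) (a : ι) {v : N}
    (hv : ∀ i ∈ b.support, 0 ≤ Φ.root' i v) : Φ.root' a v ≤ Φ.root' θ v := by
  rw [root'_eq_sum_fundCoweight b a, root'_eq_sum_fundCoweight b θ]
  exact Finset.sum_le_sum fun i _ => mul_le_mul_of_nonneg_right
    (hθ i i.2 _ (isFundamental_fundCoweight b i) a) (hv i i.2)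

theorem IsHighestRoot.isPos (hθ : IsHighestRoot b θ) : b.IsPos θ := by
  have hle := hθ.root'_le (opp Φ θ) (root'_simple_rhoVee_nonneg (Φ := Φ) (b := b))
  by_contra hneg
  rw [← isPos_opp, isPos_iff_root'_rhoVee_pos] at hneg
  linarith [root'_opp (Φ := Φ) θ (rhoVee b)]

variable [Φ.IsCrystallographic]

theorem IsHighestRoot.pairingIn_simple_nonneg [Finite ι] (hθ : IsHighestRoot b θ) {i : ι}
    (hi : i ∈ b.support) : 0 ≤ Φ.pairingIn ℤ i θ := by
  have hω : Φ.root' i (fundCoweight b ⟨i, hi⟩) = 1 := (isFundamental_fundCoweight b ⟨i, hi⟩).1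
  have hle := hθ.root'_le (Φ.reflectionPerm i θ) (root'_simple_fundCoweight_nonneg b ⟨i, hi⟩)
  rw [root'_reflectionPerm, hω] at hle
  have hθi : (0 : ℝ) ≤ Φ.pairingIn ℤ θ i := by linarith
  by_contra! hlt
  exact absurd (Int.cast_nonneg_iff.1 hθi) ((Φ.pairingIn_lt_zero_iff ℤ).1 hlt).not_ge

theorem IsHighestRoot.pairingIn_nonneg [Finite ι] (hθ : IsHighestRoot b θ) {a : ι}
    (ha : b.IsPos a) : 0 ≤ Φ.pairingIn ℤ a θ := by
  have hnonneg := root'_nonneg_of_isPos ha (v := Φ.coroot θ) fun i hi => by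
    rw [root'_coroot]
    exact Int.cast_nonneg (hθ.pairingIn_simple_nonneg hi)
  rwa [root'_coroot, Int.cast_nonneg_iff] at hnonneg

-- If `⟨θ^∨, a⟩ ≥ 2` then `-s_θ a = ⟨θ^∨, a⟩θ - a ≤ θ` and `a ≤ θ` leave only `a = θ`.
theorem IsHighestRoot.pairingIn_le_one (hθ : IsHighestRoot b θ) {a : ι} (ha : a ≠ θ) :
    Φ.pairingIn ℤ a θ ≤ 1 := by
  by_contra! hpair
  have hpair' : (2 : ℝ) ≤ Φ.pairingIn ℤ a θ := by exact_mod_cast hpair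
  have heq : ∀ v, (∀ i ∈ b.support, 0 ≤ Φ.root' i v) → Φ.root' a v = Φ.root' θ v := by
    intro v hv
    have hrefl := hθ.root'_le (opp Φ (Φ.reflectionPerm θ a)) hv
    rw [root'_opp, root'_reflectionPerm] at hrefl
    nlinarith [hθ.root'_le a hv, root'_nonneg_of_isPos hθ.isPos hv]
  refine ha (root'_ext (Φ := Φ) fun v => ?_)
  rw [root'_eq_sum_fundCoweight b a, root'_eq_sum_fundCoweight b θ]
  exact Finset.sum_congr rfl fun i _ => by rw [heq _ (root'_simple_fundCoweight_nonneg b i)]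

end HighestRoot

/-! ### Affine automorphisms of the affine root system -/

/-- Composing the affine map `x` with the root `a` gives the affine root `c + kδ`, and `x` carries
the coroot of `c` to that of `a`. -/
structure IsPullback (Φ : RootPairing ι ℝ M N) (x : N ≃ᵃ[ℝ] N) (a c : ι) (k : ℤ) : Prop where
  root'_apply (v : N) : Φ.root' a (x v) = Φ.root' c v + k
  apply_add_smul (v : N) (t : ℝ) : x (v + t • Φ.coroot c) = x v + t • Φ.coroot a

theorem mul_apply (x y : N ≃ᵃ[ℝ] N) (v : N) : (x * y) v = x (y v) := rfl

theorem apply_inv_apply (x : N ≃ᵃ[ℝ] N) (v : N) : x (x⁻¹ v) = v := x.apply_symm_apply v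

theorem inv_apply_apply (x : N ≃ᵃ[ℝ] N) (v : N) : x⁻¹ (x v) = v := x.symm_apply_apply v

theorem root'_ext_of_eq_add_const {a c : ι} {r : ℝ} (h : ∀ v, Φ.root' a v = Φ.root' c v + r) :
    a = c ∧ r = 0 := by
  have hr : r = 0 := by simpa only [map_zero, zero_add, eq_comm] using h 0
  exact ⟨root'_ext (Φ := Φ) fun v => by rw [h, hr, add_zero], hr⟩

namespace IsPullback

variable {x y : N ≃ᵃ[ℝ] N} {a c d : ι} {k l : ℤ}

theorem one (a : ι) : IsPullback Φ 1 a a 0 := ⟨fun v => by simp, fun v t => by simp⟩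

theorem mul (hx : IsPullback Φ x a c k) (hy : IsPullback Φ y c d l) :
    IsPullback Φ (x * y) a d (k + l) := by
  refine ⟨fun v => ?_, fun v t => ?_⟩
  · rw [mul_apply, hx.root'_apply, hy.root'_apply, Int.cast_add]
    ring
  · rw [mul_apply, mul_apply, hy.apply_add_smul, hx.apply_add_smul]

theorem inv (hx : IsPullback Φ x a c k) : IsPullback Φ x⁻¹ c a (-k) := by
  refine ⟨fun v => ?_, fun v t => x.injective ?_⟩
  · rw [← apply_inv_apply x v, hx.root'_apply, inv_apply_apply, Int.cast_neg]
    ring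
  · rw [apply_inv_apply, hx.apply_add_smul, apply_inv_apply]

theorem eq_and_eq (h : IsPullback Φ x a c k) (h' : ∀ v, Φ.root' a (x v) = Φ.root' d v + l) :
    c = d ∧ k = l := by
  have hr : ∀ v, Φ.root' c v = Φ.root' d v + (l - k : ℝ) := fun v => by
    linarith [h.root'_apply v, h' v]
  obtain ⟨hcd, hlk⟩ := root'_ext_of_eq_add_const hr
  exact ⟨hcd, by exact_mod_cast (sub_eq_zero.1 hlk).symm⟩

theorem left_unique (h : IsPullback Φ x a d k) (h' : IsPullback Φ x c d l) : a = c := by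
  have hr : ∀ v, Φ.root' a v = Φ.root' c v + (k - l : ℝ) := fun v => by
    rw [← apply_inv_apply x v, h.root'_apply, h'.root'_apply]
    ring
  exact (root'_ext_of_eq_add_const hr).1

end IsPullback

/-- The group of affine automorphisms of the affine root system. -/
def affRootAut [Finite ι] (Φ : RootPairing ι ℝ M N) : Subgroup (N ≃ᵃ[ℝ] N) where
  carrier := {x | ∀ a, ∃ c k, IsPullback Φ x a c k}
  mul_mem' := by
    intro x y hx hy a
    obtain ⟨c, k, hc⟩ := hx a
    obtain ⟨d, l, hd⟩ := hy c
    exact ⟨d, _, hc.mul hd⟩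
  one_mem' a := ⟨a, 0, .one a⟩
  inv_mem' := by
    intro x hx a
    choose f k hf using hx
    have hinj : Function.Injective f := fun c d hcd => (hf c).left_unique (hcd ▸ hf d)
    obtain ⟨c, rfl⟩ := Finite.surjective_of_injective hinj a
    exact ⟨c, -k c, (hf c).inv⟩

/-- The index of the root `c` such that `x` pulls the root `a` back to an affine root `c + kδ`. -/
def pull (Φ : RootPairing ι ℝ M N) (x : N ≃ᵃ[ℝ] N) (a : ι) : ι :=
  open Classical in if h : ∃ c k, IsPullback Φ x a c k then h.choose else a

/-- The integer `k` such that `x` pulls the root `a` back to an affine root `c + kδ`. -/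
def shift (Φ : RootPairing ι ℝ M N) (x : N ≃ᵃ[ℝ] N) (a : ι) : ℤ :=
  open Classical in if h : ∃ c k, IsPullback Φ x a c k then h.choose_spec.choose else 0

section Pull

variable [Finite ι] {x y : N ≃ᵃ[ℝ] N}

theorem isPullback_pull (hx : x ∈ affRootAut Φ) (a : ι) :
    IsPullback Φ x a (pull Φ x a) (shift Φ x a) := by
  have h : ∃ c k, IsPullback Φ x a c k := hx a
  rw [pull, shift, dif_pos h, dif_pos h]
  exact h.choose_spec.choose_spec

theorem root'_apply (hx : x ∈ affRootAut Φ) (a : ι) (v : N) :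
    Φ.root' a (x v) = Φ.root' (pull Φ x a) v + shift Φ x a :=
  (isPullback_pull hx a).root'_apply v

theorem map_add_smul_coroot_pull (hx : x ∈ affRootAut Φ) (a : ι) (v : N) (t : ℝ) :
    x (v + t • Φ.coroot (pull Φ x a)) = x v + t • Φ.coroot a :=
  (isPullback_pull hx a).apply_add_smul v t

theorem shift_eq_root'_apply_zero (hx : x ∈ affRootAut Φ) (a : ι) :
    (shift Φ x a : ℝ) = Φ.root' a (x 0) := by
  rw [root'_apply hx, map_zero, zero_add]

theorem pull_eq (hx : x ∈ affRootAut Φ) {a c : ι} {k : ℤ}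
    (h : ∀ v, Φ.root' a (x v) = Φ.root' c v + k) : pull Φ x a = c :=
  ((isPullback_pull hx a).eq_and_eq h).1

theorem shift_eq (hx : x ∈ affRootAut Φ) {a c : ι} {k : ℤ}
    (h : ∀ v, Φ.root' a (x v) = Φ.root' c v + k) : shift Φ x a = k :=
  ((isPullback_pull hx a).eq_and_eq h).2

theorem pull_mul (hx : x ∈ affRootAut Φ) (hy : y ∈ affRootAut Φ) (a : ι) :
    pull Φ (x * y) a = pull Φ y (pull Φ x a) :=
  pull_eq (mul_mem hx hy) ((isPullback_pull hx a).mul (isPullback_pull hy _)).root'_apply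

theorem shift_mul (hx : x ∈ affRootAut Φ) (hy : y ∈ affRootAut Φ) (a : ι) :
    shift Φ (x * y) a = shift Φ x a + shift Φ y (pull Φ x a) :=
  shift_eq (mul_mem hx hy) ((isPullback_pull hx a).mul (isPullback_pull hy _)).root'_apply

theorem pull_one (a : ι) : pull Φ 1 a = a := pull_eq (one_mem _) (IsPullback.one a).root'_apply

theorem shift_one (a : ι) : shift Φ 1 a = 0 := shift_eq (one_mem _) (IsPullback.one a).root'_apply

theorem pull_pull_inv (hx : x ∈ affRootAut Φ) (a : ι) : pull Φ x (pull Φ x⁻¹ a) = a := by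
  rw [← pull_mul (inv_mem hx) hx, inv_mul_cancel, pull_one]

theorem pull_inv_pull (hx : x ∈ affRootAut Φ) (a : ι) : pull Φ x⁻¹ (pull Φ x a) = a := by
  rw [← pull_mul hx (inv_mem hx), mul_inv_cancel, pull_one]

theorem pull_injective (hx : x ∈ affRootAut Φ) : Function.Injective (pull Φ x) :=
  Function.LeftInverse.injective (pull_inv_pull hx)

theorem root'_opp_apply (hx : x ∈ affRootAut Φ) (a : ι) (v : N) :
    Φ.root' (opp Φ a) (x v) = Φ.root' (opp Φ (pull Φ x a)) v + (-shift Φ x a : ℤ) := by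
  rw [root'_opp, root'_opp, root'_apply hx, Int.cast_neg]
  ring

theorem pull_opp (hx : x ∈ affRootAut Φ) (a : ι) : pull Φ x (opp Φ a) = opp Φ (pull Φ x a) :=
  pull_eq hx (root'_opp_apply hx a)

theorem shift_opp (hx : x ∈ affRootAut Φ) (a : ι) : shift Φ x (opp Φ a) = -shift Φ x a :=
  shift_eq hx (root'_opp_apply hx a)

end Pull

theorem trans_apply (μ v : N) : trans μ v = μ + v := rfl

section Trans

variable [Finite ι] {μ : N}

theorem trans_mem_affRootAut (h : ∀ a, ∃ z : ℤ, Φ.root' a μ = z) : trans μ ∈ affRootAut Φ := by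
  intro a
  obtain ⟨z, hz⟩ := h a
  refine ⟨a, z, fun v => ?_, fun v t => ?_⟩
  · rw [trans_apply, map_add, hz, add_comm]
  · rw [trans_apply, trans_apply, add_assoc]

theorem pull_trans (h : trans μ ∈ affRootAut Φ) (a : ι) : pull Φ (trans μ) a = a := by
  refine pull_eq (k := shift Φ (trans μ) a) h fun v => ?_
  rw [shift_eq_root'_apply_zero h, trans_apply, trans_apply, add_zero, map_add, add_comm]

end Trans

section Reflections

theorem affRefl_apply_root' (c : ι) (j : ℤ) (v : N) :
    affRefl Φ c j v = v - (Φ.root' c v + j) • Φ.coroot c := affRefl_apply Φ c j v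

theorem affRefl_mul_self (c : ι) (j : ℤ) : affRefl Φ c j * affRefl Φ c j = 1 := by
  ext v
  rw [mul_apply, AffineEquiv.coe_one, id, affRefl_apply_root', affRefl_apply_root', map_sub,
    map_smul, Φ.root'_coroot_eq_pairing, Φ.pairing_same, smul_eq_mul]
  module

theorem affRefl_mul_cancel_left (c : ι) (j : ℤ) (x : N ≃ᵃ[ℝ] N) :
    affRefl Φ c j * (affRefl Φ c j * x) = x := by
  rw [← mul_assoc, affRefl_mul_self, one_mul]

theorem affRefl_opp (c : ι) (j : ℤ) : affRefl Φ (opp Φ c) (-j) = affRefl Φ c j := by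
  ext v
  rw [affRefl_apply_root', affRefl_apply_root', root'_opp, coroot_opp, Int.cast_neg]
  module

theorem affRefl_mem_weyl (a : ι) : affRefl Φ a 0 ∈ weyl Φ := Subgroup.subset_closure ⟨a, rfl⟩

theorem mul_affRefl_pull [Finite ι] {x : N ≃ᵃ[ℝ] N} (hx : x ∈ affRootAut Φ) (c : ι) (j : ℤ) :
    x * affRefl Φ (pull Φ x c) (j + shift Φ x c) = affRefl Φ c j * x := by
  ext v
  rw [mul_apply, mul_apply, affRefl_apply_root', affRefl_apply_root', sub_eq_add_neg, ← neg_smul,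
    map_add_smul_coroot_pull hx, root'_apply hx, Int.cast_add]
  module

variable [Φ.IsCrystallographic]

theorem isPullback_affRefl (c : ι) (j : ℤ) (a : ι) :
    IsPullback Φ (affRefl Φ c j) a (Φ.reflectionPerm c a) (-j * Φ.pairingIn ℤ a c) := by
  refine ⟨fun v => ?_, fun v t => ?_⟩
  · rw [affRefl_apply_root', map_sub, map_smul, root'_coroot, root'_reflectionPerm, smul_eq_mul]
    push_cast
    ring
  · rw [affRefl_apply_root', affRefl_apply_root', ← Φ.reflectionPerm_coroot, map_add, map_smul,
      map_sub, map_smul, Φ.root'_coroot_eq_pairing c c, Φ.pairing_same]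
    simp only [smul_eq_mul, RootPairing.root']
    module

variable [Finite ι]

theorem affRefl_mem_affRootAut (c : ι) (j : ℤ) : affRefl Φ c j ∈ affRootAut Φ :=
  fun a => ⟨_, _, isPullback_affRefl c j a⟩

theorem pull_affRefl (c : ι) (j : ℤ) (a : ι) : pull Φ (affRefl Φ c j) a = Φ.reflectionPerm c a :=
  pull_eq (affRefl_mem_affRootAut c j) (isPullback_affRefl c j a).root'_apply

theorem shift_affRefl (c : ι) (j : ℤ) (a : ι) :
    shift Φ (affRefl Φ c j) a = -j * Φ.pairingIn ℤ a c :=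
  shift_eq (affRefl_mem_affRootAut c j) (isPullback_affRefl c j a).root'_apply

variable {x : N ≃ᵃ[ℝ] N}

theorem pairingIn_pull (hx : x ∈ affRootAut Φ) (a c : ι) :
    Φ.pairingIn ℤ (pull Φ x a) (pull Φ x c) = Φ.pairingIn ℤ a c := by
  have h := congrArg (Φ.root' a) (map_add_smul_coroot_pull hx c 0 1)
  rw [root'_apply hx, one_smul, zero_add, one_smul, map_add, root'_coroot, root'_coroot,
    ← shift_eq_root'_apply_zero hx, add_comm] at h
  exact_mod_cast add_left_cancel h

theorem pull_reflectionPerm (hx : x ∈ affRootAut Φ) (c a : ι) :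
    pull Φ x (Φ.reflectionPerm c a) = Φ.reflectionPerm (pull Φ x c) (pull Φ x a) := by
  refine pull_eq (k := shift Φ x a - Φ.pairingIn ℤ a c * shift Φ x c) hx fun v => ?_
  rw [root'_reflectionPerm, root'_reflectionPerm, pairingIn_pull hx, root'_apply hx, root'_apply hx]
  push_cast
  ring

end Reflections

/-! ### Coweights and the Weyl group -/

theorem IsCoweight.exists_root'_eq_intCast {b : Φ.Base} {μ : N} (h : IsCoweight b μ) (a : ι) :
    ∃ z : ℤ, Φ.root' a μ = z := by
  choose! g hg using h
  obtain ⟨f, -, -, hf⟩ := b.exists_root_eq_sum_int a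
  refine ⟨∑ j ∈ b.support, f j * g j, ?_⟩
  simp only [RootPairing.root', hf, map_sum, map_zsmul, LinearMap.sum_apply,
    LinearMap.smul_apply, zsmul_eq_mul, Int.cast_sum, Int.cast_mul]
  exact Finset.sum_congr rfl fun j hj => by rw [hg j hj]

theorem IsDominant.isCoweight {b : Φ.Base} {μ : N} (h : IsDominant b μ) : IsCoweight b μ :=
  fun i hi => let ⟨z, hz⟩ := h i hi; ⟨z, by rw [hz, Int.cast_natCast]⟩

theorem IsDominant.root'_nonneg {b : Φ.Base} {μ : N} (h : IsDominant b μ) :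
    ∀ i ∈ b.support, 0 ≤ Φ.root' i μ :=
  fun i hi => let ⟨z, hz⟩ := h i hi; (Nat.cast_nonneg z).trans_eq hz.symm

section Weyl

variable {w : N ≃ᵃ[ℝ] N}

theorem weyl_map_zero (hw : w ∈ weyl Φ) : w 0 = 0 := by
  rw [weyl] at hw
  induction hw using Subgroup.closure_induction with
  | mem x hx => obtain ⟨a, rfl⟩ := hx; simp [affRefl_apply_root']
  | one => rfl
  | mul x y _ _ hx hy => rw [mul_apply, hy, hx]
  | inv x _ hx => apply x.injective; rw [apply_inv_apply, hx]

theorem trans_mul_apply_zero (hw : w ∈ weyl Φ) (μ : N) : (trans μ * w) 0 = μ := by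
  rw [mul_apply, weyl_map_zero hw, trans_apply, add_zero]

theorem weyl_apply_eq_linear (hw : w ∈ weyl Φ) (v : N) : w v = w.linear v := by
  simpa [weyl_map_zero hw] using w.map_vadd 0 v

theorem weyl_map_add (hw : w ∈ weyl Φ) (u v : N) : w (u + v) = w u + w v := by
  simp only [weyl_apply_eq_linear hw, map_add]

theorem weyl_map_sub (hw : w ∈ weyl Φ) (u v : N) : w (u - v) = w u - w v := by
  simp only [weyl_apply_eq_linear hw, map_sub]

theorem weyl_map_smul (hw : w ∈ weyl Φ) (t : ℝ) (v : N) : w (t • v) = t • w v := by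
  simp only [weyl_apply_eq_linear hw, map_smul]

theorem weyl_mul_trans (hw : w ∈ weyl Φ) (μ : N) : w * trans μ = trans (w μ) * w := by
  ext v
  rw [mul_apply, mul_apply, trans_apply, trans_apply, weyl_map_add hw]

variable [Finite ι] [Φ.IsCrystallographic]

theorem weyl_le_affRootAut : weyl Φ ≤ affRootAut Φ := by
  rw [weyl, Subgroup.closure_le]
  rintro _ ⟨a, rfl⟩
  exact affRefl_mem_affRootAut a 0

theorem shift_weyl (hw : w ∈ weyl Φ) (a : ι) : shift Φ w a = 0 := by
  have h := shift_eq_root'_apply_zero (weyl_le_affRootAut hw) a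
  rwa [weyl_map_zero hw, map_zero, Int.cast_eq_zero] at h

theorem root'_weyl (hw : w ∈ weyl Φ) (a : ι) (v : N) :
    Φ.root' a (w v) = Φ.root' (pull Φ w a) v := by
  rw [root'_apply (weyl_le_affRootAut hw), shift_weyl hw, Int.cast_zero, add_zero]

theorem weyl_apply_coroot_pull (hw : w ∈ weyl Φ) (a : ι) :
    w (Φ.coroot (pull Φ w a)) = Φ.coroot a := by
  have h := map_add_smul_coroot_pull (weyl_le_affRootAut hw) a 0 1
  rwa [weyl_map_zero hw, one_smul, one_smul, zero_add, zero_add] at h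

theorem weyl_apply_coroot (hw : w ∈ weyl Φ) (a : ι) :
    w (Φ.coroot a) = Φ.coroot (pull Φ w⁻¹ a) := by
  rw [← weyl_apply_coroot_pull hw (pull Φ w⁻¹ a), pull_pull_inv (weyl_le_affRootAut hw)]

end Weyl

/-! ### The position of an alcove relative to the hyperplanes -/

section Level

variable {b : Φ.Base} {x y : N ≃ᵃ[ℝ] N}

open Classical in
/-- The root `a` takes values strictly between `level b x a` and `level b x a + 1` on `x c₀`. -/
def level (b : Φ.Base) (x : N ≃ᵃ[ℝ] N) (a : ι) : ℤ :=
  shift Φ x a + if b.IsPos (pull Φ x a) then 0 else -1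

theorem level_of_isPos {a : ι} (h : b.IsPos (pull Φ x a)) : level b x a = shift Φ x a := by
  rw [level, if_pos h, add_zero]

theorem level_of_not_isPos {a : ι} (h : ¬ b.IsPos (pull Φ x a)) :
    level b x a = shift Φ x a - 1 := by
  rw [level, if_neg h, sub_eq_add_neg]

theorem level_le_shift (x : N ≃ᵃ[ℝ] N) (a : ι) : level b x a ≤ shift Φ x a := by
  by_cases h : b.IsPos (pull Φ x a)
  · rw [level_of_isPos h]
  · rw [level_of_not_isPos h]
    omega

theorem shift_le_level_add_one (x : N ≃ᵃ[ℝ] N) (a : ι) : shift Φ x a ≤ level b x a + 1 := by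
  by_cases h : b.IsPos (pull Φ x a)
  · rw [level_of_isPos h]
    omega
  · rw [level_of_not_isPos h]
    omega

theorem level_mul [Finite ι] (hx : x ∈ affRootAut Φ) (hy : y ∈ affRootAut Φ) (a : ι) :
    level b (x * y) a = shift Φ x a + level b y (pull Φ x a) := by
  rw [level, level, pull_mul hx hy, shift_mul hx hy, add_assoc]

theorem level_eq_shift_add_level_one [Finite ι] (hx : x ∈ affRootAut Φ) (a : ι) :
    level b x a = shift Φ x a + level b 1 (pull Φ x a) := by
  rw [← level_mul hx (one_mem _), mul_one]

theorem level_opp [Finite ι] (hx : x ∈ affRootAut Φ) (a : ι) :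
    level b x (opp Φ a) = -1 - level b x a := by
  have hiff : b.IsPos (pull Φ x (opp Φ a)) ↔ ¬ b.IsPos (pull Φ x a) := by
    rw [pull_opp hx, isPos_opp]
  by_cases h : b.IsPos (pull Φ x a)
  · rw [level_of_isPos h, level_of_not_isPos (fun h' => hiff.1 h' h), shift_opp hx]
    ring
  · rw [level_of_not_isPos h, level_of_isPos (hiff.2 h), shift_opp hx]
    ring

theorem level_one_of_isPos [Finite ι] {a : ι} (h : b.IsPos a) : level b 1 a = 0 := by
  rw [level_of_isPos (by rwa [pull_one]), shift_one]

theorem level_one_of_not_isPos [Finite ι] {a : ι} (h : ¬ b.IsPos a) : level b 1 a = -1 := by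
  rw [level_of_not_isPos (by rwa [pull_one]), shift_one, zero_sub]

end Level

section Alcove

variable {b : Φ.Base} {θ : ι}

theorem mem_fundAlcove {v : N} : v ∈ fundAlcove b θ ↔
    (∀ i ∈ b.support, 0 < Φ.root' i v) ∧ Φ.root' θ v < 1 := by
  simp only [fundAlcove, affRoot, Set.mem_ofPred_eq, Int.cast_zero, add_zero, lt_neg_add_iff_add_lt]

variable [Φ.IsRootSystem]

theorem fundAlcove_nonempty (hθ : IsHighestRoot b θ) : (fundAlcove b θ).Nonempty := by
  have hpos : 0 < Φ.root' θ (rhoVee b) := isPos_iff_root'_rhoVee_pos.1 hθ.isPos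
  refine ⟨(2 * Φ.root' θ (rhoVee b))⁻¹ • rhoVee b, mem_fundAlcove.2 ⟨fun i hi => ?_, ?_⟩⟩
  · rw [map_smul, root'_simple_rhoVee b hi, smul_eq_mul, mul_one]
    positivity
  · rw [map_smul, smul_eq_mul, mul_inv, mul_assoc, inv_mul_cancel₀ hpos.ne']
    norm_num

variable [Finite ι] [Φ.IsCrystallographic]

theorem root'_mem_Ioo (hθ : IsHighestRoot b θ) {v : N} (hv : v ∈ fundAlcove b θ) {a : ι}
    (ha : b.IsPos a) : Φ.root' a v ∈ Set.Ioo (0 : ℝ) 1 := by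
  rw [mem_fundAlcove] at hv
  have hv' : ∀ i ∈ b.support, 0 ≤ Φ.root' i v := fun i hi => (hv.1 i hi).le
  obtain ⟨i, hi, hia⟩ := exists_root'_le_of_isPos ha hv'
  exact ⟨(hv.1 i hi).trans_le hia, (hθ.root'_le a hv').trans_lt hv.2⟩

variable {x : N ≃ᵃ[ℝ] N}

theorem root'_apply_mem_Ioo_level (hθ : IsHighestRoot b θ) (hx : x ∈ affRootAut Φ) (a : ι) {v : N}
    (hv : v ∈ fundAlcove b θ) : Φ.root' a (x v) ∈ Set.Ioo (level b x a : ℝ) (level b x a + 1) := by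
  rw [root'_apply hx]
  by_cases h : b.IsPos (pull Φ x a)
  · rw [level_of_isPos h]
    obtain ⟨h0, h1⟩ := root'_mem_Ioo hθ hv h
    constructor <;> linarith
  · rw [level_of_not_isPos h]
    obtain ⟨h0, h1⟩ := root'_mem_Ioo hθ hv ((isPos_opp b _).2 h)
    rw [root'_opp] at h0 h1
    push_cast
    constructor <;> linarith

theorem onPos_iff (hθ : IsHighestRoot b θ) (hx : x ∈ affRootAut Φ) {a : ι} {k : ℤ} :
    OnPos b θ x a k ↔ -k ≤ level b x a := by
  constructor
  · intro h
    obtain ⟨v, hv⟩ := fundAlcove_nonempty hθ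
    have hnonneg : 0 ≤ Φ.root' a (x v) + k := h _ ⟨v, hv, rfl⟩
    have hlt : ((-k : ℤ) : ℝ) < (level b x a + 1 : ℤ) := by
      push_cast
      linarith [(root'_apply_mem_Ioo_level hθ hx a hv).2]
    exact Int.lt_add_one_iff.1 (Int.cast_lt.1 hlt)
  · rintro h _ ⟨v, hv, rfl⟩
    have hle : ((-k : ℤ) : ℝ) ≤ level b x a := Int.cast_le.2 h
    rw [Int.cast_neg] at hle
    change 0 ≤ Φ.root' a (x v) + k
    linarith [(root'_apply_mem_Ioo_level hθ hx a hv).1]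

theorem onNeg_iff (hθ : IsHighestRoot b θ) (hx : x ∈ affRootAut Φ) {a : ι} {k : ℤ} :
    OnNeg b θ x a k ↔ level b x a < -k := by
  constructor
  · intro h
    obtain ⟨v, hv⟩ := fundAlcove_nonempty hθ
    have hnonpos : Φ.root' a (x v) + k ≤ 0 := h _ ⟨v, hv, rfl⟩
    have hlt : (level b x a : ℝ) < (-k : ℤ) := by
      push_cast
      linarith [(root'_apply_mem_Ioo_level hθ hx a hv).1]
    exact Int.cast_lt.1 hlt
  · rintro h _ ⟨v, hv, rfl⟩
    have hle : ((level b x a + 1 : ℤ) : ℝ) ≤ (-k : ℤ) := Int.cast_le.2 h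
    push_cast at hle
    change Φ.root' a (x v) + k ≤ 0
    linarith [(root'_apply_mem_Ioo_level hθ hx a hv).2]

end Alcove

/-! ### The generators and the wall between adjacent alcoves -/

section Walls

variable {b : Φ.Base} {θ : ι}

/-- The root of the simple affine root with label `s`. -/
def simpleRoot (b : Φ.Base) (θ : ι) : Option b.support → ι
  | some i => i
  | none => opp Φ θ

/-- The multiple of `δ` in the simple affine root with label `s`. -/
def simpleLevel (b : Φ.Base) : Option b.support → ℤ
  | some _ => 0
  | none => 1

theorem gen_eq_affRefl (s : Option b.support) :
    gen b θ s = affRefl Φ (simpleRoot b θ s) (simpleLevel b s) := by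
  cases s with
  | some i => rfl
  | none => exact (affRefl_opp θ (-1)).symm

theorem gen_mul_self (s : Option b.support) : gen b θ s * gen b θ s = 1 := by
  rw [gen_eq_affRefl, affRefl_mul_self]

theorem mul_gen_mul_gen (x : N ≃ᵃ[ℝ] N) (s : Option b.support) :
    x * gen b θ s * gen b θ s = x := by
  rw [mul_assoc, gen_mul_self, mul_one]

section Generators

variable [Finite ι] [Φ.IsRootSystem]

theorem level_one_simpleRoot (hθ : IsHighestRoot b θ) (s : Option b.support) :
    level b 1 (simpleRoot b θ s) = -simpleLevel b s := by
  cases s with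
  | some i => exact level_one_of_isPos (RootPairing.Base.isPos_of_mem_support i.2)
  | none => exact level_one_of_not_isPos fun h => (isPos_opp b θ).1 h hθ.isPos

variable [Φ.IsCrystallographic]

omit [Φ.IsRootSystem] in
theorem gen_mem_affRootAut (s : Option b.support) : gen b θ s ∈ affRootAut Φ :=
  gen_eq_affRefl (θ := θ) s ▸ affRefl_mem_affRootAut _ _

theorem level_gen_simpleRoot (hθ : IsHighestRoot b θ) (s : Option b.support) :
    level b (gen b θ s) (simpleRoot b θ s) = -simpleLevel b s - 1 := by
  have hpull : pull Φ (gen b θ s) (simpleRoot b θ s) = opp Φ (simpleRoot b θ s) := by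
    rw [gen_eq_affRefl, pull_affRefl, opp]
  have hshift : shift Φ (gen b θ s) (simpleRoot b θ s) = -2 * simpleLevel b s := by
    rw [gen_eq_affRefl, shift_affRefl, Φ.pairingIn_same]
    ring
  cases s with
  | some i =>
    rw [level_of_not_isPos, hshift]
    · rfl
    · rw [hpull, isPos_opp, not_not]
      exact RootPairing.Base.isPos_of_mem_support i.2
  | none =>
    rw [level_of_isPos, hshift]
    · rfl
    · rw [hpull, simpleRoot, opp_involutive]
      exact hθ.isPos

theorem level_gen_none_of_isPos (hθ : IsHighestRoot b θ) {a : ι} (ha : b.IsPos a) (hne : a ≠ θ) :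
    level b (gen b θ none) a = 0 := by
  have hpos : 0 < Φ.root' a (rhoVee b) := isPos_iff_root'_rhoVee_pos.1 ha
  have hle := hθ.root'_le a (root'_simple_rhoVee_nonneg (Φ := Φ) (b := b))
  have hshift : shift Φ (gen b θ none) a = Φ.pairingIn ℤ a θ := by
    rw [gen, shift_affRefl, neg_neg, one_mul]
  have hpull : b.IsPos (pull Φ (gen b θ none) a) ↔
      0 < Φ.root' a (rhoVee b) - Φ.pairingIn ℤ a θ * Φ.root' θ (rhoVee b) := by
    rw [gen, pull_affRefl, isPos_iff_root'_rhoVee_pos, root'_reflectionPerm]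
  obtain hpair | hpair : Φ.pairingIn ℤ a θ = 0 ∨ Φ.pairingIn ℤ a θ = 1 := by
    have hnonneg := hθ.pairingIn_nonneg ha
    have hle_one := hθ.pairingIn_le_one hne
    omega
  · rw [level_of_isPos, hshift, hpair]
    rw [hpull, hpair, Int.cast_zero, zero_mul, sub_zero]
    exact hpos
  · rw [level_of_not_isPos, hshift, hpair, sub_self]
    rw [hpull, hpair, Int.cast_one, one_mul, sub_pos]
    exact hle.not_gt

variable [Φ.IsReduced]

omit [Φ.IsRootSystem] in
theorem level_gen_some_of_isPos {i : b.support} {a : ι} (ha : b.IsPos a) (hne : a ≠ i) :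
    level b (gen b θ (some i)) a = 0 := by
  have hopp : a ≠ opp Φ i := by
    rintro rfl
    exact (isPos_opp b i).1 ha (RootPairing.Base.isPos_of_mem_support i.2)
  rw [gen, level_of_isPos, shift_affRefl, neg_zero, zero_mul]
  rw [pull_affRefl, isPos_reflectionPerm_simple i.2 hne hopp]
  exact ha

theorem level_gen_of_ne (hθ : IsHighestRoot b θ) {s : Option b.support} {a : ι}
    (h : a ≠ simpleRoot b θ s) (h' : a ≠ opp Φ (simpleRoot b θ s)) :
    level b (gen b θ s) a = level b 1 a := by
  wlog ha : b.IsPos a generalizing a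
  · have hopp := this (a := opp Φ a) (fun e => h' (opp_involutive.eq_iff.1 e))
      (fun e => h (opp_involutive.injective e)) ((isPos_opp b a).2 ha)
    rw [level_opp (gen_mem_affRootAut s), level_opp (one_mem _)] at hopp
    exact sub_right_injective hopp
  rw [level_one_of_isPos ha]
  cases s with
  | some i => exact level_gen_some_of_isPos ha h
  | none => exact level_gen_none_of_isPos hθ ha (by rwa [simpleRoot, opp_involutive] at h')

end Generators

/-- The root of the affine root that vanishes on the wall between `x c₀` and `x s c₀` and is
positive on `x c₀`. -/
def wallRoot (b : Φ.Base) (θ : ι) (x : N ≃ᵃ[ℝ] N) (s : Option b.support) : ι :=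
  pull Φ x⁻¹ (simpleRoot b θ s)

/-- The multiple of `δ` in the affine root that vanishes on the wall between `x c₀` and `x s c₀`
and is positive on `x c₀`. -/
def wallLevel (b : Φ.Base) (θ : ι) (x : N ≃ᵃ[ℝ] N) (s : Option b.support) : ℤ :=
  simpleLevel b s - shift Φ x (wallRoot b θ x s)

variable [Finite ι] {x : N ≃ᵃ[ℝ] N}

theorem pull_wallRoot (hx : x ∈ affRootAut Φ) (s : Option b.support) :
    pull Φ x (wallRoot b θ x s) = simpleRoot b θ s := pull_pull_inv hx _

theorem mul_gen_eq_affRefl_mul (hx : x ∈ affRootAut Φ) (s : Option b.support) :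
    x * gen b θ s = affRefl Φ (wallRoot b θ x s) (wallLevel b θ x s) * x := by
  rw [← mul_affRefl_pull hx, pull_wallRoot hx, gen_eq_affRefl, wallLevel, sub_add_cancel]

theorem wallRoot_mul {g : N ≃ᵃ[ℝ] N} (hg : g ∈ affRootAut Φ) (hx : x ∈ affRootAut Φ)
    (s : Option b.support) : wallRoot b θ (g * x) s = pull Φ g⁻¹ (wallRoot b θ x s) := by
  rw [wallRoot, mul_inv_rev, pull_mul (inv_mem hx) (inv_mem hg), wallRoot]

variable [Φ.IsRootSystem]

theorem level_wallRoot (hθ : IsHighestRoot b θ) (hx : x ∈ affRootAut Φ) (s : Option b.support) :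
    level b x (wallRoot b θ x s) = -wallLevel b θ x s := by
  rw [level_eq_shift_add_level_one hx, pull_wallRoot hx, level_one_simpleRoot hθ, wallLevel]
  ring

variable [Φ.IsCrystallographic]

theorem level_mul_gen_wallRoot (hθ : IsHighestRoot b θ) (hx : x ∈ affRootAut Φ)
    (s : Option b.support) :
    level b (x * gen b θ s) (wallRoot b θ x s) = -wallLevel b θ x s - 1 := by
  rw [level_mul hx (gen_mem_affRootAut s), pull_wallRoot hx, level_gen_simpleRoot hθ, wallLevel]
  ring

theorem level_mul_gen_opp_wallRoot (hθ : IsHighestRoot b θ) (hx : x ∈ affRootAut Φ)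
    (s : Option b.support) :
    level b (x * gen b θ s) (opp Φ (wallRoot b θ x s)) =
      level b x (opp Φ (wallRoot b θ x s)) + 1 := by
  have hxs : x * gen b θ s ∈ affRootAut Φ := mul_mem hx (gen_mem_affRootAut s)
  rw [level_opp hxs, level_opp hx, level_mul_gen_wallRoot hθ hx,
    level_wallRoot hθ hx]
  ring

variable [Φ.IsReduced] {s : Option b.support}

theorem level_mul_gen_of_ne (hθ : IsHighestRoot b θ) (hx : x ∈ affRootAut Φ) {a : ι}
    (h : a ≠ wallRoot b θ x s) (h' : a ≠ opp Φ (wallRoot b θ x s)) :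
    level b (x * gen b θ s) a = level b x a := by
  rw [level_eq_shift_add_level_one hx, level_mul hx (gen_mem_affRootAut s), level_gen_of_ne hθ]
  · exact fun e => h (pull_injective hx (e.trans (pull_wallRoot hx s).symm))
  · rw [← pull_wallRoot hx, ← pull_opp hx]
    exact fun e => h' (pull_injective hx e)

theorem eq_wall (hθ : IsHighestRoot b θ) (hx : x ∈ affRootAut Φ) {a : ι} {k : ℤ}
    (h : -k ≤ level b x a) (h' : level b (x * gen b θ s) a < -k) :
    a = wallRoot b θ x s ∧ k = wallLevel b θ x s := by
  by_cases ha : a = wallRoot b θ x s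
  · subst ha
    rw [level_wallRoot hθ hx] at h
    rw [level_mul_gen_wallRoot hθ hx] at h'
    exact ⟨rfl, by omega⟩
  · exfalso
    by_cases ha' : a = opp Φ (wallRoot b θ x s)
    · rw [ha', level_mul_gen_opp_wallRoot hθ hx, ← ha'] at h'
      omega
    · rw [level_mul_gen_of_ne hθ hx ha ha'] at h'
      omega

theorem onPos_onNeg_iff (hθ : IsHighestRoot b θ) (hx : x ∈ affRootAut Φ) {a : ι} {k : ℤ} :
    (OnPos b θ x a k ∧ OnNeg b θ (x * gen b θ s) a k) ↔
      a = wallRoot b θ x s ∧ k = wallLevel b θ x s := by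
  rw [onPos_iff hθ hx, onNeg_iff hθ (mul_mem hx (gen_mem_affRootAut (θ := θ) s))]
  refine ⟨fun h => eq_wall hθ hx h.1 h.2, ?_⟩
  rintro ⟨rfl, rfl⟩
  rw [level_wallRoot hθ hx, level_mul_gen_wallRoot hθ hx]
  constructor <;> omega

theorem opp_wallRoot_eq_and_neg_wallLevel_eq (hθ : IsHighestRoot b θ) (hx : x ∈ affRootAut Φ)
    (s : Option b.support) :
    opp Φ (wallRoot b θ x s) = wallRoot b θ (x * gen b θ s) s ∧
      -wallLevel b θ x s = wallLevel b θ (x * gen b θ s) s := by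
  have hxs := mul_mem hx (gen_mem_affRootAut (θ := θ) s)
  refine eq_wall hθ hxs ?_ ?_
  · rw [level_opp hxs, level_mul_gen_wallRoot hθ hx]
    omega
  · rw [mul_gen_mul_gen, level_opp hx, level_wallRoot hθ hx]
    omega

theorem onNeg_onPos_iff (hθ : IsHighestRoot b θ) (hx : x ∈ affRootAut Φ) {a : ι} {k : ℤ} :
    (OnNeg b θ x a k ∧ OnPos b θ (x * gen b θ s) a k) ↔
      a = opp Φ (wallRoot b θ x s) ∧ k = -wallLevel b θ x s := by
  obtain ⟨hroot, hlevel⟩ := opp_wallRoot_eq_and_neg_wallLevel_eq hθ hx s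
  have hxs : x * gen b θ s ∈ affRootAut Φ := mul_mem hx (gen_mem_affRootAut s)
  have h := onPos_onNeg_iff (s := s) (a := a) (k := k) hθ hxs
  rw [mul_gen_mul_gen] at h
  rw [and_comm, hroot, hlevel, h]

end Walls

/-! ### The length function -/

section Length

variable [Finite ι] {b : Φ.Base} {θ : ι}

/-- The finite set of positive roots. -/
def posRoots (b : Φ.Base) : Finset ι := (Set.toFinite {a | b.IsPos a}).toFinset

theorem mem_posRoots {a : ι} : a ∈ posRoots b ↔ b.IsPos a := Set.Finite.mem_toFinset _

theorem sum_posRoots_eq_add_sub {A : Type*} [AddCommGroup A] (f g : ι → A) {c : ι}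
    (hc : b.IsPos c) (h : ∀ a, a ≠ c → a ≠ opp Φ c → f a = g a) :
    ∑ a ∈ posRoots b, f a = ∑ a ∈ posRoots b, g a + (f c - g c) := by
  rw [add_comm, ← sub_eq_iff_eq_add, ← Finset.sum_sub_distrib]
  refine Finset.sum_eq_single_of_mem c (mem_posRoots.2 hc) fun a ha hac =>
    sub_eq_zero.2 (h a hac ?_)
  rintro rfl
  exact (isPos_opp b c).1 (mem_posRoots.1 ha) hc

/-- The sum of the positions of the alcove `x c₀` relative to the positive roots. -/
def levelSum (b : Φ.Base) (x : N ≃ᵃ[ℝ] N) : ℤ := ∑ a ∈ posRoots b, level b x a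

variable [Φ.IsRootSystem] [Φ.IsCrystallographic] {x : N ≃ᵃ[ℝ] N}

theorem separates_iff (hθ : IsHighestRoot b θ) (hx : x ∈ affRootAut Φ) {a : ι} (ha : b.IsPos a)
    {k : ℤ} :
    ((OnPos b θ 1 a k ∧ OnNeg b θ x a k) ∨ (OnNeg b θ 1 a k ∧ OnPos b θ x a k)) ↔
      k ∈ Finset.Ico (min 0 (-level b x a)) (max 0 (-level b x a)) := by
  rw [onPos_iff hθ hx, onNeg_iff hθ hx, onPos_iff hθ (one_mem _), onNeg_iff hθ (one_mem _),
    level_one_of_isPos ha, Finset.mem_Ico]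
  omega

theorem len_eq (hθ : IsHighestRoot b θ) (hx : x ∈ affRootAut Φ) :
    len b θ x = ∑ a ∈ posRoots b, (level b x a).natAbs := by
  have hset : {h : ι × ℤ | b.IsPos h.1 ∧ ((OnPos b θ 1 h.1 h.2 ∧ OnNeg b θ x h.1 h.2) ∨
      (OnNeg b θ 1 h.1 h.2 ∧ OnPos b θ x h.1 h.2))} =
      (((posRoots b).sigma fun a => Finset.Ico (min 0 (-level b x a)) (max 0 (-level b x a))).map
        (Equiv.sigmaEquivProd ι ℤ).toEmbedding : Finset (ι × ℤ)) := by
    ext ⟨a, k⟩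
    rw [Finset.mem_coe, Finset.mem_map_equiv]
    change _ ↔ (⟨a, k⟩ : Σ _ : ι, ℤ) ∈ _
    rw [Finset.mem_sigma, mem_posRoots]
    exact and_congr_right fun ha => separates_iff hθ hx ha
  rw [len, hset, Set.ncard_coe_finset, Finset.card_map, Finset.card_sigma]
  refine Finset.sum_congr rfl fun a _ => ?_
  rw [Int.card_Ico]
  omega

theorem len_one (hθ : IsHighestRoot b θ) : len b θ (1 : N ≃ᵃ[ℝ] N) = 0 := by
  rw [len_eq hθ (one_mem _)]
  refine Finset.sum_eq_zero fun a ha => ?_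
  rw [level_one_of_isPos (mem_posRoots.1 ha), Int.natAbs_zero]

variable [Φ.IsReduced]

theorem len_mul_gen (hθ : IsHighestRoot b θ) (hx : x ∈ affRootAut Φ) (s : Option b.support) :
    (len b θ (x * gen b θ s) : ℤ) = len b θ x +
      if level b x (wallRoot b θ x s) ≤ level b 1 (wallRoot b θ x s) then 1 else -1 := by
  have hxs : x * gen b θ s ∈ affRootAut Φ := mul_mem hx (gen_mem_affRootAut s)
  rw [len_eq hθ hx, len_eq hθ hxs]
  push_cast
  have hlevel := level_wallRoot hθ hx s
  have hlevel_mul := level_mul_gen_wallRoot hθ hx s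
  by_cases hc : b.IsPos (wallRoot b θ x s)
  · rw [sum_posRoots_eq_add_sub (fun a => |level b (x * gen b θ s) a|) (fun a => |level b x a|) hc
      fun a h h' => by rw [level_mul_gen_of_ne hθ hx h h'], level_one_of_isPos hc,
      hlevel, hlevel_mul]
    split_ifs with h
    · rw [abs_of_nonpos (by omega), abs_of_nonpos (by omega)]
      ring
    · rw [abs_of_nonneg (by omega), abs_of_nonneg (by omega)]
      ring
  · have hc' : b.IsPos (opp Φ (wallRoot b θ x s)) := (isPos_opp b _).2 hc
    rw [sum_posRoots_eq_add_sub (fun a => |level b (x * gen b θ s) a|) (fun a => |level b x a|) hc'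
      fun a h h' => by rw [level_mul_gen_of_ne hθ hx (by rwa [opp_involutive] at h') h],
      level_one_of_not_isPos hc, level_opp hx, level_opp hxs, hlevel, hlevel_mul]
    split_ifs with h
    · rw [abs_of_nonneg (by omega), abs_of_nonneg (by omega)]
      ring
    · rw [abs_of_nonpos (by omega), abs_of_nonpos (by omega)]
      ring

theorem len_mul_gen_le (hθ : IsHighestRoot b θ) (hx : x ∈ affRootAut Φ) (s : Option b.support) :
    len b θ (x * gen b θ s) ≤ len b θ x + 1 := by
  have hlen := len_mul_gen hθ hx s
  split_ifs at hlen <;> omega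

open Classical in
theorem levelSum_mul_gen (hθ : IsHighestRoot b θ) (hx : x ∈ affRootAut Φ) (s : Option b.support) :
    levelSum b (x * gen b θ s) =
      levelSum b x + if b.IsPos (wallRoot b θ x s) then -1 else 1 := by
  have hlevel := level_wallRoot hθ hx s
  have hlevel_mul := level_mul_gen_wallRoot hθ hx s
  rw [levelSum, levelSum]
  split_ifs with hc
  · rw [sum_posRoots_eq_add_sub (level b (x * gen b θ s)) (level b x) hc
      fun a h h' => level_mul_gen_of_ne hθ hx h h', hlevel, hlevel_mul]
    ring
  · have hc' : b.IsPos (opp Φ (wallRoot b θ x s)) := (isPos_opp b _).2 hc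
    rw [sum_posRoots_eq_add_sub (level b (x * gen b θ s)) (level b x) hc'
      fun a h h' => level_mul_gen_of_ne hθ hx (by rwa [opp_involutive] at h') h,
      level_mul_gen_opp_wallRoot hθ hx]
    ring

end Length

section ExtendedAffineWeylGroup

variable [Finite ι] [Φ.IsCrystallographic] {b : Φ.Base} {θ : ι} {x γ : N ≃ᵃ[ℝ] N}

theorem mem_affRootAut_of_mem_extAffWeyl (hx : x ∈ extAffWeyl b) : x ∈ affRootAut Φ := by
  obtain ⟨μ, hμ, w, hw, rfl⟩ := hx
  exact mul_mem (trans_mem_affRootAut hμ.exists_root'_eq_intCast) (weyl_le_affRootAut hw)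

theorem mem_affRootAut_of_mem_lengthZero (hγ : γ ∈ lengthZero b θ) : γ ∈ affRootAut Φ :=
  mem_affRootAut_of_mem_extAffWeyl hγ.1

variable [Φ.IsRootSystem]

theorem level_lengthZero (hθ : IsHighestRoot b θ) (hγ : γ ∈ lengthZero b θ) (a : ι) :
    level b γ a = level b 1 a := by
  have hγ' := mem_affRootAut_of_mem_lengthZero hγ
  wlog ha : b.IsPos a generalizing a
  · have hopp := this (opp Φ a) ((isPos_opp b a).2 ha)
    rw [level_opp hγ', level_opp (one_mem _)] at hopp
    exact sub_right_injective hopp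
  have hlen := hγ.2
  rw [len_eq hθ hγ', Finset.sum_eq_zero_iff] at hlen
  rw [level_one_of_isPos ha]
  exact Int.natAbs_eq_zero.1 (hlen a (mem_posRoots.2 ha))

theorem level_mul_lengthZero (hθ : IsHighestRoot b θ) (hx : x ∈ affRootAut Φ)
    (hγ : γ ∈ lengthZero b θ) (a : ι) : level b (x * γ) a = level b x a := by
  rw [level_mul hx (mem_affRootAut_of_mem_lengthZero hγ), level_lengthZero hθ hγ,
    ← level_eq_shift_add_level_one hx]

theorem len_mul_lengthZero (hθ : IsHighestRoot b θ) (hx : x ∈ affRootAut Φ)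
    (hγ : γ ∈ lengthZero b θ) : len b θ (x * γ) = len b θ x := by
  rw [len_eq hθ hx, len_eq hθ (mul_mem hx (mem_affRootAut_of_mem_lengthZero hγ))]
  simp only [level_mul_lengthZero hθ hx hγ]

end ExtendedAffineWeylGroup

/-! ### The finite Weyl group -/

section WeylGroup

variable {b : Φ.Base}

/-- The product of the simple reflections along a word. -/
def simpleProd (L : List b.support) : N ≃ᵃ[ℝ] N :=
  (L.map fun i : b.support => affRefl Φ i 0).prod

theorem simpleProd_nil : simpleProd ([] : List b.support) = 1 := rfl

theorem simpleProd_singleton (i : b.support) : simpleProd [i] = affRefl Φ i 0 := by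
  rw [simpleProd, List.map_singleton, List.prod_singleton]

theorem simpleProd_cons (i : b.support) (L : List b.support) :
    simpleProd (i :: L) = affRefl Φ i 0 * simpleProd L := by
  rw [simpleProd, List.map_cons, List.prod_cons, simpleProd]

theorem simpleProd_append (L L' : List b.support) :
    simpleProd (L ++ L') = simpleProd L * simpleProd L' := by
  rw [simpleProd, List.map_append, List.prod_append, simpleProd, simpleProd]

theorem isReducedWord_iff {θ : ι} {w : N ≃ᵃ[ℝ] N} {L : List b.support} :
    IsReducedWord b θ L w ↔ simpleProd L = w ∧ L.length = len b θ w := by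
  simp [IsReducedWord, simpleProd]

theorem simpleProd_mem_weyl (L : List b.support) : simpleProd L ∈ weyl Φ := by
  refine list_prod_mem fun x hx => ?_
  obtain ⟨i, -, rfl⟩ := List.mem_map.1 hx
  exact affRefl_mem_weyl _

theorem affRefl_inv (c : ι) (j : ℤ) : (affRefl Φ c j)⁻¹ = affRefl Φ c j :=
  inv_eq_of_mul_eq_one_left (affRefl_mul_self c j)

theorem simpleProd_reverse (L : List b.support) : simpleProd L.reverse = (simpleProd L)⁻¹ := by
  induction L with
  | nil => rw [List.reverse_nil, simpleProd_nil, inv_one]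
  | cons i L ih =>
    rw [List.reverse_cons, simpleProd_append, simpleProd_singleton, simpleProd_cons, mul_inv_rev,
      ih, affRefl_inv]

theorem isPos_simple (i : b.support) : b.IsPos i := RootPairing.Base.isPos_of_mem_support i.2

variable [Finite ι] [Φ.IsCrystallographic] {w : N ≃ᵃ[ℝ] N}

variable [Φ.IsReduced]

theorem exists_simpleProd_eq_affRefl (b : Φ.Base) (a : ι) :
    ∃ L : List b.support, simpleProd L = affRefl Φ a 0 := by
  refine b.induction_reflect (p := fun a => ∃ L : List b.support, simpleProd L = affRefl Φ a 0) a
    ?_ ?_ ?_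
  · rintro i ⟨L, hL⟩
    refine ⟨L, hL.trans ?_⟩
    rw [← affRefl_opp i 0, neg_zero]
    rfl
  · intro i hi
    exact ⟨[⟨i, hi⟩], simpleProd_singleton _⟩
  · rintro i j ⟨L, hL⟩ hj
    refine ⟨⟨j, hj⟩ :: (L ++ [⟨j, hj⟩]), ?_⟩
    rw [simpleProd_cons, simpleProd_append, hL, simpleProd_singleton]
    have hconj := mul_affRefl_pull (affRefl_mem_affRootAut (Φ := Φ) j 0) (Φ.reflectionPerm j i) 0
    rw [pull_affRefl, shift_affRefl, neg_zero, zero_mul, add_zero,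
      RootPairing.reflectionPerm_self] at hconj
    rw [← mul_assoc, hconj, mul_assoc, affRefl_mul_self, mul_one]

theorem exists_simpleProd_eq (b : Φ.Base) (hw : w ∈ weyl Φ) :
    ∃ L : List b.support, simpleProd L = w := by
  rw [weyl] at hw
  induction hw using Subgroup.closure_induction with
  | mem x hx =>
    obtain ⟨a, rfl⟩ := hx
    exact exists_simpleProd_eq_affRefl b a
  | one => exact ⟨[], rfl⟩
  | mul x y _ _ hx hy =>
    obtain ⟨L, rfl⟩ := hx
    obtain ⟨L', rfl⟩ := hy
    exact ⟨L ++ L', simpleProd_append L L'⟩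
  | inv x _ hx =>
    obtain ⟨L, rfl⟩ := hx
    exact ⟨L.reverse, simpleProd_reverse L⟩

omit [Φ.IsReduced] in
theorem pull_mul_simple_inv (hw : w ∈ weyl Φ) (i : ι) :
    pull Φ (w * affRefl Φ i 0)⁻¹ i = opp Φ (pull Φ w⁻¹ i) := by
  have hw' : w⁻¹ ∈ affRootAut Φ := inv_mem (weyl_le_affRootAut hw)
  rw [mul_inv_rev, affRefl_inv, pull_mul (affRefl_mem_affRootAut _ _) hw', pull_affRefl]
  exact pull_opp hw' i


theorem simpleProd_exchange (L : List b.support) (j : b.support)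
    (h : ¬ b.IsPos (pull Φ (simpleProd L)⁻¹ j)) :
    ∃ L' : List b.support, L'.length + 1 = L.length ∧
      simpleProd L * affRefl Φ j 0 = simpleProd L' := by
  induction L with
  | nil =>
    rw [simpleProd_nil, inv_one, pull_one] at h
    exact absurd (isPos_simple j) h
  | cons i L ih =>
    have hL := weyl_le_affRootAut (simpleProd_mem_weyl L)
    by_cases h' : b.IsPos (pull Φ (simpleProd L)⁻¹ j)
    · refine ⟨L, rfl, ?_⟩
      rw [simpleProd_cons, mul_inv_rev, affRefl_inv,
        pull_mul (inv_mem hL) (affRefl_mem_affRootAut _ _), pull_affRefl] at h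
      have hij : pull Φ (simpleProd L)⁻¹ j = i := by
        by_contra hne
        exact h (h'.reflectionPerm i.2 hne)
      have hconj := mul_affRefl_pull hL (i : ι) 0
      rw [shift_weyl (simpleProd_mem_weyl L), ← hij, pull_pull_inv hL, hij, add_zero] at hconj
      rw [simpleProd_cons, mul_assoc, hconj, affRefl_mul_cancel_left]
    · obtain ⟨L', hlen, hprod⟩ := ih h'
      refine ⟨i :: L', congrArg (· + 1) hlen, ?_⟩
      rw [simpleProd_cons, simpleProd_cons, mul_assoc, hprod]

theorem eq_one_of_isPos_pull_inv (hw : w ∈ weyl Φ) (h : ∀ i ∈ b.support, b.IsPos (pull Φ w⁻¹ i)) :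
    w = 1 := by
  obtain ⟨L, rfl⟩ := exists_simpleProd_eq b hw
  clear hw
  induction hn : L.length using Nat.strong_induction_on generalizing L with
  | _ n ih =>
    rcases List.eq_nil_or_concat L with rfl | ⟨L₁, j, rfl⟩
    · rfl
    · rw [List.concat_eq_append] at h hn ⊢
      rw [simpleProd_append, simpleProd_singleton] at h ⊢
      have hj := h j j.2
      rw [pull_mul_simple_inv (simpleProd_mem_weyl L₁), isPos_opp] at hj
      obtain ⟨L', hlen, hprod⟩ := simpleProd_exchange L₁ j hj
      rw [hprod] at h ⊢
      refine ih L'.length ?_ L' h rfl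
      simp only [List.length_append, List.length_singleton] at hn
      omega

variable [Φ.IsRootSystem] {θ : ι}

omit [Φ.IsReduced] in
theorem not_isPos_pull_of_simple (hw : w ∈ weyl Φ) (h : ∀ i ∈ b.support, ¬ b.IsPos (pull Φ w i))
    {a : ι} (ha : b.IsPos a) : ¬ b.IsPos (pull Φ w a) := by
  have h' : ∀ i ∈ b.support, 0 < Φ.root' i (-w (rhoVee b)) := fun i hi => by
    rw [map_neg, root'_weyl hw, ← root'_opp, ← isPos_iff_root'_rhoVee_pos, isPos_opp]
    exact h i hi
  obtain ⟨i, hi, hle⟩ := exists_root'_le_of_isPos ha fun i hi => (h' i hi).le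
  rw [← isPos_opp, isPos_iff_root'_rhoVee_pos, root'_opp, ← root'_weyl hw, ← map_neg]
  exact (h' i hi).trans_le hle

theorem len_mul_simple_of_isPos (hθ : IsHighestRoot b θ) (hw : w ∈ weyl Φ) {i : b.support}
    (h : b.IsPos (pull Φ w⁻¹ i)) : len b θ (w * affRefl Φ i 0) = len b θ w + 1 := by
  have hw' := weyl_le_affRootAut hw
  have hlen := len_mul_gen hθ hw' (some i)
  change (len b θ (w * affRefl Φ i 0) : ℤ) = len b θ w +
    if level b w (pull Φ w⁻¹ i) ≤ level b 1 (pull Φ w⁻¹ i) then 1 else -1 at hlen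
  rw [level_one_of_isPos h, level_of_isPos (by rw [pull_pull_inv hw']; exact isPos_simple i),
    shift_weyl hw, if_pos le_rfl] at hlen
  exact_mod_cast hlen

theorem len_mul_simple_of_not_isPos (hθ : IsHighestRoot b θ) (hw : w ∈ weyl Φ) {i : b.support}
    (h : ¬ b.IsPos (pull Φ w⁻¹ i)) : len b θ (w * affRefl Φ i 0) + 1 = len b θ w := by
  have hwi := mul_mem hw (affRefl_mem_weyl (i : ι))
  rw [← len_mul_simple_of_isPos hθ hwi, mul_assoc, affRefl_mul_self, mul_one]
  rwa [pull_mul_simple_inv hw, isPos_opp]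

theorem exists_isReducedWord (hθ : IsHighestRoot b θ) (hw : w ∈ weyl Φ) :
    ∃ L : List b.support, IsReducedWord b θ L w := by
  induction hn : len b θ w using Nat.strong_induction_on generalizing w with
  | _ n ih =>
    by_cases h : ∀ i ∈ b.support, b.IsPos (pull Φ w⁻¹ i)
    · obtain rfl := eq_one_of_isPos_pull_inv hw h
      exact ⟨[], isReducedWord_iff.2 ⟨rfl, (len_one hθ).symm⟩⟩
    · push Not at h
      obtain ⟨i, hi, h⟩ := h
      have hlen : len b θ (w * affRefl Φ i 0) + 1 = len b θ w :=
        len_mul_simple_of_not_isPos hθ hw (i := ⟨i, hi⟩) h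
      obtain ⟨L, hL⟩ := ih _ (by omega) (mul_mem hw (affRefl_mem_weyl i)) rfl
      rw [isReducedWord_iff] at hL
      refine ⟨L ++ [⟨i, hi⟩], isReducedWord_iff.2 ⟨?_, ?_⟩⟩
      · rw [simpleProd_append, hL.1, simpleProd_singleton, mul_assoc, affRefl_mul_self, mul_one]
      · rw [List.length_append, hL.2, List.length_singleton, hlen]

theorem IsLongest.not_isPos_pull_inv {w₀ : N ≃ᵃ[ℝ] N} (hθ : IsHighestRoot b θ)
    (hw₀ : IsLongest b θ w₀) {a : ι} (ha : b.IsPos a) : ¬ b.IsPos (pull Φ w₀⁻¹ a) := by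
  refine not_isPos_pull_of_simple (inv_mem hw₀.1) (fun i hi h => ?_) ha
  have hlen : len b θ (w₀ * affRefl Φ i 0) = len b θ w₀ + 1 :=
    len_mul_simple_of_isPos (i := ⟨i, hi⟩) hθ hw₀.1 h
  have hmax := hw₀.2 _ (mul_mem hw₀.1 (affRefl_mem_weyl i))
  omega

theorem IsLongest.not_isPos_pull {w₀ : N ≃ᵃ[ℝ] N} (hθ : IsHighestRoot b θ)
    (hw₀ : IsLongest b θ w₀) {a : ι} (ha : b.IsPos a) : ¬ b.IsPos (pull Φ w₀ a) := fun h => by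
  have hneg := hw₀.not_isPos_pull_inv hθ h
  rw [pull_inv_pull (weyl_le_affRootAut hw₀.1)] at hneg
  exact hneg ha

end WeylGroup

/-! ### The cone of positive coroots -/

section CorootCone

variable {b : Φ.Base}

section Coheight

variable [Φ.IsRootSystem]

/-- The height of coroots, extended to a linear form on `N`. -/
def coheight (b : Φ.Base) : N →ₗ[ℝ] ℝ := Φ.toLinearMap (rhoVee b.flip)

theorem coheight_coroot {i : ι} (hi : i ∈ b.support) : coheight b (Φ.coroot i) = 1 :=
  root'_simple_rhoVee (Φ := Φ.flip) b.flip hi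

theorem eq_zero_or_coheight_pos {q : N} (hq : q ∈ corootCone b) : q = 0 ∨ 0 < coheight b q := by
  induction hq using AddSubmonoid.closure_induction with
  | mem x hx =>
    obtain ⟨i, hi, rfl⟩ := hx
    exact Or.inr (zero_lt_one.trans_eq (coheight_coroot hi).symm)
  | zero => exact Or.inl rfl
  | add x y _ _ hx hy =>
    rcases hx with rfl | hx
    · rwa [zero_add]
    · rcases hy with rfl | hy
      · rw [add_zero]
        exact Or.inr hx
      · rw [map_add]
        exact Or.inr (add_pos hx hy)

theorem coheight_nonneg {q : N} (hq : q ∈ corootCone b) : 0 ≤ coheight b q := by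
  rcases eq_zero_or_coheight_pos hq with rfl | h
  · rw [map_zero]
  · exact h.le

theorem eq_zero_of_mem_corootCone_of_neg_mem {q : N} (hq : q ∈ corootCone b)
    (hq' : -q ∈ corootCone b) : q = 0 := by
  rcases eq_zero_or_coheight_pos hq with h | h
  · exact h
  · have hneg := coheight_nonneg hq'
    rw [map_neg] at hneg
    linarith

end Coheight

variable [Finite ι] [Φ.IsCrystallographic] [Φ.IsReduced] {w : N ≃ᵃ[ℝ] N}

theorem nsmul_coroot_mem_corootCone {a : ι} (ha : b.IsPos a) (n : ℕ) :
    (n : ℝ) • Φ.coroot a ∈ corootCone b := by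
  rw [Nat.cast_smul_eq_nsmul]
  exact nsmul_mem (coroot_mem_corootCone ha) n

theorem zsmul_coroot_mem_corootCone {a : ι} (ha : b.IsPos a) {n : ℤ} (hn : 0 ≤ n) :
    (n : ℝ) • Φ.coroot a ∈ corootCone b := by
  lift n to ℕ using hn
  exact_mod_cast nsmul_coroot_mem_corootCone ha n

omit [Φ.IsReduced] in
theorem simpleProd_mul_affRefl_apply (L : List b.support) (i : b.support) (v : N) :
    (simpleProd L * affRefl Φ i 0) v =
      simpleProd L v - Φ.root' i v • Φ.coroot (pull Φ (simpleProd L)⁻¹ i) := by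
  have hL := simpleProd_mem_weyl L
  rw [mul_apply, affRefl_apply_root', weyl_map_sub hL, weyl_map_smul hL, weyl_apply_coroot hL,
    Int.cast_zero, add_zero]

theorem IsDominant.sub_weyl_apply_mem_corootCone {lam : N} (hlam : IsDominant b lam)
    (hw : w ∈ weyl Φ) : lam - w lam ∈ corootCone b := by
  obtain ⟨L, rfl⟩ := exists_simpleProd_eq b hw
  induction hn : L.length using Nat.strong_induction_on generalizing L with
  | _ n ih =>
    by_cases h : ∀ i ∈ b.support, b.IsPos (pull Φ (simpleProd L)⁻¹ i)
    · rw [eq_one_of_isPos_pull_inv hw h, AffineEquiv.coe_one, id, sub_self]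
      exact zero_mem _
    · push Not at h
      obtain ⟨i, hi, h⟩ := h
      obtain ⟨L', hlen, hprod⟩ := simpleProd_exchange L ⟨i, hi⟩ h
      have hsub := ih L'.length (by omega) L' (simpleProd_mem_weyl L') rfl
      have hpos : b.IsPos (pull Φ (simpleProd L')⁻¹ i) := by
        rw [← hprod, pull_mul_simple_inv hw, isPos_opp]
        exact h
      have hL : simpleProd L = simpleProd L' * affRefl Φ i 0 := by
        rw [← hprod, mul_assoc, affRefl_mul_self, mul_one]
      obtain ⟨z, hz⟩ := hlam i hi
      rw [hL, simpleProd_mul_affRefl_apply L' ⟨i, hi⟩, show Φ.root' i lam = z from hz, ← sub_add]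
      exact add_mem hsub (nsmul_coroot_mem_corootCone hpos z)

variable [Φ.IsRootSystem] in
theorem IsDominant.weyl_apply_eq_of_nonneg {lam : N} (hlam : IsDominant b lam) (hw : w ∈ weyl Φ)
    (h : ∀ i ∈ b.support, 0 ≤ Φ.root' i (w lam)) : w lam = lam := by
  have hdom : IsDominant b (w lam) := by
    intro i hi
    obtain ⟨z, hz⟩ := hlam.isCoweight.exists_root'_eq_intCast (pull Φ w i)
    have hval : Φ.root' i (w lam) = z := (root'_weyl hw i lam).trans hz
    have hnonneg : (0 : ℤ) ≤ z := by exact_mod_cast (h i hi).trans_eq hval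
    lift z to ℕ using hnonneg
    exact ⟨z, hval⟩
  have hsub := hlam.sub_weyl_apply_mem_corootCone hw
  have hneg := hdom.sub_weyl_apply_mem_corootCone (inv_mem hw)
  rw [inv_apply_apply, ← neg_sub] at hneg
  exact (sub_eq_zero.1 (eq_zero_of_mem_corootCone_of_neg_mem hsub hneg)).symm

end CorootCone

/-! ### Saturated sets -/

section SaturatedSet

variable {b : Φ.Base} {w : N ≃ᵃ[ℝ] N} {lam ν : N}

theorem mem_saturatedSet : ν ∈ saturatedSet b lam ↔ ∀ w ∈ weyl Φ, lam - w ν ∈ corootCone b := by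
  simp only [saturatedSet, Set.mem_iInter, Set.mem_image, SetLike.mem_coe]
  constructor
  · intro h w hw
    obtain ⟨q, hq, hq'⟩ := h w⁻¹ (inv_mem hw)
    rw [← hq', apply_inv_apply, sub_sub_cancel]
    exact hq
  · intro h w hw
    refine ⟨_, h w⁻¹ (inv_mem hw), ?_⟩
    rw [sub_sub_cancel, apply_inv_apply]

theorem weyl_apply_mem_saturatedSet (hw : w ∈ weyl Φ) (h : ν ∈ saturatedSet b lam) :
    w ν ∈ saturatedSet b lam := by
  rw [mem_saturatedSet] at h ⊢
  exact fun v hv => h (v * w) (mul_mem hv hw)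

variable [Φ.IsCrystallographic]

theorem exists_root'_eq_intCast_of_mem_corootCone {q : N} (hq : q ∈ corootCone b) (a : ι) :
    ∃ z : ℤ, Φ.root' a q = z := by
  induction hq using AddSubmonoid.closure_induction with
  | mem x hx =>
    obtain ⟨i, -, rfl⟩ := hx
    exact ⟨_, root'_coroot a i⟩
  | zero => exact ⟨0, by rw [map_zero, Int.cast_zero]⟩
  | add x y _ _ hx hy =>
    obtain ⟨z, hz⟩ := hx
    obtain ⟨z', hz'⟩ := hy
    exact ⟨z + z', by rw [map_add, hz, hz', Int.cast_add]⟩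

theorem exists_root'_eq_intCast_of_mem_saturatedSet (hlam : IsDominant b lam)
    (h : ν ∈ saturatedSet b lam) (a : ι) : ∃ z : ℤ, Φ.root' a ν = z := by
  have hsub := mem_saturatedSet.1 h 1 (one_mem _)
  rw [AffineEquiv.coe_one, id] at hsub
  obtain ⟨z, hz⟩ := exists_root'_eq_intCast_of_mem_corootCone hsub a
  obtain ⟨z', hz'⟩ := hlam.isCoweight.exists_root'_eq_intCast a
  rw [map_sub, hz'] at hz
  exact ⟨z' - z, by rw [Int.cast_sub, ← hz, sub_sub_cancel]⟩

variable [Finite ι] [Φ.IsReduced]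

theorem IsDominant.mem_saturatedSet (hlam : IsDominant b lam) : lam ∈ saturatedSet b lam :=
  AlcoveWalks.mem_saturatedSet.2 fun _ hw => hlam.sub_weyl_apply_mem_corootCone hw

theorem sub_smul_coroot_mem_saturatedSet {a : ι} {z c : ℤ} (h : ν ∈ saturatedSet b lam)
    (hz : Φ.root' a ν = z) (hc : 0 ≤ c) (hcz : c ≤ z) :
    ν - (c : ℝ) • Φ.coroot a ∈ saturatedSet b lam := by
  have h' := weyl_apply_mem_saturatedSet (affRefl_mem_weyl (Φ := Φ) a) h
  rw [affRefl_apply_root', Int.cast_zero, add_zero, hz] at h'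
  rw [mem_saturatedSet] at h h' ⊢
  intro w hw
  rw [weyl_map_sub hw, weyl_map_smul hw, weyl_apply_coroot hw]
  by_cases hpos : b.IsPos (pull Φ w⁻¹ a)
  · rw [← sub_add]
    exact add_mem (h w hw) (zsmul_coroot_mem_corootCone hpos hc)
  · have hrefl := h' w hw
    rw [weyl_map_sub hw, weyl_map_smul hw, weyl_apply_coroot hw] at hrefl
    have hadd :=
      add_mem hrefl (zsmul_coroot_mem_corootCone ((isPos_opp b _).2 hpos) (sub_nonneg.2 hcz))
    rw [coroot_opp] at hadd
    convert! hadd using 1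
    push_cast
    module

theorem sub_smul_coroot_mem_saturatedSet_of_nonpos {a : ι} {z c : ℤ} (h : ν ∈ saturatedSet b lam)
    (hz : Φ.root' a ν = z) (hc : c ≤ 0) (hcz : z ≤ c) :
    ν - (c : ℝ) • Φ.coroot a ∈ saturatedSet b lam := by
  have hopp := sub_smul_coroot_mem_saturatedSet (a := opp Φ a) (z := -z) (c := -c) h
    (by rw [root'_opp, hz, Int.cast_neg]) (by omega) (by omega)
  rwa [coroot_opp, Int.cast_neg, neg_smul_neg] at hopp

variable [Φ.IsRootSystem]

omit [Φ.IsReduced]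

theorem bddAbove_maxStep {i : ι} (hi : i ∈ b.support) :
    BddAbove {m : ℕ | ν - m • Φ.coroot i ∈ saturatedSet b lam} := by
  refine ⟨⌊coheight b (lam - affRefl Φ i 0 ν)⌋₊, fun m hm => Nat.le_floor ?_⟩
  have hnonneg := coheight_nonneg (mem_saturatedSet.1 hm _ (affRefl_mem_weyl i))
  rw [weyl_map_sub (affRefl_mem_weyl i), ← Nat.cast_smul_eq_nsmul ℝ,
    weyl_map_smul (affRefl_mem_weyl i), weyl_apply_coroot (affRefl_mem_weyl i), affRefl_inv,
    pull_affRefl, show Φ.coroot (Φ.reflectionPerm i i) = -Φ.coroot i from coroot_opp i, ← sub_add,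
    map_add, map_smul, map_neg, coheight_coroot hi, smul_eq_mul] at hnonneg
  linarith

theorem sub_maxStep_smul_coroot_mem_saturatedSet {i : ι} (hi : i ∈ b.support)
    (h : ν ∈ saturatedSet b lam) :
    ν - maxStep b lam ν i • Φ.coroot i ∈ saturatedSet b lam :=
  Nat.sSup_mem (s := {m : ℕ | ν - m • Φ.coroot i ∈ saturatedSet b lam})
    ⟨0, show ν - 0 • Φ.coroot i ∈ saturatedSet b lam by rwa [zero_smul, sub_zero]⟩
    (bddAbove_maxStep hi)

theorem le_maxStep {i : ι} (hi : i ∈ b.support) {m : ℕ}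
    (h : ν - m • Φ.coroot i ∈ saturatedSet b lam) : m ≤ maxStep b lam ν i :=
  le_csSup (bddAbove_maxStep hi) h

end SaturatedSet

/-! ### Descending along maximal strings in a saturated set -/

section Descent

variable {b : Φ.Base} {v w₀ : N ≃ᵃ[ℝ] N} {lam μ : N} {θ i a : ι}

/-- The monoid generated by the positive coroots that `v⁻¹` makes negative. -/
def inversionCone (b : Φ.Base) (v : N ≃ᵃ[ℝ] N) : AddSubmonoid N :=
  AddSubmonoid.closure (Φ.coroot '' {a | b.IsPos a ∧ ¬ b.IsPos (pull Φ v⁻¹ a)})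

/-- The point `μ` is extremal in the saturated set with respect to the inversions of `v`: no other
point of the set lies in `μ - inversionCone b v`. -/
def IsExtremal (b : Φ.Base) (lam : N) (v : N ≃ᵃ[ℝ] N) (μ : N) : Prop :=
  ∀ x ∈ saturatedSet b lam, μ - x ∈ inversionCone b v → x = μ

/-- The point reached from `μ` by going to the end of the `α_i^∨`-string in the saturated set, for
the letters `i` of a word in turn. -/
def descend (b : Φ.Base) (lam : N) : N → List b.support → N
  | μ, [] => μ
  | μ, i :: word => descend b lam (μ - maxStep b lam μ i • Φ.coroot i) word

theorem coroot_mem_inversionCone (ha : b.IsPos a) (hva : ¬ b.IsPos (pull Φ v⁻¹ a)) :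
    Φ.coroot a ∈ inversionCone b v :=
  AddSubmonoid.subset_closure ⟨a, ⟨ha, hva⟩, rfl⟩

theorem inversionCone_one [Finite ι] : inversionCone b (1 : N ≃ᵃ[ℝ] N) = ⊥ := by
  rw [inversionCone, eq_bot_iff, AddSubmonoid.closure_le]
  rintro _ ⟨a, ha, rfl⟩
  rw [Set.mem_ofPred_eq, inv_one, pull_one] at ha
  exact absurd ha.1 ha.2

theorem inversionCone_le_corootCone [Finite ι] [Φ.IsCrystallographic] [Φ.IsReduced] :
    inversionCone b v ≤ corootCone b := by
  rw [inversionCone, AddSubmonoid.closure_le]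
  rintro _ ⟨a, ha, rfl⟩
  exact coroot_mem_corootCone ha.1

variable [Finite ι] [Φ.IsCrystallographic] [Φ.IsReduced]

theorem exists_coroot_sub_nsmul_eq (hi : i ∈ b.support) (ha : b.IsPos a) (hne : i ≠ a) {d : ℕ}
    (hd : (d : ℤ) ≤ Φ.pairingIn ℤ i a) :
    ∃ c, b.IsPos c ∧ Φ.coroot c = Φ.coroot a + (-(d : ℤ)) • Φ.coroot i := by
  have hne' : Φ.flip.root i ≠ -Φ.flip.root a := fun h => by
    have hia : i = opp Φ a := Φ.coroot.injective (by rw [coroot_opp]; exact h)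
    have hpos := RootPairing.Base.isPos_of_mem_support hi
    rw [hia, isPos_opp] at hpos
    exact hpos ha
  have := Module.IsReflexive.of_isPerfPair Φ.toLinearMap
  have := Module.IsReflexive.of_isPerfPair Φ.toLinearMap.flip
  have hlin := RootPairing.IsReduced.linearIndependent Φ.flip hne hne'
  have hchain := RootPairing.chainBotCoeff_sub_chainTopCoeff hlin
  have hflip : Φ.pairingIn ℤ i a = Φ.flip.pairingIn ℤ a i := rfl
  obtain ⟨c, hc⟩ := (RootPairing.root_sub_nsmul_mem_range_iff_le_chainBotCoeff hlin (n := d)).2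
    (by omega)
  have hc' : Φ.flip.root c = Φ.flip.root a + (-(d : ℤ)) • Φ.flip.root i := by
    rw [hc, neg_smul, natCast_zsmul, sub_eq_add_neg]
  exact ⟨c, (isPos_flip_iff c).1 (.add_zsmul hne.symm ((isPos_flip_iff a).2 ha) hi hc'), hc'⟩

theorem not_isPos_of_coroot_eq_add_neg_zsmul {a c e : ι} (ha : ¬ b.IsPos a) (he : b.IsPos e) {d : ℕ}
    (hc : Φ.coroot c = Φ.coroot a + (-(d : ℤ)) • Φ.coroot e) : ¬ b.IsPos c := by
  have hheight := b.flip.height_add_zsmul (i := a) (j := e) (k := c) hc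
  rw [← isPos_flip_iff, RootPairing.Base.isPos_iff] at ha he ⊢
  rw [hheight, smul_eq_mul]
  nlinarith

theorem coroot_sub_nsmul_mem_inversionCone (hv : v ∈ weyl Φ) (hi : i ∈ b.support)
    (hvi : b.IsPos (pull Φ v⁻¹ i)) (ha : b.IsPos a) (hva : ¬ b.IsPos (pull Φ v⁻¹ a)) {d : ℕ}
    (hd : (d : ℤ) ≤ Φ.pairingIn ℤ i a) : Φ.coroot a - d • Φ.coroot i ∈ inversionCone b v := by
  obtain ⟨c, hc, hcoroot⟩ := exists_coroot_sub_nsmul_eq hi ha (fun h => hva (h ▸ hvi)) hd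
  have hpull : Φ.coroot (pull Φ v⁻¹ c) =
      Φ.coroot (pull Φ v⁻¹ a) + (-(d : ℤ)) • Φ.coroot (pull Φ v⁻¹ i) := by
    rw [← weyl_apply_coroot hv, ← weyl_apply_coroot hv, ← weyl_apply_coroot hv, hcoroot,
      ← Int.cast_smul_eq_zsmul ℝ, ← Int.cast_smul_eq_zsmul ℝ, weyl_map_add hv, weyl_map_smul hv]
  rw [sub_eq_add_neg, ← natCast_zsmul, ← neg_smul, ← hcoroot]
  exact coroot_mem_inversionCone hc (not_isPos_of_coroot_eq_add_neg_zsmul hva hvi hpull)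

theorem sub_nsmul_mem_inversionCone (hv : v ∈ weyl Φ) (hi : i ∈ b.support)
    (hvi : b.IsPos (pull Φ v⁻¹ i)) {η : N} (hη : η ∈ inversionCone b v) :
    ∃ z : ℤ, Φ.root' i η = z ∧
      ∀ d : ℕ, (d : ℤ) ≤ max 0 z → η - d • Φ.coroot i ∈ inversionCone b v := by
  induction hη using AddSubmonoid.closure_induction with
  | mem x hx =>
    obtain ⟨a, ha, rfl⟩ := hx
    refine ⟨_, root'_coroot i a, fun d hd => ?_⟩
    rcases eq_or_ne d 0 with rfl | hd0
    · rw [zero_smul, sub_zero]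
      exact coroot_mem_inversionCone ha.1 ha.2
    · exact coroot_sub_nsmul_mem_inversionCone hv hi hvi ha.1 ha.2 (by omega)
  | zero =>
    refine ⟨0, by rw [map_zero, Int.cast_zero], fun d hd => ?_⟩
    obtain rfl : d = 0 := by omega
    rw [zero_smul, sub_zero]
    exact zero_mem _
  | add x y _ _ hx hy =>
    obtain ⟨z, hz, hxz⟩ := hx
    obtain ⟨t, ht, hyt⟩ := hy
    refine ⟨z + t, by rw [map_add, hz, ht, Int.cast_add], fun d hd => ?_⟩
    have hsplit : d = min d (max 0 z).toNat + (d - min d (max 0 z).toNat) := by omega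
    rw [hsplit, add_smul, add_sub_add_comm]
    exact add_mem (hxz _ (by omega)) (hyt _ (by omega))

theorem exists_of_mem_inversionCone_mul_affRefl (hv : v ∈ weyl Φ) (hi : i ∈ b.support) {κ : N}
    (hκ : κ ∈ inversionCone b (v * affRefl Φ i 0)) :
    ∃ (n : ℕ) (η : N), η ∈ inversionCone b v ∧ κ = n • Φ.coroot i + affRefl Φ i 0 η := by
  induction hκ using AddSubmonoid.closure_induction with
  | mem x hx =>
    obtain ⟨c, ⟨hc, hvc⟩, rfl⟩ := hx
    rcases eq_or_ne c i with rfl | hci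
    · exact ⟨1, 0, zero_mem _, by rw [weyl_map_zero (affRefl_mem_weyl c), one_smul, add_zero]⟩
    · refine ⟨0, Φ.coroot (Φ.reflectionPerm i c), coroot_mem_inversionCone ?_ ?_, ?_⟩
      · exact hc.reflectionPerm hi hci
      · rwa [mul_inv_rev, affRefl_inv, pull_mul (affRefl_mem_affRootAut _ _)
          (inv_mem (weyl_le_affRootAut hv)), pull_affRefl] at hvc
      · rw [zero_smul, zero_add, ← pull_affRefl i 0,
          weyl_apply_coroot_pull (affRefl_mem_weyl i)]
  | zero =>
    exact ⟨0, 0, zero_mem _, by rw [weyl_map_zero (affRefl_mem_weyl i), zero_smul, zero_add]⟩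
  | add x y _ _ hx hy =>
    obtain ⟨n, η, hη, rfl⟩ := hx
    obtain ⟨n', η', hη', rfl⟩ := hy
    refine ⟨n + n', η + η', add_mem hη hη', ?_⟩
    rw [weyl_map_add (affRefl_mem_weyl i)]
    module

theorem IsExtremal.exists_eq_add_smul_coroot (hlam : IsDominant b lam) (hv : v ∈ weyl Φ)
    (hi : i ∈ b.support) (hvi : b.IsPos (pull Φ v⁻¹ i)) (h : IsExtremal b lam v μ) {m : ℕ}
    (hm : Φ.root' i μ ≤ m) {x : N} (hx : x ∈ saturatedSet b lam)
    (hmem : μ - m • Φ.coroot i - x ∈ inversionCone b (v * affRefl Φ i 0)) :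
    ∃ k : ℤ, x = μ + (k : ℝ) • Φ.coroot i := by
  obtain ⟨n, η, hη, hκ⟩ := exists_of_mem_inversionCone_mul_affRefl hv hi hmem
  obtain ⟨z, hz, hshrink⟩ := sub_nsmul_mem_inversionCone hv hi hvi hη
  have hxη : x = μ - η + ((z - n - m : ℤ) : ℝ) • Φ.coroot i := by
    rw [affRefl_apply_root', hz, Int.cast_zero, add_zero, ← Nat.cast_smul_eq_nsmul ℝ,
      ← Nat.cast_smul_eq_nsmul ℝ, sub_eq_iff_eq_add, ← sub_eq_iff_eq_add'] at hκ
    rw [← hκ]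
    push_cast
    module
  rcases le_or_gt 0 (z - n - m) with ht | ht
  · have hμx := hshrink (z - n - m).toNat (by omega)
    rw [← Nat.cast_smul_eq_nsmul ℝ, ← Int.cast_natCast, Int.toNat_of_nonneg ht] at hμx
    refine ⟨0, ?_⟩
    rw [Int.cast_zero, zero_smul, add_zero]
    refine h x hx ?_
    rwa [hxη, ← sub_sub, sub_sub_cancel]
  · obtain ⟨e, he⟩ := exists_root'_eq_intCast_of_mem_saturatedSet hlam hx i
    have hroot : (e : ℝ) = Φ.root' i μ - z + (z - n - m) * 2 := by
      rw [← he, hxη, map_add, map_sub, map_smul, root'_coroot, Φ.pairingIn_same, hz, smul_eq_mul]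
      push_cast
      rfl
    have hle : e ≤ z - n - m := by
      have hreal : (e : ℝ) ≤ z - n - m := by linarith [n.cast_nonneg (α := ℝ)]
      exact_mod_cast hreal
    have hμη := sub_smul_coroot_mem_saturatedSet_of_nonpos hx he ht.le hle
    rw [hxη, add_sub_cancel_right] at hμη
    exact ⟨z - n - m, by rw [hxη, h _ hμη (by rwa [sub_sub_cancel])]⟩

variable [Φ.IsRootSystem]

theorem IsLongest.neg_apply_mem_inversionCone (hθ : IsHighestRoot b θ) (hw₀ : IsLongest b θ w₀)
    {q : N} (hq : q ∈ corootCone b) : -w₀ q ∈ inversionCone b w₀ := by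
  induction hq using AddSubmonoid.closure_induction with
  | mem x hx =>
    obtain ⟨i, hi, rfl⟩ := hx
    rw [weyl_apply_coroot hw₀.1, ← coroot_opp]
    have hpos : b.IsPos (opp Φ (pull Φ w₀⁻¹ i)) := (isPos_opp b _).2
      (hw₀.not_isPos_pull_inv hθ (RootPairing.Base.isPos_of_mem_support hi))
    exact coroot_mem_inversionCone hpos (hw₀.not_isPos_pull_inv hθ hpos)
  | zero =>
    rw [weyl_map_zero hw₀.1, neg_zero]
    exact zero_mem _
  | add x y _ _ hx hy =>
    rw [weyl_map_add hw₀.1, neg_add]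
    exact add_mem hx hy

theorem root'_le_maxStep (hlam : IsDominant b lam) (hi : i ∈ b.support)
    (hμ : μ ∈ saturatedSet b lam) : Φ.root' i μ ≤ maxStep b lam μ i := by
  obtain ⟨z, hz⟩ := exists_root'_eq_intCast_of_mem_saturatedSet hlam hμ i
  rw [hz]
  rcases le_or_gt 0 z with hz0 | hz0
  · have hmem := sub_smul_coroot_mem_saturatedSet hμ hz hz0 le_rfl
    lift z to ℕ using hz0
    rw [Int.cast_natCast, Nat.cast_smul_eq_nsmul] at hmem
    exact_mod_cast le_maxStep hi hmem
  · exact (Int.cast_nonpos.2 hz0.le).trans (Nat.cast_nonneg _)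

theorem IsExtremal.sub_maxStep (hlam : IsDominant b lam) (hv : v ∈ weyl Φ) (hi : i ∈ b.support)
    (hvi : b.IsPos (pull Φ v⁻¹ i)) (hμ : μ ∈ saturatedSet b lam) (h : IsExtremal b lam v μ) :
    IsExtremal b lam (v * affRefl Φ i 0) (μ - maxStep b lam μ i • Φ.coroot i) := by
  intro x hx hmem
  have hmax : ∀ m : ℕ, μ - m • Φ.coroot i ∈ saturatedSet b lam → m ≤ maxStep b lam μ i :=
    fun m hm => le_maxStep hi hm
  obtain ⟨k, hk⟩ := h.exists_eq_add_smul_coroot hlam hv hi hvi (root'_le_maxStep hlam hi hμ) hx hmem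
  generalize maxStep b lam μ i = m at *
  have hmk : 0 ≤ m + k := by
    by_contra! hcon
    have hk' : ((-k).toNat : ℝ) = -k := by
      rw [← Int.cast_natCast, Int.toNat_of_nonneg (by omega), Int.cast_neg]
    have hle := hmax (-k).toNat
      (by rwa [← Nat.cast_smul_eq_nsmul ℝ, hk', neg_smul, sub_neg_eq_add, ← hk])
    omega
  have hdiff : μ - m • Φ.coroot i - x = -(((m + k : ℤ) : ℝ) • Φ.coroot i) := by
    rw [hk, ← Nat.cast_smul_eq_nsmul ℝ]
    push_cast
    module
  have hpos := zsmul_coroot_mem_corootCone (RootPairing.Base.isPos_of_mem_support hi) hmk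
  have hneg := inversionCone_le_corootCone hmem
  rw [hdiff] at hneg
  rw [eq_zero_of_mem_corootCone_of_neg_mem hpos hneg, neg_zero, sub_eq_zero] at hdiff
  exact hdiff.symm

theorem len_mul_simpleProd_le (hθ : IsHighestRoot b θ) (hv : v ∈ weyl Φ) (L : List b.support) :
    len b θ (v * simpleProd L) ≤ len b θ v + L.length := by
  induction L generalizing v with
  | nil => rw [simpleProd_nil, mul_one, List.length_nil, add_zero]
  | cons i L ih =>
    have htail := ih (mul_mem hv (affRefl_mem_weyl (Φ := Φ) i))
    have hhead := len_mul_gen_le hθ (weyl_le_affRootAut hv) (some i)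
    rw [gen] at hhead
    rw [simpleProd_cons, ← mul_assoc, List.length_cons]
    omega

theorem IsExtremal.descend (hθ : IsHighestRoot b θ) (hlam : IsDominant b lam) (hv : v ∈ weyl Φ)
    (hμ : μ ∈ saturatedSet b lam) (h : IsExtremal b lam v μ) (L : List b.support)
    (hL : len b θ (v * simpleProd L) = len b θ v + L.length) :
    IsExtremal b lam (v * simpleProd L) (descend b lam μ L) ∧
      AlcoveWalks.descend b lam μ L ∈ saturatedSet b lam := by
  induction L generalizing v μ with
  | nil =>
    rw [simpleProd_nil, mul_one]
    exact ⟨h, hμ⟩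
  | cons i L ih =>
    have hv' := mul_mem hv (affRefl_mem_weyl (Φ := Φ) i)
    have hle := len_mul_simpleProd_le hθ hv' L
    rw [simpleProd_cons, ← mul_assoc, List.length_cons] at hL
    have hpos : b.IsPos (pull Φ v⁻¹ i) := by
      by_contra hcon
      have hlen := len_mul_simple_of_not_isPos hθ hv hcon
      omega
    have hlen := len_mul_simple_of_isPos hθ hv hpos
    rw [simpleProd_cons, ← mul_assoc]
    exact ih hv' (sub_maxStep_smul_coroot_mem_saturatedSet i.2 hμ)
      (h.sub_maxStep hlam hv i.2 hpos hμ) (by omega)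

theorem descend_longest (hθ : IsHighestRoot b θ) (hw₀ : IsLongest b θ w₀)
    (hlam : IsDominant b lam) (hμ : μ ∈ saturatedSet b lam) {L : List b.support}
    (hL : IsReducedWord b θ L w₀) : descend b lam μ L = w₀ lam := by
  rw [isReducedWord_iff] at hL
  have hone : IsExtremal b lam (1 : N ≃ᵃ[ℝ] N) μ := fun x _ hx => by
    rw [inversionCone_one, AddSubmonoid.mem_bot, sub_eq_zero] at hx
    exact hx.symm
  obtain ⟨hext, hmem⟩ := hone.descend hθ hlam (one_mem _) hμ L
    (by rw [one_mul, hL.1, len_one hθ, zero_add, hL.2])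
  rw [one_mul, hL.1] at hext
  refine (hext _ (weyl_apply_mem_saturatedSet hw₀.1 hlam.mem_saturatedSet) ?_).symm
  have hcone := hw₀.neg_apply_mem_inversionCone hθ
    (mem_saturatedSet.1 hmem w₀⁻¹ (inv_mem hw₀.1))
  rwa [weyl_map_sub hw₀.1, apply_inv_apply, neg_sub] at hcone

end Descent

/-! ### Reduced words -/

section ReducedWords

variable {b : Φ.Base} {θ a : ι} {k l : ℕ} {v w x γ : N ≃ᵃ[ℝ] N} {lam : N}
  {word : List (Option b.support)} {s : Option b.support}

/-- The product of the Coxeter generators along a word. -/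
def genProd (b : Φ.Base) (θ : ι) (word : List (Option b.support)) : N ≃ᵃ[ℝ] N :=
  (word.map (gen b θ)).prod

theorem genProd_nil : genProd b θ [] = 1 := rfl

theorem genProd_cons (s : Option b.support) (word : List (Option b.support)) :
    genProd b θ (s :: word) = gen b θ s * genProd b θ word := by
  rw [genProd, List.map_cons, List.prod_cons, genProd]

theorem genProd_append (word word' : List (Option b.support)) :
    genProd b θ (word ++ word') = genProd b θ word * genProd b θ word' := by
  rw [genProd, List.map_append, List.prod_append, genProd, genProd]

theorem genProd_take_succ (hs : word[k]? = some s) :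
    genProd b θ (word.take (k + 1)) = genProd b θ (word.take k) * gen b θ s := by
  rw [List.take_add_one, hs, genProd_append, Option.toList_some, genProd_cons, genProd_nil, mul_one]

theorem genProd_take_succ_of_none (hk : word[k]? = none) :
    genProd b θ (word.take (k + 1)) = genProd b θ (word.take k) := by
  rw [List.take_add_one, hk, Option.toList_none, List.append_nil]

theorem isReducedExpr_iff : IsReducedExpr b θ word γ w ↔
    γ ∈ lengthZero b θ ∧ genProd b θ word * γ = w ∧ word.length = len b θ w := Iff.rfl

variable [Finite ι] [Φ.IsCrystallographic]

theorem genProd_mem_affRootAut (word : List (Option b.support)) :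
    genProd b θ word ∈ affRootAut Φ := by
  refine list_prod_mem fun x hx => ?_
  obtain ⟨s, -, rfl⟩ := List.mem_map.1 hx
  exact gen_mem_affRootAut s

variable [Φ.IsRootSystem] [Φ.IsReduced]

theorem len_genProd_take_le (hθ : IsHighestRoot b θ) (word : List (Option b.support)) (k d : ℕ) :
    len b θ (genProd b θ (word.take (k + d))) ≤ len b θ (genProd b θ (word.take k)) + d := by
  induction d with
  | zero => exact le_rfl
  | succ d ih =>
    rw [← add_assoc]
    cases hs : word[k + d]? with
    | none =>
      rw [genProd_take_succ_of_none hs]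
      omega
    | some s =>
      rw [genProd_take_succ hs]
      have hstep := len_mul_gen_le hθ (genProd_mem_affRootAut (θ := θ) (word.take (k + d))) s
      omega

namespace IsReducedExpr

theorem level_le (hθ : IsHighestRoot b θ) (h : IsReducedExpr b θ word γ w)
    (hs : word[k]? = some s) :
    level b (genProd b θ (word.take k)) (wallRoot b θ (genProd b θ (word.take k)) s) ≤
      level b (1 : N ≃ᵃ[ℝ] N) (wallRoot b θ (genProd b θ (word.take k)) s) := by
  rw [isReducedExpr_iff] at h
  have hk : k < word.length := (List.getElem?_eq_some_iff.1 hs).1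
  have hlen : len b θ (genProd b θ word) = word.length := by
    rw [← len_mul_lengthZero hθ (genProd_mem_affRootAut word) h.1, h.2.1, h.2.2]
  have hhead := len_genProd_take_le hθ word 0 k
  have htail := len_genProd_take_le hθ word (k + 1) (word.length - (k + 1))
  rw [List.take_of_length_le (by omega), hlen, genProd_take_succ hs] at htail
  rw [List.take_zero, zero_add, genProd_nil, len_one hθ] at hhead
  have hstep := len_mul_gen hθ (genProd_mem_affRootAut (θ := θ) (word.take k)) s
  split_ifs at hstep with hle
  · exact hle
  · omega

theorem level_lt (hθ : IsHighestRoot b θ) (h : IsReducedExpr b θ word γ w)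
    (hs : word[k]? = some s) (hl : k + 1 ≤ l) :
    level b (genProd b θ (word.take l)) (wallRoot b θ (genProd b θ (word.take k)) s) <
      level b (genProd b θ (word.take k)) (wallRoot b θ (genProd b θ (word.take k)) s) := by
  have hle := h.level_le hθ hs
  have hbefore := level_wallRoot hθ (genProd_mem_affRootAut (θ := θ) (word.take k)) s
  have hafter := level_mul_gen_wallRoot hθ (genProd_mem_affRootAut (θ := θ) (word.take k)) s
  rw [← genProd_take_succ hs] at hafter
  generalize wallRoot b θ (genProd b θ (word.take k)) s = c at *
  generalize wallLevel b θ (genProd b θ (word.take k)) s = j at *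
  induction l, hl using Nat.le_induction with
  | base => omega
  | succ l _ ih =>
    cases ht : word[l]? with
    | none => rwa [genProd_take_succ_of_none ht]
    | some t =>
      by_contra! hcon
      rw [genProd_take_succ ht] at hcon
      have hx := genProd_mem_affRootAut (θ := θ) (word.take l)
      have hlt := h.level_le hθ ht
      generalize genProd b θ (word.take l) = x at *
      have hwall := (eq_wall (s := t) (a := c) (k := j) hθ
        (mul_mem hx (gen_mem_affRootAut (θ := θ) t)) (by omega)
        (by rw [mul_gen_mul_gen]; omega)).1
      rw [← (opp_wallRoot_eq_and_neg_wallLevel_eq hθ hx t).1] at hwall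
      have hlt' := ih.trans_le hle
      rw [hwall, level_opp hx, level_opp (one_mem _)] at hlt'
      omega

theorem level_wallRoot_lt (hθ : IsHighestRoot b θ) (h : IsReducedExpr b θ word γ w)
    (hs : word[k]? = some s) :
    level b w (wallRoot b θ (genProd b θ (word.take k)) s) <
      level b (1 : N ≃ᵃ[ℝ] N) (wallRoot b θ (genProd b θ (word.take k)) s) := by
  have hlt := h.level_lt hθ hs (l := word.length) (List.getElem?_eq_some_iff.1 hs).1
  rw [List.take_length] at hlt
  obtain ⟨hγ, hprod, -⟩ := isReducedExpr_iff.1 h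
  rw [← hprod, level_mul_lengthZero hθ (genProd_mem_affRootAut word) hγ]
  exact hlt.trans_le (h.level_le hθ hs)

end IsReducedExpr

end ReducedWords

/-! ### The Bruhat order -/

section BruhatOrder

variable {b : Φ.Base} {θ : ι} {w x γ : N ≃ᵃ[ℝ] N} {lam : N} {s : Option b.support}

/-- The element `x` is obtained from `y` by a reflection that moves it closer to `1`. -/
def BruhatStep (b : Φ.Base) (y x : N ≃ᵃ[ℝ] N) : Prop :=
  ∃ a k, x = affRefl Φ a k * y ∧ -k ≤ level b (1 : N ≃ᵃ[ℝ] N) a ∧ level b y a < -k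

/-- The Bruhat order, with the larger element first. -/
def BruhatLE (b : Φ.Base) (w x : N ≃ᵃ[ℝ] N) : Prop :=
  Relation.ReflTransGen (BruhatStep b) w x

variable [Finite ι] [Φ.IsCrystallographic]

theorem BruhatLE.mem_affRootAut (hw : w ∈ affRootAut Φ) (h : BruhatLE b w x) :
    x ∈ affRootAut Φ := by
  induction h with
  | refl => exact hw
  | tail _ h ih =>
    obtain ⟨a, k, rfl, -, -⟩ := h
    exact mul_mem (affRefl_mem_affRootAut a k) ih

variable [Φ.IsReduced] in
theorem BruhatLE.apply_zero_mem_saturatedSet (hw : w ∈ affRootAut Φ) (h : BruhatLE b w x)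
    (hw0 : w 0 ∈ saturatedSet b lam) : x 0 ∈ saturatedSet b lam := by
  induction h with
  | refl => exact hw0
  | @tail y x hwy hyx ih =>
    obtain ⟨a, k, rfl, hone, hya⟩ := hyx
    have hy := BruhatLE.mem_affRootAut hw hwy
    rw [mul_apply, affRefl_apply_root', ← shift_eq_root'_apply_zero hy, ← Int.cast_add]
    have hshift := shift_le_level_add_one (b := b) y a
    have hk := level_le_shift (b := b) (1 : N ≃ᵃ[ℝ] N) a
    rw [shift_one] at hk
    exact sub_smul_coroot_mem_saturatedSet_of_nonpos ih (shift_eq_root'_apply_zero hy a).symm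
      (by omega) (by omega)

variable [Φ.IsRootSystem]

theorem bruhatStep_mul_gen (hθ : IsHighestRoot b θ) (hw : w ∈ affRootAut Φ)
    (h : level b w (wallRoot b θ w s) ≤ level b (1 : N ≃ᵃ[ℝ] N) (wallRoot b θ w s)) :
    BruhatStep b (w * gen b θ s) w := by
  refine ⟨wallRoot b θ w s, wallLevel b θ w s, ?_, ?_, ?_⟩
  · rw [mul_gen_eq_affRefl_mul hw, affRefl_mul_cancel_left]
  · rwa [← level_wallRoot hθ hw]
  · rw [level_mul_gen_wallRoot hθ hw]
    omega

theorem BruhatLE.mul_lengthZero (hθ : IsHighestRoot b θ) (hw : w ∈ affRootAut Φ)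
    (hγ : γ ∈ lengthZero b θ) (hx : BruhatLE b w x) : BruhatLE b (w * γ) (x * γ) := by
  induction hx with
  | refl => exact Relation.ReflTransGen.refl
  | @tail y x hwy hyx ih =>
    obtain ⟨a, k, rfl, hone, hya⟩ := hyx
    refine ih.tail ⟨a, k, by rw [mul_assoc], hone, ?_⟩
    rwa [level_mul_lengthZero hθ (BruhatLE.mem_affRootAut hw hwy) hγ]

variable [Φ.IsReduced]

theorem BruhatLE.mul_gen (hθ : IsHighestRoot b θ) (hw : w ∈ affRootAut Φ)
    (h : level b w (wallRoot b θ w s) ≤ level b (1 : N ≃ᵃ[ℝ] N) (wallRoot b θ w s))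
    (hx : BruhatLE b w x) : BruhatLE b (w * gen b θ s) (x * gen b θ s) := by
  induction hx with
  | refl => exact Relation.ReflTransGen.refl
  | @tail y x hwy hyx ih =>
    obtain ⟨a, k, rfl, hone, hya⟩ := hyx
    rcases lt_or_ge (level b (y * gen b θ s) a) (-k) with hlt | hge
    · exact ih.tail ⟨a, k, by rw [mul_assoc], hone, hlt⟩
    · have hys := mul_mem (BruhatLE.mem_affRootAut hw hwy) (gen_mem_affRootAut (θ := θ) s)
      obtain ⟨rfl, rfl⟩ := eq_wall (s := s) (a := a) (k := k) hθ hys hge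
        (by rw [mul_gen_mul_gen]; exact hya)
      rw [mul_assoc, ← mul_gen_eq_affRefl_mul hys, mul_gen_mul_gen]
      exact Relation.ReflTransGen.head (bruhatStep_mul_gen hθ hw h) hwy

end BruhatOrder

/-! ### Steps of alcove walks -/

namespace Walk

section Steps

variable {b : Φ.Base} {p : Walk b} {k n : ℕ} {s : Option b.support} {m : Move} {θ a : ι} {j : ℤ}
  {w γ : N ≃ᵃ[ℝ] N} {word : List (Option b.support)}

/-- Step `k` is a fold. -/
def IsFold (p : Walk b) (k : ℕ) : Prop := ∃ s, p.steps[k]? = some (s, .fold)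

/-- Step `k` is a negative crossing. -/
def IsNegCross (θ : ι) (p : Walk b) (k : ℕ) : Prop :=
  ∃ s, p.steps[k]? = some (s, .cross) ∧ b.IsPos (wallRoot b θ (p.pos θ k) s)

/-- Step `k` is a positive crossing. -/
def IsPosCross (θ : ι) (p : Walk b) (k : ℕ) : Prop :=
  ∃ s, p.steps[k]? = some (s, .cross) ∧ ¬ b.IsPos (wallRoot b θ (p.pos θ k) s)

theorem isFold_iff (h : p.steps[k]? = some (s, m)) : p.IsFold k ↔ m = .fold := by
  simp [IsFold, h]

theorem isNegCross_iff (h : p.steps[k]? = some (s, m)) :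
    p.IsNegCross θ k ↔ m = .cross ∧ b.IsPos (wallRoot b θ (p.pos θ k) s) := by
  simp [IsNegCross, h, and_assoc]

theorem isPosCross_iff (h : p.steps[k]? = some (s, m)) :
    p.IsPosCross θ k ↔ m = .cross ∧ ¬ b.IsPos (wallRoot b θ (p.pos θ k) s) := by
  simp [IsPosCross, h, and_assoc]

theorem IsFold.lt_length (h : p.IsFold k) : k < p.steps.length := by
  obtain ⟨s, hs⟩ := h
  exact (List.getElem?_eq_some_iff.1 hs).1

theorem IsPosCross.lt_length (h : p.IsPosCross θ k) : k < p.steps.length := by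
  obtain ⟨s, hs, -⟩ := h
  exact (List.getElem?_eq_some_iff.1 hs).1

theorem exists_steps_eq (hk : k < p.steps.length) : ∃ s m, p.steps[k]? = some (s, m) :=
  ⟨_, _, List.getElem?_eq_getElem hk⟩

theorem pos_zero : p.pos θ 0 = 1 := rfl

theorem pos_succ_cross (h : p.steps[k]? = some (s, .cross)) :
    p.pos θ (k + 1) = p.pos θ k * gen b θ s := by
  rw [pos, pos, List.take_add_one, h]
  simp

theorem pos_succ_fold (h : p.steps[k]? = some (s, .fold)) : p.pos θ (k + 1) = p.pos θ k := by
  rw [pos, pos, List.take_add_one, h]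
  simp

theorem pos_succ_of_none (h : p.steps[k]? = none) : p.pos θ (k + 1) = p.pos θ k := by
  rw [pos, pos, List.take_add_one, h, Option.toList_none, List.append_nil]

variable [Finite ι] [Φ.IsCrystallographic]

theorem pos_mem_affRootAut (p : Walk b) (k : ℕ) : p.pos θ k ∈ affRootAut Φ := by
  induction k with
  | zero => exact one_mem _
  | succ k ih =>
    cases h : p.steps[k]? with
    | none => rwa [pos_succ_of_none h]
    | some st =>
      obtain ⟨s, _ | _⟩ := st
      · rw [pos_succ_cross h]
        exact mul_mem ih (gen_mem_affRootAut s)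
      · rwa [pos_succ_fold h]

theorem endAlcove_mem_affRootAut (h : p.sheet ∈ lengthZero b θ) : p.endAlcove θ ∈ affRootAut Φ :=
  mul_mem (pos_mem_affRootAut p _) (mem_affRootAut_of_mem_lengthZero h)

variable [Φ.IsRootSystem]

theorem level_endAlcove (hθ : IsHighestRoot b θ) (h : p.sheet ∈ lengthZero b θ) (a : ι) :
    level b (p.endAlcove θ) a = level b (p.pos θ p.steps.length) a :=
  level_mul_lengthZero hθ (pos_mem_affRootAut p _) h a

variable [Φ.IsReduced]

theorem negCrossingOn_iff (hθ : IsHighestRoot b θ) : p.NegCrossingOn θ k a j ↔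
    ∃ s, p.steps[k]? = some (s, .cross) ∧ a = wallRoot b θ (p.pos θ k) s ∧
      j = wallLevel b θ (p.pos θ k) s := by
  simp only [NegCrossingOn, onPos_onNeg_iff hθ (pos_mem_affRootAut p k)]

theorem posFoldOn_iff (hθ : IsHighestRoot b θ) : p.PosFoldOn θ k a j ↔
    ∃ s, p.steps[k]? = some (s, .fold) ∧ a = wallRoot b θ (p.pos θ k) s ∧
      j = wallLevel b θ (p.pos θ k) s := by
  simp only [PosFoldOn, onPos_onNeg_iff hθ (pos_mem_affRootAut p k)]

theorem posCrossingOn_iff (hθ : IsHighestRoot b θ) : p.PosCrossingOn θ k a j ↔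
    ∃ s, p.steps[k]? = some (s, .cross) ∧ a = opp Φ (wallRoot b θ (p.pos θ k) s) ∧
      j = -wallLevel b θ (p.pos θ k) s := by
  simp only [PosCrossingOn, onNeg_onPos_iff hθ (pos_mem_affRootAut p k)]

theorem exists_posCrossingOn_iff (hθ : IsHighestRoot b θ) :
    (∃ a j, b.IsPos a ∧ p.PosCrossingOn θ k a j) ↔ p.IsPosCross θ k := by
  simp only [posCrossingOn_iff hθ]
  constructor
  · rintro ⟨a, j, ha, s, hs, rfl, -⟩
    exact ⟨s, hs, (isPos_opp b _).1 ha⟩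
  · rintro ⟨s, hs, h⟩
    exact ⟨_, _, (isPos_opp b _).2 h, s, hs, rfl, rfl⟩

theorem positivelyFolded_iff (hθ : IsHighestRoot b θ) : p.PositivelyFolded θ ↔
    ∀ k s, p.steps[k]? = some (s, .fold) → b.IsPos (wallRoot b θ (p.pos θ k) s) := by
  refine forall_congr' fun k => forall_congr' fun s => forall_congr' fun hs => ?_
  simp only [posFoldOn_iff hθ]
  constructor
  · rintro ⟨a, j, ha, s', hs', rfl, -⟩
    obtain rfl : s = s' := congrArg Prod.fst (Option.some_inj.1 (hs.symm.trans hs'))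
    exact ha
  · exact fun h => ⟨_, _, h, s, hs, rfl, rfl⟩

end Steps

/-! ### The dimension of a walk -/

section Dimension

variable {b : Φ.Base} {θ : ι} {k n : ℕ}

open Classical in
/-- The number of folds of a walk. -/
def folds (p : Walk b) : ℕ := Nat.count p.IsFold p.steps.length

open Classical in
theorem ncard_setOf_eq_count {P : ℕ → Prop} (hP : ∀ k, P k → k < n) :
    {k | P k}.ncard = Nat.count P n := by
  rw [Nat.count_eq_card_filter_range, ← Set.ncard_coe_finset]
  congr 1
  ext k
  simp only [Set.mem_ofPred_eq, Finset.coe_filter, Finset.mem_range]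
  exact ⟨fun h => ⟨hP k h, h⟩, fun h => h.2⟩

open Classical in
theorem count_isPosCross_add_count_isFold_add_count_isNegCross (p : Walk b)
    (hk : k ≤ p.steps.length) :
    Nat.count (p.IsPosCross θ) k + Nat.count p.IsFold k + Nat.count (p.IsNegCross θ) k = k := by
  induction k with
  | zero => simp only [Nat.count_zero]
  | succ k ih =>
    obtain ⟨s, m, hst⟩ := exists_steps_eq (Nat.lt_of_succ_le hk)
    have hstep : (if p.IsPosCross θ k then 1 else 0) + (if p.IsFold k then 1 else 0) +
        (if p.IsNegCross θ k then 1 else 0) = 1 := by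
      rw [isPosCross_iff hst, isFold_iff hst, isNegCross_iff hst]
      cases m <;> by_cases hpos : b.IsPos (wallRoot b θ (p.pos θ k) s) <;> simp [hpos]
    rw [Nat.count_succ, Nat.count_succ, Nat.count_succ]
    linarith [ih (Nat.le_of_succ_le hk)]

variable [Finite ι] [Φ.IsRootSystem] [Φ.IsCrystallographic] [Φ.IsReduced]

open Classical in
theorem levelSum_pos (hθ : IsHighestRoot b θ) (p : Walk b) (hk : k ≤ p.steps.length) :
    levelSum b (p.pos θ k) = Nat.count (p.IsPosCross θ) k - Nat.count (p.IsNegCross θ) k := by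
  induction k with
  | zero =>
    rw [Nat.count_zero, Nat.count_zero, sub_self, pos_zero, levelSum]
    exact Finset.sum_eq_zero fun a ha => level_one_of_isPos (mem_posRoots.1 ha)
  | succ k ih =>
    have ih := ih (Nat.le_of_succ_le hk)
    obtain ⟨s, m, hst⟩ := exists_steps_eq (Nat.lt_of_succ_le hk)
    rw [Nat.count_succ, Nat.count_succ, isPosCross_iff hst, isNegCross_iff hst]
    cases m with
    | fold =>
      rw [pos_succ_fold hst, ih]
      simp
    | cross =>
      rw [pos_succ_cross hst, levelSum_mul_gen hθ (pos_mem_affRootAut p k), ih]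
      by_cases hpos : b.IsPos (wallRoot b θ (p.pos θ k) s) <;> simp [hpos] <;> ring

open Classical in
theorem dim_eq_count (hθ : IsHighestRoot b θ) (p : Walk b) :
    p.dim θ = Nat.count (p.IsPosCross θ) p.steps.length + p.folds := by
  rw [folds, ← ncard_setOf_eq_count fun k hk => hk.lt_length,
    ← ncard_setOf_eq_count fun k hk => hk.lt_length]
  simp only [dim, exists_posCrossingOn_iff hθ]
  rfl

theorem two_mul_dim (hθ : IsHighestRoot b θ) (p : Walk b) :
    2 * (p.dim θ : ℤ) = p.steps.length + p.folds + levelSum b (p.pos θ p.steps.length) := by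
  classical
  have htotal := count_isPosCross_add_count_isFold_add_count_isNegCross (θ := θ) p le_rfl
  rw [levelSum_pos hθ p le_rfl, dim_eq_count hθ p, folds]
  omega

end Dimension

section Bruhat

variable [Finite ι] [Φ.IsRootSystem] [Φ.IsCrystallographic] [Φ.IsReduced] {b : Φ.Base} {θ : ι}
  {p : Walk b} {w γ : N ≃ᵃ[ℝ] N} {word : List (Option b.support)}

theorem bruhatLE_pos (hθ : IsHighestRoot b θ) (h : IsReducedExpr b θ word γ w)
    (htype : p.steps.map Prod.fst = word) (k : ℕ) :
    BruhatLE b (genProd b θ (word.take k)) (p.pos θ k) := by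
  have hletter : ∀ k, word[k]? = p.steps[k]?.map Prod.fst := fun k => by
    rw [← htype, List.getElem?_map]
  induction k with
  | zero => exact Relation.ReflTransGen.refl
  | succ k ih =>
    cases hst : p.steps[k]? with
    | none => rwa [pos_succ_of_none hst, genProd_take_succ_of_none (by rw [hletter, hst]; rfl)]
    | some st =>
      obtain ⟨s, m⟩ := st
      have hs : word[k]? = some s := by
        rw [hletter, hst]
        rfl
      have hle := h.level_le hθ hs
      have hmem := genProd_mem_affRootAut (θ := θ) (word.take k)
      rw [genProd_take_succ hs]
      cases m with
      | cross =>
        rw [pos_succ_cross hst]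
        exact ih.mul_gen hθ hmem hle
      | fold =>
        rw [pos_succ_fold hst]
        exact Relation.ReflTransGen.head (bruhatStep_mul_gen hθ hmem hle) ih

theorem bruhatLE_endAlcove (hθ : IsHighestRoot b θ) (h : IsReducedExpr b θ word γ w)
    (htype : p.steps.map Prod.fst = word) (hsheet : p.sheet = γ) :
    BruhatLE b w (p.endAlcove θ) := by
  have hpos := bruhatLE_pos hθ h htype word.length
  rw [List.take_length] at hpos
  obtain ⟨hγ, hprod, -⟩ := isReducedExpr_iff.1 h
  have hend := hpos.mul_lengthZero hθ (genProd_mem_affRootAut word) hγ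
  rwa [hprod, ← hsheet, ← htype, List.length_map] at hend

end Bruhat

end Walk

/-! ### Inversions and the half sum of the positive roots -/

section Inversions

variable {b : Φ.Base} {a c : ι} {x u : N ≃ᵃ[ℝ] N}

open Classical in
/-- The positive one of the roots `±a`. -/
def absRoot (b : Φ.Base) (a : ι) : ι := if b.IsPos a then a else opp Φ a

theorem absRoot_of_isPos (h : b.IsPos a) : absRoot b a = a := if_pos h

theorem absRoot_of_not_isPos (h : ¬ b.IsPos a) : absRoot b a = opp Φ a := if_neg h

theorem isPos_absRoot (a : ι) : b.IsPos (absRoot b a) := by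
  by_cases h : b.IsPos a
  · rwa [absRoot_of_isPos h]
  · rwa [absRoot_of_not_isPos h, isPos_opp]

theorem eq_or_eq_opp_of_absRoot_eq (h : absRoot b a = absRoot b c) : a = c ∨ a = opp Φ c := by
  by_cases ha : b.IsPos a <;> by_cases hc : b.IsPos c
  · rw [absRoot_of_isPos ha, absRoot_of_isPos hc] at h
    exact Or.inl h
  · rw [absRoot_of_isPos ha, absRoot_of_not_isPos hc] at h
    exact Or.inr h
  · rw [absRoot_of_not_isPos ha, absRoot_of_isPos hc] at h
    exact Or.inr (opp_involutive.eq_iff.1 h)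
  · rw [absRoot_of_not_isPos ha, absRoot_of_not_isPos hc] at h
    exact Or.inl (opp_involutive.injective h)

theorem isPos_of_root'_pos {v : N} (hv : ∀ i ∈ b.support, 0 ≤ Φ.root' i v)
    (h : 0 < Φ.root' a v) : b.IsPos a := by
  by_contra hneg
  have hopp := root'_nonneg_of_isPos ((isPos_opp b a).2 hneg) hv
  rw [root'_opp] at hopp
  linarith

theorem not_isPos_iff_root'_rhoVee_neg [Φ.IsRootSystem] :
    ¬ b.IsPos a ↔ Φ.root' a (rhoVee b) < 0 := by
  rw [← isPos_opp, isPos_iff_root'_rhoVee_pos, root'_opp, neg_pos]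

open Classical in
/-- The injection from the inversions of `x` to those of `s_c x` that are different from `c`. -/
def reflectInversion (b : Φ.Base) (c a : ι) : ι :=
  if b.IsPos (Φ.reflectionPerm c a) then Φ.reflectionPerm c a else a

theorem reflectInversion_injOn (b : Φ.Base) (c : ι) :
    Set.InjOn (reflectInversion b c) {a | b.IsPos a} := by
  intro a ha d hd h
  rw [Set.mem_ofPred_eq] at ha hd
  simp only [reflectInversion] at h
  split_ifs at h with hca hcd hcd
  · exact (Φ.reflectionPerm c).injective h
  · rw [← h, RootPairing.reflectionPerm_self] at hcd
    exact absurd ha hcd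
  · rw [h, RootPairing.reflectionPerm_self] at hca
    exact absurd hd hca
  · exact h

variable [Finite ι]

theorem sum_absRoot_pull {A : Type*} [AddCommMonoid A] (hx : x ∈ affRootAut Φ) (F : ι → A) :
    ∑ a ∈ posRoots b, F (absRoot b (pull Φ x a)) = ∑ a ∈ posRoots b, F a := by
  have hmaps : ∀ a ∈ posRoots b, absRoot b (pull Φ x a) ∈ posRoots b :=
    fun a _ => mem_posRoots.2 (isPos_absRoot _)
  have hinj : Set.InjOn (fun a => absRoot b (pull Φ x a)) (posRoots b) := by
    intro a ha c hc h
    rw [Finset.mem_coe, mem_posRoots] at ha hc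
    rcases eq_or_eq_opp_of_absRoot_eq h with heq | heq
    · exact pull_injective hx heq
    · rw [← pull_opp hx] at heq
      rw [pull_injective hx heq, isPos_opp] at ha
      exact absurd hc ha
  exact Finset.sum_nbij _ hmaps hinj
    (Finset.surjOn_of_injOn_of_card_le _ hmaps hinj le_rfl) fun a _ => rfl

theorem sum_pull_of_even {A : Type*} [AddCommMonoid A] (hx : x ∈ affRootAut Φ) (F : ι → A)
    (hF : ∀ a, F (opp Φ a) = F a) :
    ∑ a ∈ posRoots b, F (pull Φ x a) = ∑ a ∈ posRoots b, F a := by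
  rw [← sum_absRoot_pull hx F]
  refine Finset.sum_congr rfl fun a _ => ?_
  by_cases h : b.IsPos (pull Φ x a)
  · rw [absRoot_of_isPos h]
  · rw [absRoot_of_not_isPos h, hF]

open Classical in
/-- The positive roots that the linear part of `x⁻¹` makes negative. -/
def inversions (b : Φ.Base) (x : N ≃ᵃ[ℝ] N) : Finset ι :=
  (posRoots b).filter fun a => ¬ b.IsPos (pull Φ x a)

open Classical in
theorem mem_inversions : a ∈ inversions b x ↔ b.IsPos a ∧ ¬ b.IsPos (pull Φ x a) :=
  Finset.mem_filter.trans (and_congr_left' mem_posRoots)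

section Reflection

variable [Φ.IsCrystallographic]

theorem pull_affRefl_mul (hx : x ∈ affRootAut Φ) (c : ι) (j : ℤ) (a : ι) :
    pull Φ (affRefl Φ c j * x) a = pull Φ x (Φ.reflectionPerm c a) := by
  rw [pull_mul (affRefl_mem_affRootAut c j) hx, pull_affRefl]

theorem mem_inversions_affRefl_mul_self (hx : x ∈ affRootAut Φ) (hc : b.IsPos c)
    (hxc : b.IsPos (pull Φ x c)) (j : ℤ) : c ∈ inversions b (affRefl Φ c j * x) := by
  rw [mem_inversions, pull_affRefl_mul hx]
  refine ⟨hc, ?_⟩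
  change ¬ b.IsPos (pull Φ x (opp Φ c))
  rwa [pull_opp hx, isPos_opp, not_not]

variable [Φ.IsRootSystem]

theorem not_isPos_pull_reflectionPerm (hx : x ∈ affRootAut Φ) (hc : b.IsPos c)
    (hxc : b.IsPos (pull Φ x c)) (ha : a ∈ inversions b x)
    (hca : ¬ b.IsPos (Φ.reflectionPerm c a)) :
    ¬ b.IsPos (pull Φ x (Φ.reflectionPerm c a)) := by
  rw [mem_inversions, isPos_iff_root'_rhoVee_pos, not_isPos_iff_root'_rhoVee_neg] at ha
  rw [isPos_iff_root'_rhoVee_pos] at hc hxc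
  rw [not_isPos_iff_root'_rhoVee_neg, root'_reflectionPerm] at hca
  rw [not_isPos_iff_root'_rhoVee_neg, pull_reflectionPerm hx, root'_reflectionPerm,
    pairingIn_pull hx]
  have hpairing : (0 : ℝ) < Φ.pairingIn ℤ a c := by
    by_contra! hle
    nlinarith [ha.1]
  nlinarith [ha.2, mul_pos hpairing hxc]

open Classical in
theorem reflectInversion_mem (hx : x ∈ affRootAut Φ) (hc : b.IsPos c)
    (hxc : b.IsPos (pull Φ x c)) (ha : a ∈ inversions b x) (j : ℤ) :
    reflectInversion b c a ∈ (inversions b (affRefl Φ c j * x)).erase c := by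
  obtain ⟨hpos, hinv⟩ := mem_inversions.1 ha
  rw [Finset.mem_erase, mem_inversions, pull_affRefl_mul hx, reflectInversion]
  split_ifs with hca
  · rw [RootPairing.reflectionPerm_self]
    refine ⟨fun heq => ?_, hca, hinv⟩
    have hopp := congrArg (Φ.reflectionPerm c) heq
    rw [RootPairing.reflectionPerm_self, ← opp] at hopp
    rw [hopp, isPos_opp] at hpos
    exact hpos hc
  · refine ⟨?_, hpos, not_isPos_pull_reflectionPerm hx hc hxc ha hca⟩
    rintro rfl
    exact hinv hxc

theorem card_inversions_lt (hx : x ∈ affRootAut Φ) (hc : b.IsPos c)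
    (hxc : b.IsPos (pull Φ x c)) (j : ℤ) :
    (inversions b x).card < (inversions b (affRefl Φ c j * x)).card := by
  classical
  have hle := Finset.card_le_card_of_injOn (reflectInversion b c)
    (fun a ha => reflectInversion_mem hx hc hxc ha j)
    ((reflectInversion_injOn b c).mono fun a ha => (mem_inversions.1 ha).1)
  exact hle.trans_lt (Finset.card_erase_lt_of_mem (mem_inversions_affRefl_mul_self hx hc hxc j))

end Reflection

end Inversions

section Rho

variable [Fintype ι] {b : Φ.Base} {x : N ≃ᵃ[ℝ] N}

open Classical in
theorem two_mul_rho (b : Φ.Base) (v : N) :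
    2 * Φ.toLinearMap (rho b) v = ∑ a ∈ posRoots b, Φ.root' a v := by
  rw [rho, map_smul, map_sum, LinearMap.smul_apply, LinearMap.sum_apply, smul_eq_mul, ← mul_assoc,
    mul_one_div_cancel two_ne_zero, one_mul]
  exact Finset.sum_congr (Finset.ext fun a => Finset.mem_filter_univ a |>.trans mem_posRoots.symm)
    fun a _ => rfl

theorem levelSum_eq (hx : x ∈ affRootAut Φ) :
    (levelSum b x : ℝ) = 2 * Φ.toLinearMap (rho b) (x 0) - (inversions b x).card := by
  classical
  rw [two_mul_rho, inversions, Finset.card_filter, levelSum, Int.cast_sum, Nat.cast_sum,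
    ← Finset.sum_sub_distrib]
  refine Finset.sum_congr rfl fun a _ => ?_
  rw [← shift_eq_root'_apply_zero hx]
  by_cases h : b.IsPos (pull Φ x a)
  · rw [level_of_isPos h, if_neg (not_not.2 h), Nat.cast_zero, sub_zero]
  · rw [level_of_not_isPos h, if_pos h, Int.cast_sub, Int.cast_one, Nat.cast_one]

end Rho

/-! ### The number of folds -/

section Folds

variable [Finite ι] [Φ.IsRootSystem] [Φ.IsCrystallographic] [Φ.IsReduced]
  {b : Φ.Base} {θ : ι} {k : ℕ} {w γ : N ≃ᵃ[ℝ] N} {word : List (Option b.support)}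
  {s : Option b.support}

theorem IsReducedExpr.isPos_pull_simpleRoot (hθ : IsHighestRoot b θ)
    (h : IsReducedExpr b θ word γ w)
    (hw : ∀ c, level b w c < level b (1 : N ≃ᵃ[ℝ] N) c → b.IsPos (pull Φ w c))
    (hs : word[k]? = some s) :
    b.IsPos (pull Φ (genProd b θ (word.drop k) * γ) (simpleRoot b θ s)) := by
  obtain ⟨hγ, hprod, -⟩ := isReducedExpr_iff.1 h
  have htake := genProd_mem_affRootAut (θ := θ) (word.take k)
  have hdrop := genProd_mem_affRootAut (θ := θ) (word.drop k)
  have hsplit : w = genProd b θ (word.take k) * (genProd b θ (word.drop k) * γ) := by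
    rw [← mul_assoc, ← genProd_append, List.take_append_drop, hprod]
  have hpos := hw _ (h.level_wallRoot_lt hθ hs)
  rwa [hsplit, pull_mul htake (mul_mem hdrop (mem_affRootAut_of_mem_lengthZero hγ)),
    pull_wallRoot htake] at hpos

namespace Walk

variable {p : Walk b}

open Classical in
theorem count_isFold_le_card_inversions (hθ : IsHighestRoot b θ)
    (h : IsReducedExpr b θ word γ w)
    (hw : ∀ c, level b w c < level b (1 : N ≃ᵃ[ℝ] N) c → b.IsPos (pull Φ w c))
    (hfold : p.PositivelyFolded θ) (htype : p.steps.map Prod.fst = word)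
    (hk : k ≤ p.steps.length) :
    Nat.count p.IsFold k ≤
      (inversions b (p.pos θ k * (genProd b θ (word.drop k) * γ))).card := by
  have hγ := mem_affRootAut_of_mem_lengthZero (isReducedExpr_iff.1 h).1
  induction k with
  | zero =>
    rw [Nat.count_zero]
    exact Nat.zero_le _
  | succ k ih =>
    have ih := ih (Nat.le_of_succ_le hk)
    obtain ⟨s, m, hst⟩ := exists_steps_eq (Nat.lt_of_succ_le hk)
    have hs : word[k]? = some s := by
      rw [← htype, List.getElem?_map, hst]
      rfl
    have hdrop : genProd b θ (word.drop k) = gen b θ s * genProd b θ (word.drop (k + 1)) := by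
      obtain ⟨hlt, hget⟩ := List.getElem?_eq_some_iff.1 hs
      rw [List.drop_eq_getElem_cons hlt, hget, genProd_cons]
    rw [Nat.count_succ, isFold_iff hst]
    cases m with
    | cross =>
      rw [if_neg Move.noConfusion, add_zero, pos_succ_cross hst, mul_assoc, ← mul_assoc (gen b θ s),
        ← hdrop]
      exact ih
    | fold =>
      have hx := pos_mem_affRootAut (θ := θ) p k
      have hy := mul_mem (genProd_mem_affRootAut (θ := θ) (word.drop k)) hγ
      have hreflect : p.pos θ k * (genProd b θ (word.drop (k + 1)) * γ) =
          affRefl Φ (wallRoot b θ (p.pos θ k) s) (wallLevel b θ (p.pos θ k) s) *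
            (p.pos θ k * (genProd b θ (word.drop k) * γ)) := by
        rw [hdrop, ← mul_assoc (affRefl _ _ _), ← mul_gen_eq_affRefl_mul hx]
        simp only [← mul_assoc, mul_gen_mul_gen]
      rw [if_pos rfl, pos_succ_fold hst, hreflect]
      refine Nat.succ_le_of_lt (ih.trans_lt (card_inversions_lt (mul_mem hx hy)
        ((positivelyFolded_iff hθ).1 hfold k s hst) ?_ _))
      rw [pull_mul hx hy, pull_wallRoot hx]
      exact h.isPos_pull_simpleRoot hθ hw hs

theorem folds_le (hθ : IsHighestRoot b θ) (h : IsReducedExpr b θ word γ w)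
    (hw : ∀ c, level b w c < level b (1 : N ≃ᵃ[ℝ] N) c → b.IsPos (pull Φ w c))
    (hfold : p.PositivelyFolded θ) (htype : p.steps.map Prod.fst = word) (hsheet : p.sheet = γ) :
    p.folds ≤ (inversions b (p.endAlcove θ)).card := by
  have hcount := count_isFold_le_card_inversions hθ h hw hfold htype le_rfl
  rwa [← htype, ← List.length_map Prod.fst, List.drop_length, genProd_nil, one_mul,
    List.length_map, ← hsheet] at hcount

end Walk

end Folds

/-! ### Minimal coset representatives -/

section MinimalRepresentatives

variable [Finite ι] [Φ.IsRootSystem] [Φ.IsCrystallographic] [Φ.IsReduced]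
  {b : Φ.Base} {θ a : ι} {u u' w : N ≃ᵃ[ℝ] N} {lam : N}

theorem isPos_pull_inv_simple_of_mem_minReps (hθ : IsHighestRoot b θ) (hu : u ∈ minReps b θ lam)
    {i : b.support} (h0 : Φ.root' i lam = 0) : b.IsPos (pull Φ u⁻¹ i) := by
  by_contra hneg
  have hlen := len_mul_simple_of_not_isPos hθ hu.1 hneg
  have hmin := hu.2 (affRefl Φ i 0) (affRefl_mem_weyl i.1) (by simp [affRefl_apply_root', h0])
  omega

theorem isPos_pull_inv_of_mem_minReps (hθ : IsHighestRoot b θ) (hlam : IsDominant b lam)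
    (hu : u ∈ minReps b θ lam) (ha : b.IsPos a) (h0 : Φ.root' a lam = 0) :
    b.IsPos (pull Φ u⁻¹ a) := by
  have hcoeff (i : b.support) : 0 ≤ Φ.root' a (fundCoweight b i) :=
    root'_nonneg_of_isPos ha (root'_simple_fundCoweight_nonneg b i)
  have hu' := inv_mem hu.1
  rw [root'_eq_sum_fundCoweight b, Finset.sum_eq_zero_iff_of_nonneg fun i _ =>
    mul_nonneg (hcoeff i) (hlam.root'_nonneg i i.2)] at h0
  by_contra hneg
  rw [not_isPos_iff_root'_rhoVee_neg, ← root'_weyl hu', root'_eq_sum_fundCoweight b] at hneg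
  refine hneg.not_ge (Finset.sum_nonneg fun i hi => ?_)
  rcases mul_eq_zero.1 (h0 i hi) with h | h
  · rw [h, zero_mul]
  · rw [root'_weyl hu']
    exact mul_nonneg (hcoeff i)
      (isPos_iff_root'_rhoVee_pos.1 (isPos_pull_inv_simple_of_mem_minReps hθ hu h)).le

theorem isPos_pull_iff_of_mem_minReps (hθ : IsHighestRoot b θ) (hlam : IsDominant b lam)
    (hu : u ∈ minReps b θ lam) (h0 : Φ.root' (pull Φ u a) lam = 0) :
    b.IsPos (pull Φ u a) ↔ b.IsPos a := by
  have hmem := weyl_le_affRootAut hu.1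
  by_cases h : b.IsPos (pull Φ u a)
  · have ha := isPos_pull_inv_of_mem_minReps hθ hlam hu h h0
    rw [pull_inv_pull hmem] at ha
    exact iff_of_true h ha
  · have ha := isPos_pull_inv_of_mem_minReps hθ hlam hu ((isPos_opp b _).2 h)
      (by rw [root'_opp, h0, neg_zero])
    rw [pull_opp (inv_mem hmem), pull_inv_pull hmem, isPos_opp] at ha
    exact iff_of_false h ha

theorem eq_of_mem_minReps_of_apply_eq (hθ : IsHighestRoot b θ) (hlam : IsDominant b lam)
    (hu : u ∈ minReps b θ lam) (hu' : u' ∈ minReps b θ lam) (h : u lam = u' lam) : u = u' := by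
  have hv : u⁻¹ * u' ∈ weyl Φ := mul_mem (inv_mem hu.1) hu'.1
  have hfix : (u⁻¹ * u')⁻¹ lam = lam := by
    rw [mul_inv_rev, inv_inv, mul_apply, h, inv_apply_apply]
  refine inv_mul_eq_one.1 (eq_one_of_isPos_pull_inv (b := b) hv fun i hi => ?_)
  have hlam_i : Φ.root' (pull Φ (u⁻¹ * u')⁻¹ i) lam = Φ.root' i lam := by
    rw [← root'_weyl (inv_mem hv), hfix]
  by_contra hneg
  have hpos := (isPos_opp b _).2 hneg
  have hopp := root'_nonneg_of_isPos hpos hlam.root'_nonneg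
  rw [root'_opp, hlam_i] at hopp
  have h0 : Φ.root' i lam = 0 := le_antisymm (neg_nonneg.1 hopp) (hlam.root'_nonneg i hi)
  have hu_opp := isPos_pull_inv_of_mem_minReps hθ hlam hu hpos
    (by rw [root'_opp, hlam_i, h0, neg_zero])
  have hu'_i := isPos_pull_inv_of_mem_minReps hθ hlam hu'
    (RootPairing.Base.isPos_of_mem_support hi) h0
  have hmul : (u⁻¹ * u')⁻¹ * u⁻¹ = u'⁻¹ := by rw [mul_inv_rev, inv_inv, mul_inv_cancel_right]
  rw [pull_opp (inv_mem (weyl_le_affRootAut hu.1)), isPos_opp,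
    ← pull_mul (inv_mem (weyl_le_affRootAut hv)) (inv_mem (weyl_le_affRootAut hu.1)),
    hmul] at hu_opp
  exact hu_opp hu'_i

omit [Finite ι] [Φ.IsRootSystem] [Φ.IsCrystallographic] [Φ.IsReduced] in
theorem exists_mem_minReps_apply_eq (hw : w ∈ weyl Φ) : ∃ u ∈ minReps b θ lam, u lam = w lam := by
  let S := {v : N ≃ᵃ[ℝ] N | v ∈ weyl Φ ∧ v lam = w lam}
  have hS : S.Nonempty := ⟨w, hw, rfl⟩
  obtain ⟨hmem, heq⟩ := Function.argminOn_mem (len b θ) S hS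
  refine ⟨_, ⟨hmem, fun v hv hvl => ?_⟩, heq⟩
  exact Function.argminOn_le (len b θ) S ⟨mul_mem hmem hv, by rw [mul_apply, hvl, heq]⟩

end MinimalRepresentatives

/-! ### The shortest element of a double coset -/

section ShortestElement

variable [Finite ι] {b : Φ.Base} {θ a : ι} {u w x m γ : N ≃ᵃ[ℝ] N} {lam : N}

theorem IsCoweight.trans_mem_affRootAut (hlam : IsCoweight b lam) : trans lam ∈ affRootAut Φ :=
  AlcoveWalks.trans_mem_affRootAut hlam.exists_root'_eq_intCast

variable [Φ.IsCrystallographic]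

theorem level_weyl_mul (hu : u ∈ weyl Φ) (hx : x ∈ affRootAut Φ) (a : ι) :
    level b (u * x) a = level b x (pull Φ u a) := by
  rw [level_mul (weyl_le_affRootAut hu) hx, shift_weyl hu, zero_add]

theorem pull_trans_mul (ht : trans lam ∈ affRootAut Φ) (hw : w ∈ weyl Φ) (a : ι) :
    pull Φ (trans lam * w) a = pull Φ w a := by
  rw [pull_mul ht (weyl_le_affRootAut hw), pull_trans ht]

theorem shift_trans_mul (ht : trans lam ∈ affRootAut Φ) (hw : w ∈ weyl Φ) (a : ι) :
    (shift Φ (trans lam * w) a : ℝ) = Φ.root' a lam := by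
  rw [shift_eq_root'_apply_zero (mul_mem ht (weyl_le_affRootAut hw)), mul_apply, weyl_map_zero hw,
    trans_apply, add_zero]

theorem mem_affRootAut_of_mem_doubleCoset (hlam : IsCoweight b lam) (hx : x ∈ doubleCoset Φ lam) :
    x ∈ affRootAut Φ := by
  obtain ⟨v, hv, w, hw, rfl⟩ := hx
  exact mul_mem (mul_mem (weyl_le_affRootAut hv) hlam.trans_mem_affRootAut) (weyl_le_affRootAut hw)

/-- The shape of the shortest element of the double coset of a dominant translation. -/
structure IsShortest (b : Φ.Base) (lam : N) (m w : N ≃ᵃ[ℝ] N) : Prop where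
  mem_weyl : w ∈ weyl Φ
  eq_trans_mul : m = trans lam * w
  isPos_pull : ∀ a, b.IsPos a → Φ.root' a lam = 0 → b.IsPos (pull Φ w a)
  not_isPos_pull : ∀ a, b.IsPos a → 0 < Φ.root' a lam → ¬ b.IsPos (pull Φ w a)

namespace IsShortest

theorem mem_affRootAut (hlam : IsDominant b lam) (hm : IsShortest b lam m w) :
    m ∈ affRootAut Φ := by
  rw [hm.eq_trans_mul]
  exact mul_mem hlam.isCoweight.trans_mem_affRootAut (weyl_le_affRootAut hm.mem_weyl)

theorem shift_eq (hlam : IsDominant b lam) (hm : IsShortest b lam m w) (a : ι) :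
    (shift Φ m a : ℝ) = Φ.root' a lam := by
  rw [hm.eq_trans_mul, shift_trans_mul hlam.isCoweight.trans_mem_affRootAut hm.mem_weyl]

theorem pull_eq (hlam : IsDominant b lam) (hm : IsShortest b lam m w) (a : ι) :
    pull Φ m a = pull Φ w a := by
  rw [hm.eq_trans_mul, pull_trans_mul hlam.isCoweight.trans_mem_affRootAut hm.mem_weyl]

theorem root'_eq_zero (hlam : IsDominant b lam) (hm : IsShortest b lam m w)
    (h : shift Φ m a = 0) : Φ.root' a lam = 0 := by
  rw [← hm.shift_eq hlam, h, Int.cast_zero]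

theorem isPos_and_not_isPos_pull (hlam : IsDominant b lam) (hm : IsShortest b lam m w)
    (h : 0 < shift Φ m a) : b.IsPos a ∧ ¬ b.IsPos (pull Φ m a) := by
  have hroot : 0 < Φ.root' a lam := by
    rw [← hm.shift_eq hlam]
    exact_mod_cast h
  have ha := isPos_of_root'_pos hlam.root'_nonneg hroot
  rw [hm.pull_eq hlam]
  exact ⟨ha, hm.not_isPos_pull a ha hroot⟩

theorem level_of_shift_pos (hlam : IsDominant b lam) (hm : IsShortest b lam m w)
    (h : 0 < shift Φ m a) : level b m a = shift Φ m a - 1 :=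
  level_of_not_isPos (hm.isPos_and_not_isPos_pull hlam h).2

theorem not_isPos_and_isPos_pull (hlam : IsDominant b lam) (hm : IsShortest b lam m w)
    (h : shift Φ m a < 0) : ¬ b.IsPos a ∧ b.IsPos (pull Φ m a) := by
  have hmem := hm.mem_affRootAut hlam
  have hopp := hm.isPos_and_not_isPos_pull (a := opp Φ a) hlam (by rwa [shift_opp hmem, neg_pos])
  rwa [pull_opp hmem, isPos_opp, isPos_opp, not_not] at hopp

theorem isPos_pull_iff (hlam : IsDominant b lam) (hm : IsShortest b lam m w)
    (h : shift Φ m a = 0) : b.IsPos (pull Φ m a) ↔ b.IsPos a := by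
  have h0 := hm.root'_eq_zero hlam h
  rw [hm.pull_eq hlam]
  by_cases ha : b.IsPos a
  · exact iff_of_true (hm.isPos_pull a ha h0) ha
  · have hopp := hm.isPos_pull (opp Φ a) ((isPos_opp b a).2 ha) (by rw [root'_opp, h0, neg_zero])
    rw [pull_opp (weyl_le_affRootAut hm.mem_weyl), isPos_opp] at hopp
    exact iff_of_false hopp ha

theorem level_of_shift_eq_zero (hlam : IsDominant b lam) (hm : IsShortest b lam m w)
    (h : shift Φ m a = 0) : level b m a = level b (1 : N ≃ᵃ[ℝ] N) a := by
  have hiff := hm.isPos_pull_iff hlam h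
  by_cases ha : b.IsPos a
  · rw [level_one_of_isPos ha, level_of_isPos (hiff.2 ha), h]
  · rw [level_one_of_not_isPos ha, level_of_not_isPos (mt hiff.1 ha), h, zero_sub]

theorem level_nonneg (hlam : IsDominant b lam) (hm : IsShortest b lam m w) (ha : b.IsPos a) :
    0 ≤ level b m a := by
  rcases lt_trichotomy (shift Φ m a) 0 with h | h | h
  · exact absurd ha (hm.not_isPos_and_isPos_pull hlam h).1
  · rw [hm.level_of_shift_eq_zero hlam h, level_one_of_isPos ha]
  · rw [hm.level_of_shift_pos hlam h]
    exact Int.sub_nonneg_of_le h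

end IsShortest

section Minimality

variable [Φ.IsRootSystem] [Φ.IsReduced]

theorem len_simple_mul_lt (hθ : IsHighestRoot b θ) (hx : x ∈ affRootAut Φ) {i : ι}
    (hi : i ∈ b.support) (h : level b x i < 0) : len b θ (affRefl Φ i 0 * x) < len b θ x := by
  have hs := affRefl_mem_weyl (Φ := Φ) i
  have hsimple := RootPairing.Base.isPos_of_mem_support hi
  have habs (a : ι) (ha : b.IsPos a) (hne : a ≠ i) :
      absRoot b (pull Φ (affRefl Φ i 0) a) = pull Φ (affRefl Φ i 0) a := by
    rw [pull_affRefl]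
    refine absRoot_of_isPos ((isPos_reflectionPerm_simple hi hne ?_).2 ha)
    rintro rfl
    exact (isPos_opp b i).1 ha hsimple
  have hlt : (level b x (opp Φ i)).natAbs < (level b x (absRoot b (opp Φ i))).natAbs := by
    rw [absRoot_of_not_isPos (mt (isPos_opp b i).1 (not_not.2 hsimple)), opp_involutive,
      level_opp hx]
    lia
  rw [len_eq hθ hx, len_eq hθ (mul_mem (weyl_le_affRootAut hs) hx),
    ← sum_absRoot_pull (weyl_le_affRootAut hs) fun a => (level b x a).natAbs]
  simp only [level_weyl_mul hs hx]
  refine Finset.sum_lt_sum (fun a ha => ?_) ⟨i, mem_posRoots.2 hsimple, ?_⟩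
  · rcases eq_or_ne a i with rfl | hne
    · rw [pull_affRefl]
      exact hlt.le
    · rw [habs a (mem_posRoots.1 ha) hne]
  · rw [pull_affRefl]
    exact hlt

omit [Φ.IsReduced] in
theorem level_nonneg_of_isPos (hθ : IsHighestRoot b θ) (hx : x ∈ affRootAut Φ)
    (h : ∀ i ∈ b.support, 0 ≤ level b x i) (ha : b.IsPos a) : 0 ≤ level b x a := by
  obtain ⟨v, hv⟩ := fundAlcove_nonempty hθ
  have hlevel (c : ι) := root'_apply_mem_Ioo_level hθ hx c hv
  have hnonneg : 0 ≤ Φ.root' a (x v) := root'_nonneg_of_isPos ha fun i hi =>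
    (Int.cast_nonneg (h i hi)).trans (hlevel i).1.le
  have hlt : (-1 : ℝ) < level b x a := by linarith [(hlevel a).2]
  exact_mod_cast hlt

namespace IsMinimalIn

theorem level_simple_nonneg (hθ : IsHighestRoot b θ) (hlam : IsCoweight b lam)
    (hm : IsMinimalIn b θ lam m) {i : ι} (hi : i ∈ b.support) : 0 ≤ level b m i := by
  by_contra! hneg
  have hlt := len_simple_mul_lt hθ (mem_affRootAut_of_mem_doubleCoset hlam hm.1) hi hneg
  obtain ⟨⟨v, hv, w, hw, rfl⟩, hmin⟩ := hm
  exact hlt.not_ge (hmin _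
    ⟨affRefl Φ i 0 * v, mul_mem (affRefl_mem_weyl i) hv, w, hw, by simp only [mul_assoc]⟩)

theorem exists_eq_trans_mul (hθ : IsHighestRoot b θ) (hlam : IsDominant b lam)
    (hm : IsMinimalIn b θ lam m) : ∃ w ∈ weyl Φ, m = trans lam * w := by
  have hmem := mem_affRootAut_of_mem_doubleCoset hlam.isCoweight hm.1
  have hlevel (i : ι) := hm.level_simple_nonneg hθ hlam.isCoweight (i := i)
  obtain ⟨⟨v, hv, w, hw, rfl⟩, -⟩ := hm
  have hv_lam : v lam = lam := by
    refine IsDominant.weyl_apply_eq_of_nonneg hlam hv fun i hi => ?_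
    have hzero : (v * trans lam * w) 0 = v lam := by
      rw [mul_apply, mul_apply, weyl_map_zero hw, trans_apply, add_zero]
    rw [← hzero, ← shift_eq_root'_apply_zero hmem]
    exact Int.cast_nonneg ((hlevel i hi).trans (level_le_shift _ _))
  exact ⟨v * w, mul_mem hv hw, by rw [weyl_mul_trans hv, hv_lam, mul_assoc]⟩

theorem root'_inv_apply_nonpos (hθ : IsHighestRoot b θ) (hlam : IsDominant b lam) (hw : w ∈ weyl Φ)
    (hm : IsMinimalIn b θ lam (trans lam * w)) (i : b.support) : Φ.root' i (w⁻¹ lam) ≤ 0 := by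
  have ht := hlam.isCoweight.trans_mem_affRootAut
  have hmem := mem_affRootAut_of_mem_doubleCoset hlam.isCoweight hm.1
  have hpull : pull Φ (trans lam * w) (pull Φ w⁻¹ i) = i := by
    rw [pull_trans_mul ht hw, pull_pull_inv (weyl_le_affRootAut hw)]
  have hwall : wallRoot b θ (trans lam * w) (some i) = pull Φ w⁻¹ i :=
    pull_injective hmem ((pull_wallRoot hmem _).trans hpull.symm)
  have hmin : len b θ (trans lam * w) ≤ len b θ (trans lam * w * gen b θ (some i)) :=
    hm.2 _ ⟨1, one_mem _, w * affRefl Φ i 0, mul_mem hw (affRefl_mem_weyl i.1),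
      by rw [one_mul, mul_assoc]; rfl⟩
  have hlen := len_mul_gen hθ hmem (some i)
  have hle : level b (trans lam * w) (pull Φ w⁻¹ i) ≤ level b (1 : N ≃ᵃ[ℝ] N) (pull Φ w⁻¹ i) := by
    by_contra hcon
    rw [hwall, if_neg hcon] at hlen
    lia
  have hone := level_le_shift (b := b) (1 : N ≃ᵃ[ℝ] N) (pull Φ w⁻¹ i)
  rw [shift_one] at hone
  rw [root'_weyl (inv_mem hw), ← shift_trans_mul ht hw, ← level_of_isPos (hpull ▸ isPos_simple i)]
  exact_mod_cast hle.trans hone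

theorem exists_isShortest (hθ : IsHighestRoot b θ) (hlam : IsDominant b lam)
    (hm : IsMinimalIn b θ lam m) : ∃ w, IsShortest b lam m w := by
  obtain ⟨w, hw, rfl⟩ := hm.exists_eq_trans_mul hθ hlam
  have ht := hlam.isCoweight.trans_mem_affRootAut
  have hmem := mem_affRootAut_of_mem_doubleCoset hlam.isCoweight hm.1
  refine ⟨w, hw, rfl, fun a ha h0 => ?_, fun a _ hpos hw_a => ?_⟩
  · have hlevel := level_nonneg_of_isPos hθ hmem
      (fun i => hm.level_simple_nonneg hθ hlam.isCoweight) ha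
    by_contra hneg
    rw [← pull_trans_mul ht hw] at hneg
    have hshift : shift Φ (trans lam * w) a = 0 := by
      exact_mod_cast (shift_trans_mul ht hw a).trans h0
    rw [level_of_not_isPos hneg, hshift] at hlevel
    exact absurd hlevel (by decide)
  · have hnonneg := root'_nonneg_of_isPos hw_a (v := -(w⁻¹ lam)) fun i hi => by
      rw [map_neg, neg_nonneg]
      exact hm.root'_inv_apply_nonpos hθ hlam hw ⟨i, hi⟩
    rw [map_neg, ← root'_weyl hw, apply_inv_apply] at hnonneg
    linarith

end IsMinimalIn

end Minimality

section Concatenation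

variable [Φ.IsRootSystem]

theorem len_mul_shortest (hθ : IsHighestRoot b θ) (hlam : IsDominant b lam)
    (hm : IsShortest b lam m w) (hu : u ∈ weyl Φ) :
    len b θ (u * m) = len b θ u + len b θ m := by
  have hmem := hm.mem_affRootAut hlam
  have hu' := weyl_le_affRootAut hu
  rw [len_eq hθ (mul_mem hu' hmem), len_eq hθ hu', len_eq hθ hmem,
    ← sum_absRoot_pull hu' fun a => (level b m a).natAbs, ← Finset.sum_add_distrib]
  refine Finset.sum_congr rfl fun a _ => ?_
  rw [level_weyl_mul hu hmem]
  by_cases h : b.IsPos (pull Φ u a)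
  · rw [absRoot_of_isPos h, level_of_isPos h, shift_weyl hu, Int.natAbs_zero, zero_add]
  · have hnonneg := hm.level_nonneg hlam ((isPos_opp b _).2 h)
    rw [absRoot_of_not_isPos h, level_of_not_isPos h, shift_weyl hu]
    rw [level_opp hmem] at hnonneg ⊢
    lia

theorem isReducedExpr_append (hθ : IsHighestRoot b θ) (hlam : IsDominant b lam)
    (hm : IsShortest b lam m w) (hu : u ∈ weyl Φ) {uword mword : List (Option b.support)}
    (hmword : IsReducedExpr b θ mword γ m) (huword : IsReducedExpr b θ uword 1 u) :
    IsReducedExpr b θ (uword ++ mword) γ (u * m) := by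
  rw [isReducedExpr_iff, mul_one] at huword
  rw [isReducedExpr_iff] at hmword ⊢
  refine ⟨hmword.1, ?_, ?_⟩
  · rw [genProd_append, mul_assoc, hmword.2.1, huword.2.1]
  · rw [List.length_append, huword.2.2, hmword.2.2, len_mul_shortest hθ hlam hm hu]

variable [Φ.IsReduced]

theorem isPos_pull_of_level_lt (hθ : IsHighestRoot b θ) (hlam : IsDominant b lam)
    (hm : IsShortest b lam m w) (hu : u ∈ minReps b θ lam)
    (h : level b (u * m) a < level b (1 : N ≃ᵃ[ℝ] N) a) : b.IsPos (pull Φ (u * m) a) := by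
  have hmem := hm.mem_affRootAut hlam
  have hone := level_le_shift (b := b) (1 : N ≃ᵃ[ℝ] N) a
  rw [shift_one] at hone
  rw [level_weyl_mul hu.1 hmem] at h
  rw [pull_mul (weyl_le_affRootAut hu.1) hmem]
  rcases lt_trichotomy (shift Φ m (pull Φ u a)) 0 with hneg | hzero | hpos
  · exact (hm.not_isPos_and_isPos_pull hlam hneg).2
  · have hiff := isPos_pull_iff_of_mem_minReps hθ hlam hu (hm.root'_eq_zero hlam hzero)
    rw [hm.level_of_shift_eq_zero hlam hzero] at h
    refine absurd h (not_lt_of_ge (le_of_eq ?_))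
    by_cases ha : b.IsPos a
    · rw [level_one_of_isPos ha, level_one_of_isPos (hiff.2 ha)]
    · rw [level_one_of_not_isPos ha, level_one_of_not_isPos (mt hiff.1 ha)]
  · rw [hm.level_of_shift_pos hlam hpos] at h
    lia

theorem abs_level_shortest_le (hθ : IsHighestRoot b θ) (hlam : IsDominant b lam)
    (hm : IsShortest b lam m w) (hu : u ∈ minReps b θ lam) (ha : b.IsPos a) :
    |level b m (pull Φ u a)| ≤ |shift Φ m (pull Φ u a)| := by
  rcases lt_trichotomy (shift Φ m (pull Φ u a)) 0 with hneg | hzero | hpos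
  · rw [level_of_isPos (hm.not_isPos_and_isPos_pull hlam hneg).2]
  · have h0 := hm.root'_eq_zero hlam hzero
    rw [hm.level_of_shift_eq_zero hlam hzero, hzero,
      level_one_of_isPos ((isPos_pull_iff_of_mem_minReps hθ hlam hu h0).2 ha)]
  · rw [hm.level_of_shift_pos hlam hpos, abs_of_nonneg (Int.le_sub_one_of_lt hpos),
      abs_of_pos hpos]
    exact Int.sub_le_self _ zero_le_one

end Concatenation

end ShortestElement

section ShortestElementRho

variable [Fintype ι] [Φ.IsCrystallographic] [Φ.IsRootSystem] [Φ.IsReduced] {b : Φ.Base} {θ : ι}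
  {u w m : N ≃ᵃ[ℝ] N} {lam : N}

theorem len_mul_shortest_le (hθ : IsHighestRoot b θ) (hlam : IsDominant b lam)
    (hm : IsShortest b lam m w) (hu : u ∈ minReps b θ lam) :
    (len b θ (u * m) : ℝ) ≤ 2 * Φ.toLinearMap (rho b) lam := by
  have hmem := hm.mem_affRootAut hlam
  have hu' := weyl_le_affRootAut hu.1
  calc (len b θ (u * m) : ℝ) = ∑ a ∈ posRoots b, |(level b m (pull Φ u a) : ℝ)| := by
        rw [len_eq hθ (mul_mem hu' hmem), Nat.cast_sum]
        exact Finset.sum_congr rfl fun a _ => by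
          rw [level_weyl_mul hu.1 hmem, Nat.cast_natAbs, Int.cast_abs]
    _ ≤ ∑ a ∈ posRoots b, |(shift Φ m (pull Φ u a) : ℝ)| := Finset.sum_le_sum fun a ha => by
        exact_mod_cast abs_level_shortest_le hθ hlam hm hu (mem_posRoots.1 ha)
    _ = ∑ a ∈ posRoots b, |Φ.root' (pull Φ u a) lam| := by simp only [hm.shift_eq hlam]
    _ = ∑ a ∈ posRoots b, |Φ.root' a lam| :=
        sum_pull_of_even hu' (fun a => |Φ.root' a lam|) fun a => by rw [root'_opp, abs_neg]
    _ = ∑ a ∈ posRoots b, Φ.root' a lam := Finset.sum_congr rfl fun a ha =>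
        abs_of_nonneg (root'_nonneg_of_isPos (mem_posRoots.1 ha) hlam.root'_nonneg)
    _ = 2 * Φ.toLinearMap (rho b) lam := (two_mul_rho b lam).symm

end ShortestElementRho

section TranslatedWalls

variable [Finite ι] {b : Φ.Base} {θ : ι} {x : N ≃ᵃ[ℝ] N}

theorem wallRoot_trans_mul {μ : N} (hμ : trans μ ∈ affRootAut Φ) (hx : x ∈ affRootAut Φ)
    (t : Option b.support) : wallRoot b θ (trans μ * x) t = wallRoot b θ x t := by
  rw [wallRoot_mul hμ hx, ← pull_trans hμ (pull Φ (trans μ)⁻¹ (wallRoot b θ x t)),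
    pull_pull_inv hμ]

variable [Φ.IsCrystallographic]

theorem wallRoot_affRefl_mul (hx : x ∈ affRootAut Φ) (i : ι) (j : ℤ) (t : Option b.support) :
    wallRoot b θ (affRefl Φ i j * x) t = Φ.reflectionPerm i (wallRoot b θ x t) := by
  rw [wallRoot_mul (affRefl_mem_affRootAut i j) hx,
    inv_eq_of_mul_eq_one_left (affRefl_mul_self i j), pull_affRefl]

end TranslatedWalls

theorem affRefl_mul_affRefl_succ (i : ι) (j : ℤ) :
    affRefl Φ i j * affRefl Φ i (j + 1) = trans (Φ.coroot i) := by
  ext v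
  have hpair : Φ.root' i (Φ.coroot i) = 2 := Φ.root_coroot_two i
  simp only [mul_apply, affRefl_apply_root', map_sub, map_smul, trans_apply, hpair, smul_eq_mul,
    Int.cast_add, Int.cast_one]
  module

theorem trans_mul_trans (μ ν : N) : trans μ * trans ν = trans (μ + ν) := by
  ext v
  rw [mul_apply, trans_apply, trans_apply, trans_apply, add_assoc]

theorem affRefl_mul_trans (a : ι) (k : ℤ) (ν : N) :
    affRefl Φ a k * trans ν = trans (affRefl Φ a k ν) * affRefl Φ a 0 := by
  ext v
  simp only [mul_apply, trans_apply, affRefl_apply_root', map_add, Int.cast_zero]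
  module

namespace Walk

section Toggle

variable {b : Φ.Base} {θ : ι} {p q : Walk b} {k l : ℕ} {s : Option b.support} {m : Move}

/-! ### Exchanging a crossing and a fold -/

theorem toggleAt_of_ne (h : k ≠ l) : (p.toggleAt k).steps[l]? = p.steps[l]? := by
  simp [toggleAt, h]

theorem toggleAt_self (h : p.steps[k]? = some (s, m)) :
    (p.toggleAt k).steps[k]? = some (s, m.toggle) := by
  simp [toggleAt, h]

theorem toggleAt_map_fst (p : Walk b) (k : ℕ) :
    (p.toggleAt k).steps.map Prod.fst = p.steps.map Prod.fst := by
  refine List.ext_getElem? fun l => ?_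
  rw [List.getElem?_map, List.getElem?_map]
  by_cases h : k = l
  · subst h
    cases hst : p.steps[k]? with
    | none => simp [toggleAt, hst]
    | some st => rw [toggleAt_self (s := st.1) (m := st.2) hst]; rfl
  · rw [toggleAt_of_ne h]

theorem toggleAt_length (p : Walk b) (k : ℕ) : (p.toggleAt k).steps.length = p.steps.length := by
  simp [toggleAt]

theorem pos_eq_mul_of_steps_eq {g : N ≃ᵃ[ℝ] N} (hk : q.pos θ k = g * p.pos θ k)
    (h : ∀ n, k ≤ n → n < l → q.steps[n]? = p.steps[n]?) (hl : k ≤ l) :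
    q.pos θ l = g * p.pos θ l := by
  induction l, hl using Nat.le_induction with
  | base => exact hk
  | succ l hl ih =>
    have ih := ih fun n hkn hnl => h n hkn (by lia)
    have hst := h l hl (by lia)
    cases hp : p.steps[l]? with
    | none => rw [hp] at hst; rw [pos_succ_of_none hp, pos_succ_of_none hst, ih]
    | some st =>
      rw [hp] at hst
      obtain ⟨s, _ | _⟩ := st
      · rw [pos_succ_cross hp, pos_succ_cross hst, ih, mul_assoc]
      · rw [pos_succ_fold hp, pos_succ_fold hst, ih]

theorem pos_eq_of_steps_eq (h : ∀ n < l, q.steps[n]? = p.steps[n]?) : q.pos θ l = p.pos θ l := by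
  have heq := pos_eq_mul_of_steps_eq (θ := θ) (k := 0) (g := 1) rfl (fun n _ => h n) (Nat.zero_le l)
  rwa [one_mul] at heq

theorem pos_eq_of_steps_eq_toggleAt (hl : l ≤ k)
    (h : ∀ n < k, q.steps[n]? = (p.toggleAt k).steps[n]?) :
    q.pos θ l = p.pos θ l :=
  pos_eq_of_steps_eq fun n hn => by
    rw [h n (by lia), toggleAt_of_ne (by lia)]

end Toggle

section Critical

variable [Finite ι] [Φ.IsRootSystem] [Φ.IsCrystallographic] [Φ.IsReduced] {b : Φ.Base} {θ i : ι}
  {p q : Walk b} {c k l : ℕ} {j : ℤ} {t : Option b.support} {m : Move}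

/-! ### The critical crossing and the return -/

theorem level_pos_succ_of_ne (hθ : IsHighestRoot b θ)
    (h : ∀ t m, p.steps[l]? = some (t, m) →
      wallRoot b θ (p.pos θ l) t ≠ i ∧ wallRoot b θ (p.pos θ l) t ≠ opp Φ i) :
    level b (p.pos θ (l + 1)) i = level b (p.pos θ l) i := by
  cases hp : p.steps[l]? with
  | none => rw [pos_succ_of_none hp]
  | some st =>
    obtain ⟨t, _ | _⟩ := st
    · obtain ⟨hne, hne'⟩ := h _ _ hp
      rw [pos_succ_cross hp, level_mul_gen_of_ne hθ (pos_mem_affRootAut p l) hne.symm]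
      exact fun e => hne' (opp_involutive.eq_iff.1 e.symm)
    · rw [pos_succ_fold hp]

theorem negCrossingOn_of_level_lt (hθ : IsHighestRoot b θ)
    (h : level b (p.pos θ (l + 1)) i < level b (p.pos θ l) i) :
    p.NegCrossingOn θ l i (-level b (p.pos θ l) i) := by
  cases hp : p.steps[l]? with
  | none => rw [pos_succ_of_none hp] at h; lia
  | some st =>
    obtain ⟨t, _ | _⟩ := st
    · rw [pos_succ_cross hp] at h
      exact (negCrossingOn_iff hθ).2
        ⟨t, hp, eq_wall hθ (pos_mem_affRootAut p l) (neg_neg _).le (by rwa [neg_neg])⟩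
    · rw [pos_succ_fold hp] at h; lia

omit [Finite ι] [Φ.IsRootSystem] [Φ.IsCrystallographic] [Φ.IsReduced] in
theorem NegCrossingOn.lt_length (h : p.NegCrossingOn θ k i j) : k < p.steps.length := by
  obtain ⟨s, hs, -⟩ := h
  exact (List.getElem?_eq_some_iff.1 hs).1

theorem NegCrossingOn.level_eq (hθ : IsHighestRoot b θ) (h : p.NegCrossingOn θ k i j) :
    level b (p.pos θ k) i = -j := by
  obtain ⟨s, -, rfl, rfl⟩ := (negCrossingOn_iff hθ).1 h
  exact level_wallRoot hθ (pos_mem_affRootAut p k) s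

theorem NegCrossingOn.level_succ_eq (hθ : IsHighestRoot b θ) (h : p.NegCrossingOn θ k i j) :
    level b (p.pos θ (k + 1)) i = -j - 1 := by
  obtain ⟨s, hs, rfl, rfl⟩ := (negCrossingOn_iff hθ).1 h
  rw [pos_succ_cross hs]
  exact level_mul_gen_wallRoot hθ (pos_mem_affRootAut p k) s

theorem exists_negCrossingOn (hθ : IsHighestRoot b θ) (hi : b.IsPos i) {n : ℤ} (hn : 1 ≤ n)
    (h : level b (p.pos θ l) i ≤ -n) : ∃ k, p.NegCrossingOn θ k i (n - 1) := by
  induction l with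
  | zero => rw [pos_zero, level_one_of_isPos hi] at h; lia
  | succ l ih =>
    by_cases hle : level b (p.pos θ l) i ≤ -n
    · exact ih hle
    · have hcross := negCrossingOn_of_level_lt (p := p) (l := l) (i := i) hθ (by lia)
      have hsucc := hcross.level_succ_eq hθ
      exact ⟨l, by rwa [show n - 1 = -level b (p.pos θ l) i by lia]⟩

theorem exists_isCritical (hθ : IsHighestRoot b θ) (h : p.NegCrossingOn θ k i j) :
    ∃ d : ℕ × ℤ, p.IsCritical θ i d.1 d.2 := by
  have hfinite : {j' : ℤ | ∃ n, p.NegCrossingOn θ n i j'}.Finite := by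
    refine ((Set.finite_Iio p.steps.length).image fun n => -level b (p.pos θ n) i).subset ?_
    rintro j' ⟨n, hn⟩
    exact ⟨n, hn.lt_length, neg_eq_iff_eq_neg.2 (hn.level_eq hθ)⟩
  obtain ⟨j₀, hj₀, hmax⟩ := Set.exists_max_image _ id hfinite ⟨j, k, h⟩
  exact ⟨(sInf {n | p.NegCrossingOn θ n i j₀}, j₀), ⟨hj₀, hmax⟩, Nat.sInf_mem hj₀,
    fun n hn => Nat.sInf_le hn⟩

/-- Step `l` is of a kind at which the part of the walk reflected by a root operator can end:
`IsReturn θ i c j` singles out the first such step after `c`. -/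
def IsReturnStep (θ : ι) (p : Walk b) (i : ι) (j : ℤ) (l : ℕ) : Prop :=
  p.PosFoldOn θ l i (j + 1) ∨ p.PosCrossingOn θ l i j

omit [Finite ι] [Φ.IsRootSystem] [Φ.IsCrystallographic] [Φ.IsReduced] in
theorem IsReturnStep.lt_length (h : p.IsReturnStep θ i j l) : l < p.steps.length := by
  rcases h with ⟨s, hs, -⟩ | ⟨s, hs, -⟩ <;> exact (List.getElem?_eq_some_iff.1 hs).1

theorem wallRoot_ne_opp_of_not_isReturnStep (hθ : IsHighestRoot b θ) (hi : b.IsPos i)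
    (hp : p.PositivelyFolded θ) (hlevel : level b (p.pos θ l) i = -j - 1)
    (hreturn : ¬ p.IsReturnStep θ i j l) (hst : p.steps[l]? = some (t, m)) :
    wallRoot b θ (p.pos θ l) t ≠ opp Φ i := by
  intro e
  have hx := pos_mem_affRootAut (θ := θ) p l
  have hwall := level_wallRoot hθ hx t
  rw [e, level_opp hx, hlevel] at hwall
  cases m with
  | cross =>
    exact hreturn (Or.inr ((posCrossingOn_iff hθ).2
      ⟨t, hst, by rw [e, opp_involutive], by lia⟩))
  | fold =>
    have hpos := (positivelyFolded_iff hθ).1 hp l t hst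
    rw [e, isPos_opp] at hpos
    exact hpos hi

namespace IsCritical

theorem wallRoot_ne (hθ : IsHighestRoot b θ) (h : p.IsCritical θ i c j)
    (hlevel : level b (p.pos θ l) i = -j - 1) (hreturn : ¬ p.IsReturnStep θ i j l)
    (hst : p.steps[l]? = some (t, m)) : wallRoot b θ (p.pos θ l) t ≠ i := by
  intro e
  have hwall := level_wallRoot hθ (pos_mem_affRootAut (θ := θ) p l) t
  rw [e, hlevel] at hwall
  have hsucc : j + 1 = wallLevel b θ (p.pos θ l) t := by lia
  cases m with
  | cross =>
    have hle := h.1.2 ⟨l, (negCrossingOn_iff hθ).2 ⟨t, hst, e.symm, hsucc⟩⟩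
    lia
  | fold => exact hreturn (Or.inl ((posFoldOn_iff hθ).2 ⟨t, hst, e.symm, hsucc⟩))

theorem level_eq (hθ : IsHighestRoot b θ) (hi : b.IsPos i) (hp : p.PositivelyFolded θ)
    (h : p.IsCritical θ i c j) (hl : c + 1 ≤ l)
    (hreturn : ∀ n, c < n → n < l → ¬ p.IsReturnStep θ i j n) :
    level b (p.pos θ l) i = -j - 1 := by
  induction l, hl using Nat.le_induction with
  | base => exact NegCrossingOn.level_succ_eq hθ h.2.1
  | succ l hl ih =>
    have ih := ih fun n hcn hnl => hreturn n hcn (by lia)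
    have hr := hreturn l (by lia) (by lia)
    rw [level_pos_succ_of_ne hθ fun t m hst => ⟨h.wallRoot_ne hθ ih hr hst,
      wallRoot_ne_opp_of_not_isReturnStep hθ hi hp ih hr hst⟩, ih]

end IsCritical

end Critical

/-! ### The effect of a root operator -/

section Raised

variable {b : Φ.Base} {θ i : ι}
  {p q : Walk b} {c l r : ℕ} {j : ℤ} {t : Option b.support} {m : Move}

/-- The folds of `q` at step `l` are positive, and `q` has a negative crossing there exactly
if `p` has one and `l ≠ c`. This is how a root operator with critical crossing `c` changes a walk
`p` into `q`. -/
structure IsStepRaised (θ : ι) (p q : Walk b) (c l : ℕ) : Prop where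
  isNegCross_iff : q.IsNegCross θ l ↔ p.IsNegCross θ l ∧ l ≠ c
  isPos_of_fold : ∀ t, q.steps[l]? = some (t, .fold) → b.IsPos (wallRoot b θ (q.pos θ l) t)

namespace IsStepRaised

theorem of_fold_cross (hp : p.steps[l]? = some (t, .fold)) (hq : q.steps[l]? = some (t, .cross))
    (h : ¬ b.IsPos (wallRoot b θ (q.pos θ l) t)) : IsStepRaised θ p q c l where
  isNegCross_iff := by
    rw [Walk.isNegCross_iff hp, Walk.isNegCross_iff hq]
    simp [h]
  isPos_of_fold t' ht' := by simp [hq] at ht'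

theorem of_cross_fold (hp : p.steps[l]? = some (t, .cross)) (hq : q.steps[l]? = some (t, .fold))
    (h : b.IsPos (wallRoot b θ (q.pos θ l) t))
    (h' : l = c ∨ ¬ b.IsPos (wallRoot b θ (p.pos θ l) t)) : IsStepRaised θ p q c l where
  isNegCross_iff := by
    rw [Walk.isNegCross_iff hp, Walk.isNegCross_iff hq]
    grind
  isPos_of_fold t' ht' := by
    obtain rfl : t = t' := by simpa [hq] using ht'
    exact h

variable [Finite ι] [Φ.IsRootSystem] [Φ.IsCrystallographic] [Φ.IsReduced]

theorem of_steps_eq (hθ : IsHighestRoot b θ) (hp : p.PositivelyFolded θ)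
    (hst : q.steps[l]? = p.steps[l]?) (hlc : l ≠ c)
    (h : ∀ t m, p.steps[l]? = some (t, m) →
      (b.IsPos (wallRoot b θ (q.pos θ l) t) ↔ b.IsPos (wallRoot b θ (p.pos θ l) t))) :
    IsStepRaised θ p q c l where
  isNegCross_iff := by
    rw [IsNegCross, IsNegCross, hst]
    refine ⟨fun ⟨t, ht, hpos⟩ => ⟨⟨t, ht, (h t _ ht).1 hpos⟩, hlc⟩, ?_⟩
    exact fun ⟨⟨t, ht, hpos⟩, _⟩ => ⟨t, ht, (h t _ ht).2 hpos⟩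
  isPos_of_fold t ht := by
    rw [hst] at ht
    exact (h t _ ht).2 ((positivelyFolded_iff hθ).1 hp l t ht)

end IsStepRaised

/-- The properties of the walk `q` obtained from `p` by a root operator with critical crossing `c`
on `H_{α_i + jδ}`. If the reflected part of the walk never returns, then `q` ends at the
reflection of the end of `p`. -/
structure IsRaised (θ : ι) (p q : Walk b) (i : ι) (c : ℕ) (j : ℤ) : Prop where
  critical : p.IsCritical θ i c j
  map_fst : q.steps.map Prod.fst = p.steps.map Prod.fst
  sheet : q.sheet = p.sheet
  pos_critical : q.pos θ c = p.pos θ c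
  isStepRaised : ∀ l, IsStepRaised θ p q c l
  pos_end :
    (∃ μ, (μ = 0 ∨ μ = Φ.coroot i) ∧
      q.pos θ q.steps.length = trans μ * p.pos θ p.steps.length) ∨
    (q.pos θ q.steps.length = affRefl Φ i j * p.pos θ p.steps.length ∧
      level b (p.pos θ p.steps.length) i = -j - 1)

namespace IsCritical

variable [Finite ι] [Φ.IsRootSystem] [Φ.IsCrystallographic] [Φ.IsReduced]

theorem pos_eq_affRefl_mul (hθ : IsHighestRoot b θ) (h : p.IsCritical θ i c j) (hl : c < l)
    (hagree : ∀ n < l, q.steps[n]? = (p.toggleAt c).steps[n]?) :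
    q.pos θ l = affRefl Φ i j * p.pos θ l := by
  obtain ⟨s, hs, rfl, rfl⟩ := (negCrossingOn_iff hθ).1 h.2.1
  have hc := (hagree c hl).trans (toggleAt_self hs)
  refine pos_eq_mul_of_steps_eq (k := c + 1) ?_ (fun n hcn hnl => ?_) hl
  · rw [pos_succ_fold hc, pos_succ_cross hs, mul_gen_eq_affRefl_mul (pos_mem_affRootAut p c),
      affRefl_mul_cancel_left,
      pos_eq_of_steps_eq_toggleAt le_rfl fun n hn => hagree n (by lia)]
  · rw [hagree n hnl, toggleAt_of_ne (by lia)]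

theorem isStepRaised (hθ : IsHighestRoot b θ) (hi : i ∈ b.support) (hp : p.PositivelyFolded θ)
    (h : p.IsCritical θ i c j) (hagree : ∀ n ≤ max l c, q.steps[n]? = (p.toggleAt c).steps[n]?)
    (hreturn : ∀ n, c < n → n ≤ l → ¬ p.IsReturnStep θ i j n) : IsStepRaised θ p q c l := by
  have hpos := RootPairing.Base.isPos_of_mem_support hi
  obtain ⟨s, hs, hwall, -⟩ := (negCrossingOn_iff hθ).1 h.2.1
  have hbefore : ∀ n ≤ c, q.pos θ n = p.pos θ n := fun n hn =>
    pos_eq_of_steps_eq_toggleAt hn fun n' hn' => hagree n' (by lia)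
  rcases lt_trichotomy l c with hlc | rfl | hlc
  · have hst := (hagree l (le_max_left l c)).trans (toggleAt_of_ne hlc.ne')
    exact .of_steps_eq hθ hp hst hlc.ne fun t m _ => by rw [hbefore l hlc.le]
  · refine .of_cross_fold hs ((hagree l (by lia)).trans (toggleAt_self hs)) ?_ (Or.inl rfl)
    rwa [hbefore l le_rfl, ← hwall]
  · have hst := (hagree l (le_max_left l c)).trans (toggleAt_of_ne hlc.ne)
    refine .of_steps_eq hθ hp hst hlc.ne' fun t m ht => ?_
    have hlevel := h.level_eq hθ hpos hp hlc fun n hcn hnl => hreturn n hcn hnl.le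
    have hr := hreturn l hlc le_rfl
    rw [h.pos_eq_affRefl_mul hθ hlc fun n hn => hagree n (by lia),
      wallRoot_affRefl_mul (pos_mem_affRootAut p l)]
    exact isPos_reflectionPerm_simple hi (h.wallRoot_ne hθ hlevel hr ht)
      (wallRoot_ne_opp_of_not_isReturnStep hθ hpos hp hlevel hr ht)

theorem isRaised_toggleAt (hθ : IsHighestRoot b θ) (hi : i ∈ b.support)
    (hp : p.PositivelyFolded θ) (h : p.IsCritical θ i c j)
    (hreturn : ∀ n, c < n → ¬ p.IsReturnStep θ i j n) : IsRaised θ p (p.toggleAt c) i c j where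
  critical := h
  map_fst := toggleAt_map_fst p c
  sheet := rfl
  pos_critical := pos_eq_of_steps_eq_toggleAt le_rfl fun _ _ => rfl
  isStepRaised l := h.isStepRaised hθ hi hp (fun _ _ => rfl) fun n hcn _ => hreturn n hcn
  pos_end := by
    have hlt := NegCrossingOn.lt_length h.2.1
    rw [toggleAt_length]
    exact Or.inr ⟨h.pos_eq_affRefl_mul hθ hlt fun _ _ => rfl,
      h.level_eq hθ (RootPairing.Base.isPos_of_mem_support hi) hp hlt fun n hcn _ => hreturn n hcn⟩

variable (hθ : IsHighestRoot b θ) (hi : i ∈ b.support) (hp : p.PositivelyFolded θ)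
  (h : p.IsCritical θ i c j)

include hθ h in
theorem pos_toggleAt_toggleAt (hcr : c < r) :
    ((p.toggleAt c).toggleAt r).pos θ r = affRefl Φ i j * p.pos θ r :=
  h.pos_eq_affRefl_mul hθ hcr fun _ hn => toggleAt_of_ne hn.ne'

include hθ hi hp h

theorem isRaised_toggleAt_toggleAt (hr : p.IsReturn θ i c j r) {μ : N}
    (hμ : μ = 0 ∨ μ = Φ.coroot i)
    (hpos : ((p.toggleAt c).toggleAt r).pos θ (r + 1) = trans μ * p.pos θ (r + 1))
    (hstep : IsStepRaised θ p ((p.toggleAt c).toggleAt r) c r) :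
    IsRaised θ p ((p.toggleAt c).toggleAt r) i c j := by
  obtain ⟨⟨hcr, hret : p.IsReturnStep θ i j r⟩, hleast⟩ := hr
  set q := (p.toggleAt c).toggleAt r
  have hbefore : ∀ n < r, q.steps[n]? = (p.toggleAt c).steps[n]? := fun n hn =>
    toggleAt_of_ne hn.ne'
  have hafter : ∀ n, r < n → q.steps[n]? = p.steps[n]? := fun n hn =>
    (toggleAt_of_ne hn.ne).trans (toggleAt_of_ne (hcr.trans hn).ne)
  have hpos_after : ∀ n, r < n → q.pos θ n = trans μ * p.pos θ n := fun n hn =>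
    pos_eq_mul_of_steps_eq hpos (fun n' hn' _ => hafter n' hn') hn
  have htrans : trans μ ∈ affRootAut Φ := trans_mem_affRootAut fun a => by
    rcases hμ with rfl | rfl
    · exact ⟨0, by rw [map_zero, Int.cast_zero]⟩
    · exact ⟨_, root'_coroot a i⟩
  have hlength : q.steps.length = p.steps.length := by
    rw [toggleAt_length, toggleAt_length]
  refine ⟨h, by rw [toggleAt_map_fst, toggleAt_map_fst], rfl,
    pos_eq_of_steps_eq_toggleAt le_rfl fun n hn => hbefore n (hn.trans hcr), fun l => ?_,
    Or.inl ⟨μ, hμ, by rw [hlength]; exact hpos_after _ hret.lt_length⟩⟩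
  rcases lt_trichotomy l r with hlr | rfl | hlr
  · refine h.isStepRaised hθ hi hp (fun n hn => hbefore n (by lia)) fun n hcn hnl hstep => ?_
    have hrn := hleast ⟨hcn, hstep⟩
    lia
  · exact hstep
  · refine .of_steps_eq hθ hp (hafter l hlr) (hcr.trans hlr).ne' fun t m _ => ?_
    rw [hpos_after l hlr, wallRoot_trans_mul htrans (pos_mem_affRootAut p l)]

theorem isRaised_of_posFoldOn (hr : p.IsReturn θ i c j r) (hfold : p.PosFoldOn θ r i (j + 1)) :
    IsRaised θ p ((p.toggleAt c).toggleAt r) i c j := by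
  have hcr : c < r := hr.1.1
  have hpos := h.pos_toggleAt_toggleAt hθ hcr
  have hx := pos_mem_affRootAut (θ := θ) p r
  obtain ⟨t, ht, hwall, hlevel⟩ := (posFoldOn_iff hθ).1 hfold
  have hqt : ((p.toggleAt c).toggleAt r).steps[r]? = some (t, .cross) :=
    toggleAt_self ((toggleAt_of_ne hcr.ne).trans ht)
  refine isRaised_toggleAt_toggleAt hθ hi hp h hr (Or.inr rfl) ?_ (.of_fold_cross ht hqt ?_)
  · rw [pos_succ_cross hqt, pos_succ_fold ht, hpos, mul_assoc, mul_gen_eq_affRefl_mul hx, ← hwall,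
      ← hlevel, ← mul_assoc, affRefl_mul_affRefl_succ]
  · rw [hpos, wallRoot_affRefl_mul hx, ← hwall, ← opp, isPos_opp, not_not]
    exact RootPairing.Base.isPos_of_mem_support hi

theorem isRaised_of_posCrossingOn (hr : p.IsReturn θ i c j r) (hcross : p.PosCrossingOn θ r i j) :
    IsRaised θ p ((p.toggleAt c).toggleAt r) i c j := by
  have hi_pos := RootPairing.Base.isPos_of_mem_support hi
  have hcr : c < r := hr.1.1
  have hpos := h.pos_toggleAt_toggleAt hθ hcr
  have hx := pos_mem_affRootAut (θ := θ) p r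
  obtain ⟨t, ht, hwall, hlevel⟩ := (posCrossingOn_iff hθ).1 hcross
  have hqt : ((p.toggleAt c).toggleAt r).steps[r]? = some (t, .fold) :=
    toggleAt_self ((toggleAt_of_ne hcr.ne).trans ht)
  have hwall : wallRoot b θ (p.pos θ r) t = opp Φ i := opp_involutive.eq_iff.1 hwall.symm
  refine isRaised_toggleAt_toggleAt hθ hi hp h hr (Or.inl rfl) ?_
    (.of_cross_fold ht hqt ?_ (Or.inr ?_))
  · have htrans : (trans 0 : N ≃ᵃ[ℝ] N) = 1 := by
      ext v
      exact zero_add v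
    rw [pos_succ_fold hqt, pos_succ_cross ht, hpos, mul_gen_eq_affRefl_mul hx, hwall,
      ← neg_eq_iff_eq_neg.2 hlevel, affRefl_opp, htrans, one_mul]
  · rwa [hpos, wallRoot_affRefl_mul hx, hwall, reflectionPerm_opp, ← opp, opp_involutive]
  · rwa [hwall, isPos_opp, not_not]

end IsCritical

variable [Finite ι] [Φ.IsRootSystem] [Φ.IsCrystallographic] [Φ.IsReduced]

theorem exists_isRaised (hθ : IsHighestRoot b θ) (hi : i ∈ b.support) (hp : p.PositivelyFolded θ)
    (h : ∃ d : ℕ × ℤ, p.IsCritical θ i d.1 d.2) :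
    ∃ q c j, p.rootOp θ i = some q ∧ IsRaised θ p q i c j := by
  have hcrit := h.choose_spec
  rw [rootOp, dif_pos h]
  by_cases hr : ∃ r, p.IsReturn θ i h.choose.1 h.choose.2 r
  · rw [dif_pos hr]
    refine ⟨_, h.choose.1, h.choose.2, rfl, ?_⟩
    rcases hr.choose_spec.1.2 with hfold | hcross
    · exact hcrit.isRaised_of_posFoldOn hθ hi hp hr.choose_spec hfold
    · exact hcrit.isRaised_of_posCrossingOn hθ hi hp hr.choose_spec hcross
  · rw [dif_neg hr]
    refine ⟨_, _, _, rfl, hcrit.isRaised_toggleAt hθ hi hp fun n hcn hret => hr ?_⟩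
    have hmem : n ∈ {l : ℕ | h.choose.1 < l ∧ p.IsReturnStep θ i h.choose.2 l} := ⟨hcn, hret⟩
    exact ⟨_, Nat.sInf_mem ⟨n, hmem⟩, fun l hl => Nat.sInf_le hl⟩

namespace IsRaised

theorem positivelyFolded (hθ : IsHighestRoot b θ) (h : IsRaised θ p q i c j) :
    q.PositivelyFolded θ :=
  (positivelyFolded_iff hθ).2 fun k => (h.isStepRaised k).isPos_of_fold

theorem dim_eq (hθ : IsHighestRoot b θ) (hi : i ∈ b.support) (h : IsRaised θ p q i c j) :
    q.dim θ = p.dim θ + 1 := by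
  classical
  obtain ⟨s, hs, rfl, -⟩ := (negCrossingOn_iff hθ).1 h.critical.2.1
  have hc : p.IsNegCross θ c := ⟨s, hs, RootPairing.Base.isPos_of_mem_support hi⟩
  have hlength : q.steps.length = p.steps.length := by
    simpa only [List.length_map] using congrArg List.length h.map_fst
  have hcount : Nat.count (q.IsNegCross θ) p.steps.length + 1 =
      Nat.count (p.IsNegCross θ) p.steps.length := by
    have hmem : c ∈ (Finset.range p.steps.length).filter (p.IsNegCross θ) :=
      Finset.mem_filter.2 ⟨Finset.mem_range.2 (NegCrossingOn.lt_length h.critical.2.1), hc⟩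
    rw [Nat.count_eq_card_filter_range, Nat.count_eq_card_filter_range,
      ← Finset.card_erase_add_one hmem]
    congr 2
    ext l
    simp only [Finset.mem_filter, Finset.mem_erase, (h.isStepRaised l).isNegCross_iff]
    tauto
  have htotal_p := count_isPosCross_add_count_isFold_add_count_isNegCross (θ := θ) p le_rfl
  have htotal_q := count_isPosCross_add_count_isFold_add_count_isNegCross (θ := θ) q le_rfl
  rw [hlength] at htotal_q
  rw [dim_eq_count hθ, dim_eq_count hθ, folds, folds, hlength]
  lia

omit [Φ.IsReduced] in
theorem exists_endAlcove_eq (hθ : IsHighestRoot b θ) (h : IsRaised θ p q i c j)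
    (hγ : p.sheet ∈ lengthZero b θ) {ν : N} {w : N ≃ᵃ[ℝ] N} (hw : w ∈ weyl Φ)
    (hend : p.endAlcove θ = trans ν * w) :
    ∃ ν', (ν' = ν ∨ ν' = ν + Φ.coroot i) ∧ ∃ w' ∈ weyl Φ, q.endAlcove θ = trans ν' * w' := by
  have hq {g : N ≃ᵃ[ℝ] N} (hg : q.pos θ q.steps.length = g * p.pos θ p.steps.length) :
      q.endAlcove θ = g * (trans ν * w) := by
    rw [endAlcove, h.sheet, hg, mul_assoc, ← hend, endAlcove]
  rcases h.pos_end with ⟨μ, hμ, hpos⟩ | ⟨hpos, hlevel⟩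
  · refine ⟨ν + μ, hμ.imp (by simp [·]) (by rw [·]), w, hw, ?_⟩
    rw [hq hpos, ← mul_assoc, trans_mul_trans, add_comm]
  · have hlevel_end := (level_endAlcove hθ hγ i).trans hlevel
    have hshift := shift_eq_root'_apply_zero (endAlcove_mem_affRootAut hγ) i
    rw [hend, trans_mul_apply_zero hw, ← hend] at hshift
    have hle := level_le_shift (b := b) (p.endAlcove θ) i
    have hge := shift_le_level_add_one (b := b) (p.endAlcove θ) i
    refine ⟨affRefl Φ i j ν, ?_, affRefl Φ i 0 * w, mul_mem (affRefl_mem_weyl i) hw, ?_⟩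
    · rw [affRefl_apply_root', ← hshift, ← Int.cast_add]
      rcases (by lia : shift Φ (p.endAlcove θ) i + j = 0 ∨ shift Φ (p.endAlcove θ) i + j = -1)
        with hsum | hsum <;> simp [hsum]
    · rw [hq hpos, ← mul_assoc, affRefl_mul_trans, mul_assoc]

end IsRaised

end Raised

end Walk

/-! ### Values of `ρ` -/

section RhoValues

variable [Fintype ι] [Φ.IsCrystallographic] [Φ.IsReduced] {b : Φ.Base} {θ : ι}

theorem rho_coroot {i : ι} (hi : i ∈ b.support) : Φ.toLinearMap (rho b) (Φ.coroot i) = 1 := by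
  classical
  have hpos := RootPairing.Base.isPos_of_mem_support hi
  have hself : Φ.root' i (Φ.coroot i) = 2 := Φ.root_coroot_two i
  have hsum := sum_absRoot_pull (b := b) (affRefl_mem_affRootAut (Φ := Φ) i 0)
    fun a => Φ.root' a (Φ.coroot i)
  have hterm : ∀ a ∈ posRoots b, Φ.root' (absRoot b (pull Φ (affRefl Φ i 0) a)) (Φ.coroot i) =
      (if a = i then 4 else 0) - Φ.root' a (Φ.coroot i) := by
    intro a ha
    rw [mem_posRoots] at ha
    rw [pull_affRefl]
    split_ifs with h
    · rw [h, ← opp, absRoot_of_not_isPos ((isPos_opp b _).not.2 (not_not.2 hpos)),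
        opp_involutive, hself]
      norm_num
    · have hne : a ≠ opp Φ i := fun e => (isPos_opp b i).1 (e ▸ ha) hpos
      rw [absRoot_of_isPos ((isPos_reflectionPerm_simple hi h hne).2 ha), root'_reflectionPerm,
        ← root'_coroot, hself]
      ring
  rw [Finset.sum_congr rfl hterm, Finset.sum_sub_distrib, Finset.sum_ite_eq',
    if_pos (mem_posRoots.2 hpos), ← two_mul_rho] at hsum
  linarith

variable [Φ.IsRootSystem]

theorem rho_longest (hθ : IsHighestRoot b θ) {w₀ : N ≃ᵃ[ℝ] N} (hw₀ : IsLongest b θ w₀) (v : N) :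
    Φ.toLinearMap (rho b) (w₀ v) = -Φ.toLinearMap (rho b) v := by
  have hterm : ∀ a ∈ posRoots b,
      Φ.root' (absRoot b (pull Φ w₀ a)) v = -Φ.root' a (w₀ v) := fun a ha => by
    rw [absRoot_of_not_isPos (hw₀.not_isPos_pull hθ (mem_posRoots.1 ha)), root'_opp,
      root'_weyl hw₀.1]
  have hsum := sum_absRoot_pull (b := b) (weyl_le_affRootAut hw₀.1) fun a => Φ.root' a v
  rw [Finset.sum_congr rfl hterm, Finset.sum_neg_distrib, ← two_mul_rho, ← two_mul_rho] at hsum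
  linarith

theorem Walk.two_mul_dim_add_card_inversions (hθ : IsHighestRoot b θ) {p : Walk b}
    (h : p.sheet ∈ lengthZero b θ) :
    2 * (p.dim θ : ℝ) + (inversions b (p.endAlcove θ)).card =
      p.steps.length + p.folds + 2 * Φ.toLinearMap (rho b) (p.endAlcove θ 0) := by
  have hsum : levelSum b (p.pos θ p.steps.length) = levelSum b (p.endAlcove θ) :=
    Finset.sum_congr rfl fun a _ => (level_endAlcove hθ h a).symm
  have hdim : 2 * (p.dim θ : ℝ) = p.steps.length + p.folds + levelSum b (p.endAlcove θ) := by
    rw [← hsum]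
    exact_mod_cast two_mul_dim hθ p
  rw [hdim, levelSum_eq (endAlcove_mem_affRootAut h)]
  ring

end RhoValues

/-! ### Walks without folds -/

namespace Walk

section Straight

variable {b : Φ.Base} {θ : ι}

/-- The walk of a given type all of whose steps are crossings. -/
def straight (word : List (Option b.support)) (γ : N ≃ᵃ[ℝ] N) : Walk b where
  steps := word.map fun s => (s, .cross)
  sheet := γ

theorem straight_map_fst (word : List (Option b.support)) (γ : N ≃ᵃ[ℝ] N) :
    (straight word γ).steps.map Prod.fst = word := by
  simp [straight, Function.comp_def]

theorem straight_endAlcove (word : List (Option b.support)) (γ : N ≃ᵃ[ℝ] N) :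
    (straight word γ).endAlcove θ = (word.map (gen b θ)).prod * γ := by
  rw [endAlcove, pos, List.take_length, straight, List.map_map]
  rfl

theorem straight_positivelyFolded (word : List (Option b.support)) (γ : N ≃ᵃ[ℝ] N) :
    (straight word γ).PositivelyFolded θ := by
  intro k s hs
  simp [straight] at hs

theorem eq_straight_of_folds_eq_zero {p : Walk b} (h : p.folds = 0) :
    p = straight (p.steps.map Prod.fst) p.sheet := by
  classical
  rw [folds, Nat.count_iff_forall_not] at h
  obtain ⟨steps, sheet⟩ := p
  simp only [straight, mk.injEq, and_true, List.map_map]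
  refine (List.map_id' steps).symm.trans (List.map_congr_left fun st hst => ?_)
  obtain ⟨k, hk⟩ := List.getElem?_of_mem hst
  obtain ⟨s, _ | _⟩ := st
  · rfl
  · exact absurd ⟨s, hk⟩ (h k (IsFold.lt_length (p := ⟨steps, sheet⟩) ⟨s, hk⟩))

end Straight

end Walk

/-! ### Walks of the types `u⃗ · m⃗_λ` -/

section WalkSet

variable [Finite ι] [Φ.IsRootSystem] [Φ.IsCrystallographic] {b : Φ.Base} {θ : ι}
  {lam ν : N} {m w γ : N ≃ᵃ[ℝ] N} {mword : List (Option b.support)}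
  {uword : (N ≃ᵃ[ℝ] N) → List (Option b.support)} {p : Walk b}

theorem level_pos_length_le_of_mem_walkSet (hθ : IsHighestRoot b θ) (hγ : γ ∈ lengthZero b θ)
    (hp : p ∈ walkSet b θ lam mword γ uword ν) (a : ι) :
    (level b (p.pos θ p.steps.length) a : ℝ) ≤ Φ.root' a ν := by
  obtain ⟨-, ⟨u, -, -, rfl⟩, w', hw', hend⟩ := hp
  rw [← Walk.level_endAlcove hθ hγ, ← trans_mul_apply_zero hw' ν, ← hend,
    ← shift_eq_root'_apply_zero (Walk.endAlcove_mem_affRootAut hγ)]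
  exact Int.cast_le.2 (level_le_shift _ _)

variable (hθ : IsHighestRoot b θ) (hlam : IsDominant b lam) (hm : IsShortest b lam m w)
  (hmword : IsReducedExpr b θ mword γ m)
  (huword : ∀ u ∈ minReps b θ lam, IsReducedExpr b θ (uword u) 1 u)

include hθ hlam hm hmword huword

theorem mem_saturatedSet_of_mem_walkSet [Φ.IsReduced]
    (hp : p ∈ walkSet b θ lam mword γ uword ν) :
    ν ∈ saturatedSet b lam := by
  obtain ⟨-, ⟨u, hu, htype, hsheet⟩, w', hw', hend⟩ := hp
  have hred := isReducedExpr_append hθ hlam hm hu.1 hmword (huword u hu)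
  have hstart : (u * m) 0 ∈ saturatedSet b lam := by
    rw [mul_apply, hm.eq_trans_mul, trans_mul_apply_zero hm.mem_weyl]
    exact weyl_apply_mem_saturatedSet hu.1 hlam.mem_saturatedSet
  have hend_zero := (Walk.bruhatLE_endAlcove hθ hred htype hsheet).apply_zero_mem_saturatedSet
    (mul_mem (weyl_le_affRootAut hu.1) (hm.mem_affRootAut hlam)) hstart
  rwa [hend, trans_mul_apply_zero hw'] at hend_zero

theorem straight_endAlcove_of_mem_minReps {u : N ≃ᵃ[ℝ] N} (hu : u ∈ minReps b θ lam) :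
    (Walk.straight (uword u ++ mword) γ).endAlcove θ = trans (u lam) * (u * w) := by
  rw [Walk.straight_endAlcove, (isReducedExpr_append hθ hlam hm hu.1 hmword (huword u hu)).2.1,
    hm.eq_trans_mul, ← mul_assoc, weyl_mul_trans hu.1, mul_assoc]

theorem straight_mem_walkSet {u : N ≃ᵃ[ℝ] N} (hu : u ∈ minReps b θ lam) :
    Walk.straight (uword u ++ mword) γ ∈ walkSet b θ lam mword γ uword (u lam) :=
  ⟨Walk.straight_positivelyFolded _ _, ⟨u, hu, Walk.straight_map_fst _ _, rfl⟩, u * w,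
    mul_mem hu.1 hm.mem_weyl, straight_endAlcove_of_mem_minReps hθ hlam hm hmword huword hu⟩

theorem exists_eq_straight_of_mem_walkSet (hp : p ∈ walkSet b θ lam mword γ uword ν)
    (hfolds : p.folds = 0) :
    ∃ u ∈ minReps b θ lam, u lam = ν ∧ p = Walk.straight (uword u ++ mword) γ := by
  obtain ⟨-, ⟨u, hu, htype, hsheet⟩, w', hw', hend⟩ := hp
  have hstraight := Walk.eq_straight_of_folds_eq_zero hfolds
  rw [htype, hsheet] at hstraight
  refine ⟨u, hu, ?_, hstraight⟩
  rw [hstraight, straight_endAlcove_of_mem_minReps hθ hlam hm hmword huword hu] at hend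
  rw [← trans_mul_apply_zero hw' ν, ← hend, trans_mul_apply_zero (mul_mem hu.1 hm.mem_weyl)]

end WalkSet

/-! ### Walks of maximal dimension -/

section MaximalDimension

variable [Fintype ι] [Φ.IsRootSystem] [Φ.IsCrystallographic] [Φ.IsReduced] {b : Φ.Base} {θ : ι}
  {lam ν : N} {m w w₀ γ : N ≃ᵃ[ℝ] N} {mword : List (Option b.support)}
  {uword : (N ≃ᵃ[ℝ] N) → List (Option b.support)} {p : Walk b}
  (hθ : IsHighestRoot b θ) (hlam : IsDominant b lam) (hm : IsShortest b lam m w)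
  (hmword : IsReducedExpr b θ mword γ m)
  (huword : ∀ u ∈ minReps b θ lam, IsReducedExpr b θ (uword u) 1 u)

include hθ hlam hm hmword huword

theorem dim_le_of_mem_walkSet (hp : p ∈ walkSet b θ lam mword γ uword ν) :
    (p.dim θ : ℝ) ≤ Φ.toLinearMap (rho b) (lam + ν) := by
  obtain ⟨hfold, ⟨u, hu, htype, hsheet⟩, w', hw', hend⟩ := hp
  have hred := isReducedExpr_append hθ hlam hm hu.1 hmword (huword u hu)
  have hfolds : (p.folds : ℝ) ≤ (inversions b (p.endAlcove θ)).card := by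
    exact_mod_cast Walk.folds_le hθ hred (fun c => isPos_pull_of_level_lt hθ hlam hm hu) hfold
      htype hsheet
  have hlength : (p.steps.length : ℝ) ≤ 2 * Φ.toLinearMap (rho b) lam := by
    rw [← List.length_map Prod.fst, htype, hred.2.2]
    exact len_mul_shortest_le hθ hlam hm hu
  have hdim := Walk.two_mul_dim_add_card_inversions hθ (p := p) (hsheet ▸ hmword.1)
  have hend_zero : p.endAlcove θ 0 = ν := by rw [hend, trans_mul_apply_zero hw']
  rw [hend_zero] at hdim
  rw [map_add]
  linarith

omit [Fintype ι] in
theorem dim_eq_zero_of_mem_walkSet_longest [Finite ι] (hw₀ : IsLongest b θ w₀)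
    (hp : p ∈ walkSet b θ lam mword γ uword (w₀ lam)) : p.dim θ = 0 := by
  have := Fintype.ofFinite ι
  have hdim := dim_le_of_mem_walkSet hθ hlam hm hmword huword hp
  rw [map_add, rho_longest hθ hw₀, add_neg_cancel] at hdim
  exact_mod_cast hdim.antisymm (Nat.cast_nonneg _)

theorem dim_eq_of_mem_walkSet_longest (hw₀ : IsLongest b θ w₀)
    (hp : p ∈ walkSet b θ lam mword γ uword (w₀ lam)) :
    (p.dim θ : ℝ) = Φ.toLinearMap (rho b) (lam + w₀ lam) := by
  rw [dim_eq_zero_of_mem_walkSet_longest hθ hlam hm hmword huword hw₀ hp, map_add,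
    rho_longest hθ hw₀, add_neg_cancel, Nat.cast_zero]

omit [Fintype ι] in
theorem existsUnique_mem_walkSet_longest [Finite ι] (hw₀ : IsLongest b θ w₀) :
    ∃! p, p ∈ walkSet b θ lam mword γ uword (w₀ lam) := by
  obtain ⟨u, hu, hlongest⟩ := exists_mem_minReps_apply_eq (b := b) (θ := θ) (lam := lam) hw₀.1
  refine ⟨Walk.straight (uword u ++ mword) γ,
    hlongest ▸ straight_mem_walkSet hθ hlam hm hmword huword hu, fun p hp => ?_⟩
  have hfolds : p.folds = 0 := by
    have hdim := dim_eq_zero_of_mem_walkSet_longest hθ hlam hm hmword huword hw₀ hp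
    rw [Walk.dim_eq_count hθ] at hdim
    exact (Nat.add_eq_zero_iff.1 hdim).2
  obtain ⟨u', hu', hlongest', rfl⟩ :=
    exists_eq_straight_of_mem_walkSet hθ hlam hm hmword huword hp hfolds
  rw [eq_of_mem_minReps_of_apply_eq hθ hlam hu' hu (hlongest'.trans hlongest.symm)]

theorem exists_rootOp_eq_some (hp : p ∈ walkSet b θ lam mword γ uword ν)
    (hdim : (p.dim θ : ℝ) = Φ.toLinearMap (rho b) (lam + ν)) {i : ι} (hi : i ∈ b.support)
    {n l : ℕ} (hl : level b (p.pos θ l) i ≤ -(n + 1 : ℤ)) :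
    ∃ q ∈ walkSet b θ lam mword γ uword (ν + Φ.coroot i), p.rootOp θ i = some q ∧
      (q.dim θ : ℝ) = Φ.toLinearMap (rho b) (lam + (ν + Φ.coroot i)) ∧
      ∃ l, level b (q.pos θ l) i ≤ -(n : ℤ) := by
  obtain ⟨k, hk⟩ := Walk.exists_negCrossingOn hθ (RootPairing.Base.isPos_of_mem_support hi)
    (by lia) hl
  obtain ⟨q, c, j, hq, hr⟩ := Walk.exists_isRaised hθ hi hp.1 (Walk.exists_isCritical hθ hk)
  obtain ⟨-, ⟨u, hu, htype, hsheet⟩, w', hw', hend⟩ := id hp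
  obtain ⟨ν', hν', w'', hw'', hend'⟩ := hr.exists_endAlcove_eq hθ (hsheet ▸ hmword.1) hw' hend
  have hmem : q ∈ walkSet b θ lam mword γ uword ν' :=
    ⟨hr.positivelyFolded hθ, ⟨u, hu, hr.map_fst.trans htype, hr.sheet.trans hsheet⟩, w'', hw'',
      hend'⟩
  have hqdim : (q.dim θ : ℝ) = Φ.toLinearMap (rho b) (lam + ν) + 1 := by
    rw [hr.dim_eq hθ hi, Nat.cast_add, Nat.cast_one, hdim]
  obtain rfl : ν' = ν + Φ.coroot i := by
    refine hν'.resolve_left ?_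
    rintro rfl
    have hle := dim_le_of_mem_walkSet hθ hlam hm hmword huword hmem
    linarith
  refine ⟨q, hmem, hq, ?_, c, ?_⟩
  · rw [hqdim, ← add_assoc, map_add _ (lam + ν), rho_coroot hi]
  · rw [hr.pos_critical, hr.critical.2.1.level_eq hθ]
    have hmax := hr.critical.1.2 ⟨k, hk⟩
    lia

theorem exists_rootOpPow_eq_some {i : ι} (hi : i ∈ b.support) (n : ℕ)
    (hp : p ∈ walkSet b θ lam mword γ uword ν)
    (hdim : (p.dim θ : ℝ) = Φ.toLinearMap (rho b) (lam + ν))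
    {l : ℕ} (hl : level b (p.pos θ l) i ≤ -(n : ℤ)) :
    ∃ q ∈ walkSet b θ lam mword γ uword (ν + n • Φ.coroot i),
      rootOpPow θ i n (some p) = some q ∧
      (q.dim θ : ℝ) = Φ.toLinearMap (rho b) (lam + (ν + n • Φ.coroot i)) := by
  induction n generalizing p ν l with
  | zero =>
    rw [zero_smul, add_zero]
    exact ⟨p, hp, rfl, hdim⟩
  | succ n ih =>
    obtain ⟨q, hq, hop, hqdim, l', hl'⟩ := exists_rootOp_eq_some hθ hlam hm hmword huword hp hdim hi
      (n := n) (l := l) (by exact_mod_cast hl)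
    obtain ⟨r, hr, hpow, hrdim⟩ := ih hq hqdim hl'
    rw [add_assoc, ← succ_nsmul'] at hr hrdim
    refine ⟨r, hr, ?_, hrdim⟩
    rw [rootOpPow, Function.iterate_succ_apply, Option.bind_some, hop]
    exact hpow

theorem exists_stringWalk_eq_some {κ : N} (hp : p ∈ walkSet b θ lam mword γ uword κ)
    (hdim : (p.dim θ : ℝ) = Φ.toLinearMap (rho b) (lam + κ)) (word : List b.support)
    (hν : ν ∈ saturatedSet b lam) (hdesc : descend b lam ν word = κ) :
    ∃ q ∈ walkSet b θ lam mword γ uword ν, stringWalk θ lam p ν word = some q ∧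
      (q.dim θ : ℝ) = Φ.toLinearMap (rho b) (lam + ν) := by
  induction word generalizing ν with
  | nil =>
    obtain rfl : ν = κ := hdesc
    exact ⟨p, hp, rfl, hdim⟩
  | cons i word ih =>
    rw [descend] at hdesc
    rw [stringWalk]
    obtain ⟨q, hq, hstring, hqdim⟩ := ih (sub_maxStep_smul_coroot_mem_saturatedSet i.2 hν) hdesc
    have hmax := root'_le_maxStep hlam i.2 hν
    generalize maxStep b lam ν i = n at hq hstring hqdim hmax ⊢
    have hlevel : level b (q.pos θ q.steps.length) i ≤ -(n : ℤ) := by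
      have hend := level_pos_length_le_of_mem_walkSet hθ hmword.1 hq i
      have hself : Φ.root' i (Φ.coroot i) = 2 := Φ.root_coroot_two i
      rw [map_sub, map_nsmul, hself, nsmul_eq_mul] at hend
      exact_mod_cast (by linarith : (level b (q.pos θ q.steps.length) i : ℝ) ≤ -n)
    obtain ⟨r, hr, hpow, hrdim⟩ :=
      exists_rootOpPow_eq_some hθ hlam hm hmword huword i.2 n hq hqdim hlevel
    rw [sub_add_cancel] at hr hrdim
    exact ⟨r, hr, hstring ▸ hpow, hrdim⟩

theorem exists_stringWalk_eq_some_of_mem_walkSet_longest (hw₀ : IsLongest b θ w₀)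
    {word : List b.support} (hword : IsReducedWord b θ word w₀)
    (hp : p ∈ walkSet b θ lam mword γ uword (w₀ lam)) (hν : ν ∈ saturatedSet b lam) :
    ∃ q ∈ walkSet b θ lam mword γ uword ν, stringWalk θ lam p ν word = some q ∧
      (q.dim θ : ℝ) = Φ.toLinearMap (rho b) (lam + ν) :=
  exists_stringWalk_eq_some hθ hlam hm hmword huword hp
    (dim_eq_of_mem_walkSet_longest hθ hlam hm hmword huword hw₀ hp) word hν
    (descend_longest hθ hw₀ hlam hν hword)

theorem exists_mem_walkSet_dim_eq (hw₀ : IsLongest b θ w₀) (hν : ν ∈ saturatedSet b lam) :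
    ∃ p ∈ walkSet b θ lam mword γ uword ν,
      (p.dim θ : ℝ) = Φ.toLinearMap (rho b) (lam + ν) := by
  obtain ⟨word, hword⟩ := exists_isReducedWord hθ hw₀.1
  obtain ⟨a, ha, -⟩ := existsUnique_mem_walkSet_longest hθ hlam hm hmword huword hw₀
  obtain ⟨p, hp, -, hdim⟩ :=
    exists_stringWalk_eq_some_of_mem_walkSet_longest hθ hlam hm hmword huword hw₀ hword ha hν
  exact ⟨p, hp, hdim⟩

end MaximalDimension

end AlcoveWalks

end

theorem theoremC {ι M N : Type*} [Fintype ι] [AddCommGroup M] [Module ℝ M]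
    [AddCommGroup N] [Module ℝ N] (Φ : RootPairing ι ℝ M N)
    [Φ.IsRootSystem] [Φ.IsCrystallographic] [Φ.IsReduced] [Φ.IsIrreducible]
    (b : Φ.Base) (θ : ι) (hθ : AlcoveWalks.IsHighestRoot b θ)
    (w₀ : N ≃ᵃ[ℝ] N) (hw₀ : AlcoveWalks.IsLongest b θ w₀)
    (lam : N) (hlam : AlcoveWalks.IsDominant b lam)
    (m : N ≃ᵃ[ℝ] N) (hm : AlcoveWalks.IsMinimalIn b θ lam m)
    (mword : List (Option b.support)) (γ : N ≃ᵃ[ℝ] N)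
    (hmword : AlcoveWalks.IsReducedExpr b θ mword γ m)
    (uword : (N ≃ᵃ[ℝ] N) → List (Option b.support))
    (huword : ∀ u ∈ AlcoveWalks.minReps b θ lam, AlcoveWalks.IsReducedExpr b θ (uword u) 1 u)
    (μ : N) (hμ : AlcoveWalks.IsCoweight b μ) :
    -- there are no walks unless `μ ∈ Π_λ`
    (μ ∉ AlcoveWalks.saturatedSet b lam →
      AlcoveWalks.walkSet b θ lam mword γ uword μ = ∅) ∧
    -- if `μ ∈ Π_λ` there is a walk of optimal dimension
    (μ ∈ AlcoveWalks.saturatedSet b lam →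
      ∃ p ∈ AlcoveWalks.walkSet b θ lam mword γ uword μ,
        (p.dim θ : ℝ) = Φ.toLinearMap (AlcoveWalks.rho b) (lam + μ)) ∧
    -- such a walk arises from the antidominant walk, which is the unique walk ending in
    -- `t_{w₀λ} W₀`, by applying the root operators along any reduced word of `w₀`
    (∃! a, a ∈ AlcoveWalks.walkSet b θ lam mword γ uword (w₀ lam)) ∧
    (μ ∈ AlcoveWalks.saturatedSet b lam →
      ∀ word : List b.support, AlcoveWalks.IsReducedWord b θ word w₀ →
      ∀ a ∈ AlcoveWalks.walkSet b θ lam mword γ uword (w₀ lam),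
        ∃ p ∈ AlcoveWalks.walkSet b θ lam mword γ uword μ,
          AlcoveWalks.stringWalk θ lam a μ word = some p ∧
          (p.dim θ : ℝ) = Φ.toLinearMap (AlcoveWalks.rho b) (lam + μ)) ∧
    -- consequently the set of walks is nonempty exactly for `μ ∈ Π_λ`
    ((AlcoveWalks.walkSet b θ lam mword γ uword μ).Nonempty ↔
      μ ∈ AlcoveWalks.saturatedSet b lam) := by
  obtain ⟨w, hw⟩ := hm.exists_isShortest hθ hlam
  have hsub (p) (hp : p ∈ AlcoveWalks.walkSet b θ lam mword γ uword μ) :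
      μ ∈ AlcoveWalks.saturatedSet b lam :=
    AlcoveWalks.mem_saturatedSet_of_mem_walkSet hθ hlam hw hmword huword hp
  have hexists (hsat : μ ∈ AlcoveWalks.saturatedSet b lam) :
      ∃ p ∈ AlcoveWalks.walkSet b θ lam mword γ uword μ,
        (p.dim θ : ℝ) = Φ.toLinearMap (AlcoveWalks.rho b) (lam + μ) :=
    AlcoveWalks.exists_mem_walkSet_dim_eq hθ hlam hw hmword huword hw₀ hsat
  refine ⟨fun hsat => Set.eq_empty_of_forall_notMem fun p hp => hsat (hsub p hp), hexists,
    AlcoveWalks.existsUnique_mem_walkSet_longest hθ hlam hw hmword huword hw₀,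
    fun hsat word hword a ha => ?_, fun ⟨p, hp⟩ => hsub p hp,
    fun hsat => (hexists hsat).imp fun _ => And.left⟩
  exact AlcoveWalks.exists_stringWalk_eq_some_of_mem_walkSet_longest hθ hlam hw hmword huword
    hw₀ hword ha hsat
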